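/- Let $\Lambda$ be the algebra of symmetric functions in countably many variables. A specialization is an algebra homomorphism $\rho:\Lambda\to\mathbb{C}$, and $f(\rho)$ denotes the image of $f\in\Lambda$. A strict partition is a sequence $\lambda_1\ge\lambda_2\ge\cdots$ of nonnegative integers with finitely many nonzero terms (its parts), which are distinct; $l(\lambda)$ is the number and $|\lambda|$ the sum of the parts; $\mu\subset\lambda$ means $\mu_i\le\lambda_i$ for all $i$. The shifted diagram of $\lambda$ is $\{(i,j): i\le j\le\lambda_i+i-1\}$, $i\geq 1$, and for $\mu\subset\lambda$ the shifted skew diagram $\lambda-\mu$ is the difference of the two shifted diagrams. A marked shifted skew tableau of shape $\lambda-\mu$ is a filling of it by letters from $1<1'<2<2'<\cdots$, nonincreasing along rows and columns, such that each unmarked letter occurs at most once in each column and each marked (primed) letter at most once in each row. Put $Q_{\lambda/\mu}=\sum_{\mathcal T}x^{|\mathcal T|}$ if $\mu\subset\lambda$, where the sum is over all such tableaux and the exponent of $x_k$ in $x^{|\mathcal T|}$ is the number of letters $k$ and $k'$ in $\mathcal T$, and $Q_{\lambda/\mu}=0$ otherwise; put $P_{\lambda/\mu}=2^{l(\mu)-l(\lambda)}Q_{\lambda/\mu}$,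 $Q_\lambda=Q_{\lambda/\emptyset}$ and $P_\lambda=P_{\lambda/\emptyset}$. These are elements of $\Lambda$ (the skew Schur $Q$- and $P$-functions). Let $T\ge1$, let $\rho=(\rho_0^+,\rho_1^-,\rho_1^+,\ldots,\rho_{T-1}^+,\rho_T^-)$ be specializations, and for sequences $\lambda=(\lambda^1,\ldots,\lambda^T)$, $\mu=(\mu^1,\ldots,\mu^{T-1})$ of strict partitions let $$W(\lambda,\mu)=Q_{\lambda^1}(\rho_0^+)P_{\lambda^1/\mu^1}(\rho_1^-)Q_{\lambda^2/\mu^1}(\rho_1^+)\cdots Q_{\lambda^T/\mu^{T-1}}(\rho_{T-1}^+)P_{\lambda^T}(\rho_T^-).$$ **Proposition 2.1.** The sum of the weights $W(\lambda,\mu)$ over all pairs of sequences $\lambda,\mu$ of strict partitions is $$Z(\rho)=\prod_{0\le i<j\le T}H(\rho_i^+,\rho_j^-),\qquad H(\rho^+,\rho^-)=\sum_{\lambda\ \mathrm{strict}}Q_\lambda(\rho^+)P_\lambda(\rho^-),$$ in the following two senses. (1) As graded series, for arbitrary specializations: for every $N\ge0$ only finitely many pairs $(\lambda,\mu)$ with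 $\sum_k|\lambda^k|-\sum_k|\mu^k|=N$ have $W(\lambda,\mu)\neq0$, and the sum of their weights is the coefficient of $u^N$ in $$\prod_{0\le i<j\le T}\ \sum_{\lambda\ \mathrm{strict}}Q_\lambda(\rho_i^+)P_\lambda(\rho_j^-)\,u^{|\lambda|}\in\mathbb{C}[[u]].$$ (2) As complex numbers: if $\sum_{\lambda,\mu}W(\lambda,\mu)$ converges absolutely, then each series $H(\rho_i^+,\rho_j^-)$, $0\le i<j\le T$, converges absolutely and $\sum_{\lambda,\mu}W(\lambda,\mu)=\prod_{0\le i<j\le T}H(\rho_i^+,\rho_j^-)$. -/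

import Mathlib

noncomputable section

namespace ShiftedSchur

/-- A strict partition `part 0 ≥ part 1 ≥ …`: a nonincreasing sequence of nonnegative integers
with finitely many nonzero terms (the parts), whose parts are pairwise distinct. -/
@[ext]
structure StrictPartition where
  part : ℕ → ℕ
  antitone : Antitone part
  finite_support : part.support.Finite
  distinct : ∀ i j, i ≠ j → part i ≠ 0 → part i ≠ part j

namespace StrictPartition

/-- The empty partition `∅ = (0, 0, …)`. -/
def empty : StrictPartition where
  part := fun _ => 0
  antitone := fun _ _ _ => le_rfl
  finite_support := by simp [Function.support]
  distinct := fun _ _ _ h => absurd rfl h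

/-- The length `l(λ)`: the number of parts. -/
def length (lam : StrictPartition) : ℕ := lam.part.support.ncard

/-- The size `|λ|`: the sum of the parts. -/
def size (lam : StrictPartition) : ℕ := ∑ᶠ i, lam.part i

/-- `mu ⊂ lam`, i.e. `mu_i ≤ lam_i` for every `i`. -/
def Contained (mu lam : StrictPartition) : Prop := ∀ i, mu.part i ≤ lam.part i

/-- The shifted diagram of `lam`; rows and columns are numbered from `0`, so row `i` consists of
the boxes `(i, j)` with `i ≤ j < lam_i + i`. -/
def shiftedDiagram (lam : StrictPartition) : Set (ℕ × ℕ) :=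
  {c | c.1 ≤ c.2 ∧ c.2 < lam.part c.1 + c.1}

/-- The shifted skew diagram `lam - mu`. -/
def shiftedSkewDiagram (lam mu : StrictPartition) : Set (ℕ × ℕ) :=
  lam.shiftedDiagram \ mu.shiftedDiagram

end StrictPartition

/-- The totally ordered alphabet `1 < 1' < 2 < 2' < ⋯`. The letter `(k, false)` is the unmarked
number `k + 1`, the letter `(k, true)` is the marked number `(k + 1)'`; the order is
lexicographic. -/
abbrev Letter := ℕ ×ₗ Bool

/-- The index `k` of a letter, which stands for the number `|p| = k + 1`. -/
def Letter.index (p : Letter) : ℕ := (ofLex p).1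

/-- Whether a letter carries a prime. -/
def Letter.Marked (p : Letter) : Prop := (ofLex p).2 = true

/-- Marked shifted skew tableaux of shape `lam - mu`: fillings of the shifted skew diagram by
letters, nonincreasing along rows and columns, in which an unmarked letter occurs at most once in
each column and a marked letter at most once in each row. -/
structure MarkedTableau (lam mu : StrictPartition) where
  entry : lam.shiftedSkewDiagram mu → Letter
  row_noninc : ∀ c d, c.1.1 = d.1.1 → c.1.2 ≤ d.1.2 → entry d ≤ entry c
  col_noninc : ∀ c d, c.1.2 = d.1.2 → c.1.1 ≤ d.1.1 → entry d ≤ entry c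
  unmarked_once : ∀ c d, c.1.2 = d.1.2 → entry c = entry d → ¬ (entry c).Marked → c = d
  marked_once : ∀ c d, c.1.1 = d.1.1 → entry c = entry d → (entry c).Marked → c = d

/-- The exponent of the variable with index `k` in the monomial `x ^ |T|`: the number of boxes
whose letter, marked or not, has index `k`. -/
def MarkedTableau.exponent {lam mu : StrictPartition} (t : MarkedTableau lam mu) (k : ℕ) : ℕ :=
  {c | (t.entry c).index = k}.ncard

open Classical in
/-- The skew Schur `Q`-function `∑_T x ^ |T|` as a formal power series in the variables `x_k`,
`k ∈ ℕ` (and `0` if `mu` is not contained in `lam`): the coefficient of `x ^ d` is the number of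
marked shifted tableaux `T` of shape `lam - mu` with `x ^ |T| = x ^ d`. -/
def skewQSeries (lam mu : StrictPartition) : MvPowerSeries ℕ ℚ := fun d =>
  if mu.Contained lam then
    (Nat.card {t : MarkedTableau lam mu // ∀ k, t.exponent k = d k} : ℚ)
  else 0

open Classical in
theorem coeff_skewQSeries (lam mu : StrictPartition) (d : ℕ →₀ ℕ) :
    MvPowerSeries.coeff d (skewQSeries lam mu) =
      if mu.Contained lam then
        (Nat.card {t : MarkedTableau lam mu // ∀ k, t.exponent k = d k} : ℚ)
      else 0 := rfl

/-- A power series in `x_0, x_1, …` is symmetric if its coefficients are invariant under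
permutations of the variables. -/
def IsSymmetricSeries (f : MvPowerSeries ℕ ℚ) : Prop :=
  ∀ (s : Equiv.Perm ℕ) (d : ℕ →₀ ℕ),
    MvPowerSeries.coeff (d.equivMapDomain s) f = MvPowerSeries.coeff d f

/-- A power series of bounded degree. -/
def IsBoundedDegree (f : MvPowerSeries ℕ ℚ) : Prop :=
  ∃ N : ℕ, ∀ d : ℕ →₀ ℕ, MvPowerSeries.coeff d f ≠ 0 → d.degree ≤ N

/-- The algebra `Λ` of symmetric functions: symmetric power series of bounded degree in countably
many variables. -/
def Lambda : Subalgebra ℚ (MvPowerSeries ℕ ℚ) where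
  carrier := {f | IsSymmetricSeries f ∧ IsBoundedDegree f}
  mul_mem' := by
    rintro f g ⟨hf, M, hM⟩ ⟨hg, N, hN⟩
    refine ⟨fun s d => ?_, M + N, fun d hd => ?_⟩
    · rw [MvPowerSeries.coeff_mul, MvPowerSeries.coeff_mul]
      symm
      refine Finset.sum_bij' (fun p _ => (p.1.equivMapDomain s, p.2.equivMapDomain s))
        (fun p _ => (p.1.equivMapDomain s.symm, p.2.equivMapDomain s.symm)) ?_ ?_ ?_ ?_ ?_
      · rintro ⟨a, b⟩ h
        rw [Finset.HasAntidiagonal.mem_antidiagonal] at h ⊢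
        ext k
        simp [← h]
      · rintro ⟨a, b⟩ h
        rw [Finset.HasAntidiagonal.mem_antidiagonal] at h ⊢
        ext k
        simpa using DFunLike.congr_fun h (s k)
      · rintro ⟨a, b⟩ _
        ext k <;> simp
      · rintro ⟨a, b⟩ _
        ext k <;> simp
      · rintro ⟨a, b⟩ _
        simp only [hf s a, hg s b]
    · rw [MvPowerSeries.coeff_mul] at hd
      obtain ⟨⟨a, b⟩, hab, h⟩ := Finset.exists_ne_zero_of_sum_ne_zero hd
      rw [Finset.HasAntidiagonal.mem_antidiagonal] at hab
      rw [← hab, map_add]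
      exact add_le_add (hM a (left_ne_zero_of_mul h)) (hN b (right_ne_zero_of_mul h))
  add_mem' := by
    rintro f g ⟨hf, M, hM⟩ ⟨hg, N, hN⟩
    refine ⟨fun s d => ?_, max M N, fun d hd => ?_⟩
    · rw [map_add, map_add, hf s d, hg s d]
    · by_cases h : MvPowerSeries.coeff d f = 0
      · refine le_max_of_le_right (hN d ?_)
        rwa [map_add, h, zero_add] at hd
      · exact le_max_of_le_left (hM d h)
  algebraMap_mem' := by
    intro r
    refine ⟨fun s d => ?_, 0, fun d hd => ?_⟩
    · have h : d.equivMapDomain s = 0 ↔ d = 0 := by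
        constructor
        · intro h
          ext k
          simpa using DFunLike.congr_fun h (s k)
        · rintro rfl
          ext k
          simp
      simp [MvPowerSeries.algebraMap_apply, MvPowerSeries.coeff_C, h]
    · by_contra h
      apply hd
      have h0 : d ≠ 0 := by
        rintro rfl
        simp at h
      simp [MvPowerSeries.algebraMap_apply, MvPowerSeries.coeff_C, h0]

/-- A specialization: an algebra homomorphism `Λ → ℂ`. -/
abbrev Specialization := Lambda →ₐ[ℚ] ℂ

open Classical in
/-- The skew Schur function `Q_{lam/mu}` as an element of `Λ`. (The series always lies in `Λ`,
which is asserted as part of the theorem, so that the second branch never occurs.) -/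
def skewQ (lam mu : StrictPartition) : Lambda :=
  if h : skewQSeries lam mu ∈ Lambda then ⟨skewQSeries lam mu, h⟩ else 0

/-- The skew Schur function `P_{lam/mu} = 2 ^ (l(mu) - l(lam)) Q_{lam/mu}`. -/
def skewP (lam mu : StrictPartition) : Lambda :=
  ((2 : ℚ) ^ ((mu.length : ℤ) - (lam.length : ℤ))) • skewQ lam mu

/-- `Q_lam = Q_{lam/∅}`. -/
def schurQ (lam : StrictPartition) : Lambda := skewQ lam StrictPartition.empty

/-- `P_lam = P_{lam/∅}`. -/
def schurP (lam : StrictPartition) : Lambda := skewP lam StrictPartition.empty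

/-- The term `Q_lam(a) P_lam(b)` of the series `H(a, b)`. -/
def HTerm (a b : Specialization) (lam : StrictPartition) : ℂ := a (schurQ lam) * b (schurP lam)

/-- `H(a, b) = ∑ Q_lam(a) P_lam(b)`, the sum over all strict partitions `lam` (meaningful when the
terms are absolutely summable). -/
def H (a b : Specialization) : ℂ := ∑' lam, HTerm a b lam

/-- The series `H` graded by degree, `∑ Q_lam(a) P_lam(b) u ^ |lam| ∈ ℂ⟦u⟧`; each coefficient is a
sum over the finitely many strict partitions of a given size. -/
def gradedH (a b : Specialization) : PowerSeries ℂ :=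
  PowerSeries.mk fun N => ∑ᶠ (lam : StrictPartition) (_ : lam.size = N), HTerm a b lam

/-- Pairs `(λ, μ)` of sequences of strict partitions `λ = (λ¹, …, λᵀ)`, `μ = (μ¹, …, μᵀ⁻¹)`, where
`T = n + 1`. Here `λᵏ` is `p.1 (k - 1)` and `μᵏ` is `p.2 (k - 1)`. -/
abbrev PartitionSequences (n : ℕ) := (Fin (n + 1) → StrictPartition) × (Fin n → StrictPartition)

/-- The weight `W(λ, μ) = Q_{λ¹}(ρ₀⁺) P_{λ¹/μ¹}(ρ₁⁻) Q_{λ²/μ¹}(ρ₁⁺) ⋯ Q_{λᵀ/μᵀ⁻¹}(ρ_{T-1}⁺) P_{λᵀ}(ρ_T⁻)`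
with `T = n + 1`, i.e. the product over `k = 0, …, n` of
`Q_{λᵏ⁺¹/μᵏ}(ρₖ⁺) P_{λᵏ⁺¹/μᵏ⁺¹}(ρₖ₊₁⁻)` where `μ⁰ = μᵀ = ∅`.
Here `ρₖ⁺` is `rhoPlus k` and `ρₖ₊₁⁻` is `rhoMinus k`. -/
def W {n : ℕ} (rhoPlus rhoMinus : Fin (n + 1) → Specialization) (p : PartitionSequences n) : ℂ :=
  ∏ k : Fin (n + 1),
    rhoPlus k (skewQ (p.1 k)
        (Fin.cons (α := fun _ => StrictPartition) StrictPartition.empty p.2 k)) *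
      rhoMinus k (skewP (p.1 k)
        (Fin.snoc (α := fun _ => StrictPartition) p.2 StrictPartition.empty k))

/-- The pairs of sequences of degree `N`: those with `∑ |λᵏ| = N + ∑ |μᵏ|`. If `W(λ, μ) ≠ 0`, this
`N` is the sum of the degrees of the `Q`-factors of `W(λ, μ)`, and also that of its
`P`-factors. -/
def ofDegree (n N : ℕ) : Set (PartitionSequences n) :=
  {p | ∑ k, (p.1 k).size = N + ∑ k, (p.2 k).size}

end ShiftedSchur

end

open ShiftedSchur

/-! Let the strict partitions span a Fock space. Let `Q(a)` be the operator with entries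
`Q_{lam/mu}(a)`, a power series in `u` graded by `|lam| - |mu|`, and `P(b)` the lowering operator
with entries `P_{lam/mu}(b)`. The sum of the weights of degree `N` is the coefficient of `u ^ N` in
the vacuum entry of `P(ρ_T⁻) Q(ρ_{T-1}⁺) ⋯ P(ρ_1⁻) Q(ρ_0⁺)` (`finsum_degreeWeight`). The skew Cauchy
identity says that `P(b) Q(a) = H(a, b) Q(a) P(b)` with a scalar series `H(a, b)`
(`seriesP_mul_seriesQ`). Moving every `P` to the right, `P(ρ_j⁻)` meets exactly the `Q(ρ_i⁺)` with
`i < j`, and the ordered product that remains has vacuum entry `1` (`vacuum_chainOp`).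

The skew Cauchy identity is proved from the tableaux. In one variable, `Q_{lam/mu}` is a power of
`2` times a monomial if `mu` interlaces `lam`, and zero otherwise. With partitions encoded as finite
sets and scanned from the largest part down, interlacing becomes a one-bit state, and a sum over an
intermediate partition becomes a product of transfer matrices on four states. The intertwining
relations `upSum_downSum` and `chainSum_swap` yield the relation between the operators adding and
removing a strip (`lowerOp_mul_raiseOp_succ`) and the commutation of the former (`raiseOp_commute`).

Several variables follow formally. Peeling a tableau index by index shows that the coefficients of
`Q_{lam/mu}` are entries of products of strip operators (`card_ofContent`), so the symmetry of
`Q_{lam/mu}` is the commutation of these operators. The scalars in the relation between products of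
lowering and raising operators are never evaluated: their vacuum entries identify them as
coefficients of `∑ Q_lam P_lam` (`lowerMulti_mul_raiseMulti`). An identity in two alphabets then
passes to any two specializations (`sum_specialization_eq`).

For numbers, the terms of each `H(ρ_i⁺, ρ_j⁻)` occur among the weights (`summable_HTerm`), so
absolute convergence of the whole sum gives that of every factor, and the graded identity may be
evaluated at `u = 1`. -/

noncomputable section

namespace ShiftedSchur

/-! ### Strict partitions as finite sets; containment, size and interlacing. -/

namespace StrictPartition

theorem part_succ_lt (lam : StrictPartition) (i : ℕ) :
    lam.part (i + 1) < lam.part i ∨ lam.part (i + 1) = 0 := by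
  by_cases h : lam.part (i + 1) = 0
  · exact Or.inr h
  · exact Or.inl (lt_of_le_of_ne (lam.antitone (Nat.le_succ i))
      (lam.distinct (i + 1) i (by omega) h))

theorem part_lt_of_lt (lam : StrictPartition) {i j : ℕ} (hij : i < j) (h : lam.part j ≠ 0) :
    lam.part j < lam.part i :=
  lt_of_le_of_ne (lam.antitone hij.le) (lam.distinct j i (by omega) h)

theorem exists_part_eq_zero (lam : StrictPartition) : ∃ n, lam.part n = 0 := by
  by_contra h
  push Not at h
  exact Set.infinite_univ (lam.finite_support.subset fun i _ => h i)

/-- A strict partition from a sequence which decreases strictly until it vanishes. -/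
def ofStep (f : ℕ → ℕ) (h : ∀ i, f (i + 1) < f i ∨ f (i + 1) = 0) (hz : ∃ n, f n = 0) :
    StrictPartition where
  part := f
  antitone := antitone_nat_of_succ_le fun i => by have := h i; omega
  finite_support := by
    obtain ⟨n, hn⟩ := hz
    have ha : Antitone f := antitone_nat_of_succ_le fun i => by have := h i; omega
    refine (Set.finite_lt_nat n).subset fun i hi => ?_
    by_contra hc
    have := ha (not_lt.mp hc)
    exact hi (by omega)
  distinct := by
    have ha : Antitone f := antitone_nat_of_succ_le fun i => by have := h i; omega
    have key : ∀ i j, i < j → f j ≠ 0 → f j < f i := fun i j hij hj => by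
      have h1 := h i
      have h2 := ha (Nat.succ_le_of_lt hij)
      simp only [Nat.succ_eq_add_one] at h2
      omega
    intro i j hij hi he
    rcases lt_or_gt_of_ne hij with h' | h'
    · have := key i j h' (he ▸ hi)
      omega
    · have := key j i h' hi
      omega

/-- The finite set of the numbers `m` such that `m + 1` is a part. -/
def support (lam : StrictPartition) : Finset ℕ :=
  lam.finite_support.toFinset.image fun i => lam.part i - 1

theorem mem_support (lam : StrictPartition) (m : ℕ) :
    m ∈ lam.support ↔ ∃ i, lam.part i = m + 1 := by
  simp only [support, Finset.mem_image, Set.Finite.mem_toFinset, Function.mem_support]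
  constructor
  · rintro ⟨i, hi, rfl⟩
    exact ⟨i, by omega⟩
  · rintro ⟨i, hi⟩
    exact ⟨i, by omega, by omega⟩

theorem part_sub_one_injOn (lam : StrictPartition) :
    Set.InjOn (fun i => lam.part i - 1) {i | lam.part i ≠ 0} := by
  intro i hi j hj h
  by_contra hij
  have := lam.distinct i j hij hi
  simp only [Set.mem_ofPred_eq] at hi hj h
  omega

theorem card_support (lam : StrictPartition) : lam.support.card = lam.length := by
  rw [length, Set.ncard_eq_toFinset_card _ lam.finite_support, support]
  exact Finset.card_image_of_injOn fun i hi j hj h =>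
    lam.part_sub_one_injOn (by simpa using hi) (by simpa using hj) h

theorem sum_support (lam : StrictPartition) : ∑ m ∈ lam.support, (m + 1) = lam.size := by
  rw [size, finsum_eq_sum _ lam.finite_support, support, Finset.sum_image]
  · refine Finset.sum_congr rfl fun i hi => ?_
    have : lam.part i ≠ 0 := by simpa using hi
    omega
  · exact fun i hi j hj h =>
    lam.part_sub_one_injOn (by simpa using hi) (by simpa using hj) h

/-- The number of elements of `S` which are at least `m`. -/
def countGE (S : Finset ℕ) (m : ℕ) : ℕ := (S.filter (m ≤ ·)).card

/-- The indices of the parts exceeding `m` form an initial segment, whose length is the count on the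
left. This dictionary recovers a partition from its set and translates inequalities between parts
into inequalities between counts. -/
theorem lt_countGE_support (lam : StrictPartition) (i m : ℕ) :
    i < countGE lam.support m ↔ m < lam.part i := by
  have hfin : {i | m < lam.part i}.Finite :=
    lam.finite_support.subset fun i (hi : m < lam.part i) => by
      simp only [Function.mem_support]; omega
  have h1 : countGE lam.support m = hfin.toFinset.card := by
    symm
    refine Finset.card_bij (fun i _ => lam.part i - 1) ?_ ?_ ?_
    · intro i hi
      simp only [Set.Finite.mem_toFinset, Set.mem_ofPred_eq] at hi
      simp only [Finset.mem_filter, mem_support]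
      exact ⟨⟨i, by omega⟩, by omega⟩
    · intro i hi j hj h
      simp only [Set.Finite.mem_toFinset, Set.mem_ofPred_eq] at hi hj
      exact lam.part_sub_one_injOn (Set.mem_ofPred.2 (by omega)) (Set.mem_ofPred.2 (by omega)) h
    · intro b hb
      simp only [Finset.mem_filter, mem_support] at hb
      obtain ⟨⟨i, hi⟩, hm⟩ := hb
      exact ⟨i, by simp; omega, by omega⟩
  obtain ⟨n, hn⟩ : ∃ n, hfin.toFinset = Finset.range n := by
    classical
    obtain ⟨n, hn⟩ := lam.exists_part_eq_zero
    have hex : ∃ n, lam.part n ≤ m := ⟨n, by omega⟩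
    refine ⟨Nat.find hex, ?_⟩
    ext i
    simp only [Set.Finite.mem_toFinset, Set.mem_ofPred_eq, Finset.mem_range]
    constructor
    · intro hi
      by_contra hc
      have := lam.antitone (not_lt.mp hc)
      have := Nat.find_spec hex
      omega
    · intro hi
      have := Nat.find_min hex hi
      omega
  rw [h1, hn, Finset.card_range]
  have : i ∈ hfin.toFinset ↔ i ∈ Finset.range n := by rw [hn]
  simpa using this.symm

theorem support_injective : Function.Injective support := by
  intro lam mu h
  ext i
  refine le_antisymm ?_ ?_
  · by_contra hc
    have h1 := (lam.lt_countGE_support i (mu.part i)).2 (by omega)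
    rw [h] at h1
    have := (mu.lt_countGE_support i (mu.part i)).1 h1
    omega
  · by_contra hc
    have h1 := (mu.lt_countGE_support i (lam.part i)).2 (by omega)
    rw [← h] at h1
    have := (lam.lt_countGE_support i (lam.part i)).1 h1
    omega

theorem support_surjective : Function.Surjective support := by
  intro S
  induction S using Finset.induction_on_max with
  | empty =>
    refine ⟨empty, ?_⟩
    ext m
    simp [mem_support, empty]
  | insert a S ha ih =>
    obtain ⟨mu, hmu⟩ := ih
    have hlt : ∀ i, mu.part i < a + 1 := by
      intro i
      by_cases h : mu.part i = 0
      · omega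
      · have : mu.part i - 1 ∈ S := by
          rw [← hmu, mem_support]
          exact ⟨i, by omega⟩
        have := ha _ this
        omega
    -- The new maximum `a` stands for the part `a + 1`, which is put in front of the parts of `mu`.
    refine ⟨ofStep (fun i => Nat.casesOn i (a + 1) mu.part) ?_ ?_, ?_⟩
    · rintro (_ | i)
      · exact Or.inl (hlt 0)
      · exact mu.part_succ_lt i
    · obtain ⟨n, hn⟩ := mu.exists_part_eq_zero
      exact ⟨n + 1, hn⟩
    · ext m
      rw [mem_support, Finset.mem_insert, ← hmu, mem_support]
      constructor
      · rintro ⟨_ | i, hi⟩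
        · left
          have : a + 1 = m + 1 := hi
          omega
        · exact Or.inr ⟨i, hi⟩
      · rintro (rfl | ⟨i, hi⟩)
        · exact ⟨0, rfl⟩
        · exact ⟨i + 1, hi⟩

/-- Strict partitions correspond to finite sets. -/
def equivFinset : StrictPartition ≃ Finset ℕ :=
  Equiv.ofBijective support ⟨support_injective, support_surjective⟩

theorem contained_refl (lam : StrictPartition) : lam.Contained lam := fun _ => le_rfl

theorem empty_contained (lam : StrictPartition) : empty.Contained lam := fun _ => Nat.zero_le _

theorem Contained.trans {a b c : StrictPartition} (h : a.Contained b) (h' : b.Contained c) :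
    a.Contained c := fun i => (h i).trans (h' i)

theorem size_eq_sum (lam : StrictPartition) {n : ℕ} (hn : lam.part n = 0) :
    lam.size = ∑ i ∈ Finset.range n, lam.part i := by
  rw [size]
  refine finsum_eq_sum_of_support_subset _ fun i hi => ?_
  simp only [Finset.coe_range, Set.mem_Iio]
  by_contra hc
  have := lam.antitone (not_lt.mp hc)
  exact hi (by omega)

theorem Contained.size_le {mu lam : StrictPartition} (h : mu.Contained lam) :
    mu.size ≤ lam.size := by
  obtain ⟨n, hn⟩ := lam.exists_part_eq_zero
  have hm : mu.part n = 0 := by have := h n; omega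
  rw [lam.size_eq_sum hn, mu.size_eq_sum hm]
  exact Finset.sum_le_sum fun i _ => h i

theorem Contained.eq_of_size_eq {mu lam : StrictPartition} (h : mu.Contained lam)
    (hs : mu.size = lam.size) : mu = lam := by
  obtain ⟨n, hn⟩ := lam.exists_part_eq_zero
  have hm : mu.part n = 0 := by have := h n; omega
  rw [lam.size_eq_sum hn, mu.size_eq_sum hm] at hs
  have := (Finset.sum_eq_sum_iff_of_le fun i _ => h i).1 hs
  ext i
  by_cases hi : i < n
  · exact this i (Finset.mem_range.2 hi)
  · have h1 := lam.antitone (not_lt.mp hi)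
    have h2 := h i
    omega

@[simp]
theorem size_empty : empty.size = 0 := by simp [size, empty]

theorem size_eq_zero {lam : StrictPartition} : lam.size = 0 ↔ lam = empty := by
  constructor
  · intro h
    exact ((empty_contained lam).eq_of_size_eq (by simp [h])).symm
  · rintro rfl
    simp

theorem support_subset_range (lam : StrictPartition) {n : ℕ} (h : lam.size ≤ n) :
    lam.support ⊆ Finset.range n := by
  intro m hm
  have : m + 1 ≤ ∑ m ∈ lam.support, (m + 1) :=
    Finset.single_le_sum (f := fun m => m + 1) (fun _ _ => Nat.zero_le _) hm
  rw [sum_support] at this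
  exact Finset.mem_range.2 (by omega)

/-- The strict partitions of size at most `n`. -/
def sizeLE (n : ℕ) : Finset StrictPartition :=
  ((Finset.range n).powerset.map equivFinset.symm.toEmbedding).filter fun lam => lam.size ≤ n

theorem mem_sizeLE {n : ℕ} {lam : StrictPartition} : lam ∈ sizeLE n ↔ lam.size ≤ n := by
  simp only [sizeLE, Finset.mem_filter, Finset.mem_map, Finset.mem_powerset,
    Equiv.coe_toEmbedding, and_iff_right_iff_imp]
  intro h
  exact ⟨lam.support, lam.support_subset_range h, equivFinset.symm_apply_apply lam⟩

/-- The strict partitions of size `n`. -/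
def ofSize (n : ℕ) : Finset StrictPartition := (sizeLE n).filter fun lam => lam.size = n

theorem mem_ofSize {n : ℕ} {lam : StrictPartition} : lam ∈ ofSize n ↔ lam.size = n := by
  simp only [ofSize, Finset.mem_filter, mem_sizeLE]
  omega

/-- The condition `lam_1 ≥ mu_1 ≥ lam_2 ≥ mu_2 ≥ ⋯`. -/
def Interlaces (mu lam : StrictPartition) : Prop :=
  ∀ i, mu.part i ≤ lam.part i ∧ lam.part (i + 1) ≤ mu.part i

/-- Scanning downwards from the largest part, `lam` is always ahead of `mu` by zero or one. This
single bit is the state of the site model below. -/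
theorem interlaces_iff (mu lam : StrictPartition) : mu.Interlaces lam ↔
    ∀ m, countGE mu.support m ≤ countGE lam.support m ∧
      countGE lam.support m ≤ countGE mu.support m + 1 := by
  constructor
  · intro h m
    constructor
    · by_contra hc
      have h1 := (mu.lt_countGE_support _ m).1 (not_le.mp hc)
      have h2 := (lam.lt_countGE_support _ m).2 (h1.trans_le (h _).1)
      omega
    · by_contra hc
      have h1 := (lam.lt_countGE_support _ m).1 (not_le.mp hc)
      have h2 := (mu.lt_countGE_support _ m).2 (h1.trans_le (h _).2)
      omega
  · intro h i
    constructor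
    · by_contra hc
      have h1 := (mu.lt_countGE_support i (lam.part i)).2 (not_le.mp hc)
      have h2 := (lam.lt_countGE_support i (lam.part i)).1 (h1.trans_le (h _).1)
      omega
    · by_contra hc
      have h1 := (lam.lt_countGE_support (i + 1) (mu.part i)).2 (not_le.mp hc)
      have h2 := (mu.lt_countGE_support i (mu.part i)).1 (by have := (h (mu.part i)).2; omega)
      omega

theorem Interlaces.contained {mu lam : StrictPartition} (h : mu.Interlaces lam) :
    mu.Contained lam := fun i => (h i).1

end StrictPartition

end ShiftedSchur

end

/-! ### Transfer matrices for sums over an intermediate strict partition. -/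

noncomputable section

namespace ShiftedSchur

section SiteModel

variable {R : Type*} [CommRing R]

/-- The weight of a pair of subsets `S`, `K` of `{0, …, M - 1}`: a product of weights attached to
the sites `M - 1, …, 0`. The state `s` records whether one more element of `S` than of `K` has been
met so far. -/
def siteWeight (α β x : R) : ℕ → Bool → Finset ℕ → Finset ℕ → R
  | 0, _, _, _ => 1
  | M + 1, s, S, K =>
    match s, decide (M ∈ S), decide (M ∈ K) with
    | false, false, false => siteWeight α β x M false S K
    | false, true, true => siteWeight α β x M false S K
    | false, true, false => α * x * siteWeight α β x M true S K
    | false, false, true => 0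
    | true, false, false => x * siteWeight α β x M true S K
    | true, true, true => x * siteWeight α β x M true S K
    | true, false, true => β * siteWeight α β x M false S K
    | true, true, false => 0

theorem siteWeight_congr (α β x : R) {M : ℕ} (s : Bool) {S S' K K' : Finset ℕ}
    (hS : ∀ m < M, m ∈ S ↔ m ∈ S') (hK : ∀ m < M, m ∈ K ↔ m ∈ K') :
    siteWeight α β x M s S K = siteWeight α β x M s S' K' := by
  induction M generalizing s with
  | zero => rfl
  | succ M ih =>
    have h : ∀ s, siteWeight α β x M s S K = siteWeight α β x M s S' K' := fun s =>
      ih s (fun m hm => hS m (by omega)) fun m hm => hK m (by omega)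
    simp only [siteWeight, hS M (by omega), hK M (by omega), h]

theorem siteWeight_insert_left (α β x : R) (M : ℕ) (s : Bool) (S K : Finset ℕ) :
    siteWeight α β x M s (insert M S) K = siteWeight α β x M s S K :=
  siteWeight_congr _ _ _ _ (fun m hm => by simp [hm.ne]) fun _ _ => Iff.rfl

theorem siteWeight_insert_right (α β x : R) (M : ℕ) (s : Bool) (S K : Finset ℕ) :
    siteWeight α β x M s S (insert M K) = siteWeight α β x M s S K :=
  siteWeight_congr _ _ _ _ (fun _ _ => Iff.rfl) fun m hm => by simp [hm.ne]

theorem sum_powerset_range_succ {A : Type*} [AddCommMonoid A] (f : Finset ℕ → A) (M : ℕ) :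
    ∑ S ∈ (Finset.range (M + 1)).powerset, f S =
      ∑ S ∈ (Finset.range M).powerset, (f S + f (insert M S)) := by
  rw [Finset.range_add_one, Finset.sum_powerset_insert Finset.notMem_range_self,
    Finset.sum_add_distrib]

/-- The sum over the intermediate sets `S` of the weights of `S` over `K` and of `S` over `N`. -/
def upSum (x y : R) (M : ℕ) (s t : Bool) (K N : Finset ℕ) : R :=
  ∑ S ∈ (Finset.range M).powerset, siteWeight 2 1 x M s S K * siteWeight 1 2 y M t S N

/-- The sum over the intermediate sets `S` of the weights of `N` over `S` and of `K` over `S`. -/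
def downSum (x y : R) (M : ℕ) (s t : Bool) (K N : Finset ℕ) : R :=
  ∑ S ∈ (Finset.range M).powerset, siteWeight 2 1 x M s N S * siteWeight 1 2 y M t K S

/-- The sum over the intermediate sets `S` of the weights of `S` over `K` and of `N` over `S`. -/
def chainSum (x y : R) (M : ℕ) (s t : Bool) (K N : Finset ℕ) : R :=
  ∑ S ∈ (Finset.range M).powerset, siteWeight 2 1 x M s S K * siteWeight 2 1 y M t N S

/-- Splitting the sum according to whether the top site `M` lies in `S` gives one step of a transfer
matrix on the four states `(s, t)`, for each of the four patterns of `M` in `K` and `N`.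
`downSum_succ` and `chainSum_succ` do the same for the other two sums. -/
theorem upSum_succ (x y : R) (M : ℕ) (s t : Bool) (K N : Finset ℕ) :
    upSum x y (M + 1) s t K N =
      match s, t, decide (M ∈ K), decide (M ∈ N) with
      | false, false, false, false =>
        upSum x y M false false K N + 2 * (x * y) * upSum x y M true true K N
      | false, false, true, true => upSum x y M false false K N
      | false, false, false, true => 2 * x * upSum x y M true false K N
      | false, false, true, false => y * upSum x y M false true K N
      | true, true, false, false => x * y * upSum x y M true true K N
      | true, true, true, true =>
        2 * upSum x y M false false K N + x * y * upSum x y M true true K N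
      | true, true, false, true => 2 * x * upSum x y M true false K N
      | true, true, true, false => y * upSum x y M false true K N
      | true, false, false, false => x * upSum x y M true false K N
      | true, false, true, true => x * upSum x y M true false K N
      | true, false, true, false =>
        upSum x y M false false K N + x * y * upSum x y M true true K N
      | true, false, false, true => 0
      | false, true, false, false => y * upSum x y M false true K N
      | false, true, true, true => y * upSum x y M false true K N
      | false, true, false, true =>
        2 * upSum x y M false false K N + 2 * (x * y) * upSum x y M true true K N
      | false, true, true, false => 0 := by
  simp only [upSum, sum_powerset_range_succ, Finset.mul_sum, ← Finset.sum_add_distrib]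
  cases s <;> cases t <;> by_cases hK : M ∈ K <;> by_cases hN : M ∈ N <;>
    simp only [hK, hN, decide_true, decide_false] <;>
    (try refine Finset.sum_congr rfl fun S hS => ?_) <;>
    (try refine Finset.sum_eq_zero fun S hS => ?_) <;>
    (have hM : M ∉ S := fun h => by simpa using Finset.mem_powerset.1 hS h) <;>
    simp only [siteWeight, hM, hK, hN, decide_true, decide_false, Finset.mem_insert_self,
      siteWeight_insert_left] <;> ring

theorem downSum_succ (x y : R) (M : ℕ) (s t : Bool) (K N : Finset ℕ) :
    downSum x y (M + 1) s t K N =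
      match s, t, decide (M ∈ K), decide (M ∈ N) with
      | false, false, false, false => downSum x y M false false K N
      | false, false, true, true =>
        downSum x y M false false K N + 2 * (x * y) * downSum x y M true true K N
      | false, false, false, true => 2 * x * downSum x y M true false K N
      | false, false, true, false => y * downSum x y M false true K N
      | true, true, false, false =>
        2 * downSum x y M false false K N + x * y * downSum x y M true true K N
      | true, true, true, true => x * y * downSum x y M true true K N
      | true, true, false, true => 2 * x * downSum x y M true false K N
      | true, true, true, false => y * downSum x y M false true K N
      | true, false, false, false => x * downSum x y M true false K N
      | true, false, true, true => x * downSum x y M true false K N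
      | true, false, true, false =>
        downSum x y M false false K N + x * y * downSum x y M true true K N
      | true, false, false, true => 0
      | false, true, false, false => y * downSum x y M false true K N
      | false, true, true, true => y * downSum x y M false true K N
      | false, true, false, true =>
        2 * downSum x y M false false K N + 2 * (x * y) * downSum x y M true true K N
      | false, true, true, false => 0 := by
  simp only [downSum, sum_powerset_range_succ, Finset.mul_sum, ← Finset.sum_add_distrib]
  cases s <;> cases t <;> by_cases hK : M ∈ K <;> by_cases hN : M ∈ N <;>
    simp only [hK, hN, decide_true, decide_false] <;>
    (try refine Finset.sum_congr rfl fun S hS => ?_) <;>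
    (try refine Finset.sum_eq_zero fun S hS => ?_) <;>
    (have hM : M ∉ S := fun h => by simpa using Finset.mem_powerset.1 hS h) <;>
    simp only [siteWeight, hM, hK, hN, decide_true, decide_false, Finset.mem_insert_self,
      siteWeight_insert_right] <;> ring

theorem chainSum_succ (x y : R) (M : ℕ) (s t : Bool) (K N : Finset ℕ) :
    chainSum x y (M + 1) s t K N =
      match s, t, decide (M ∈ K), decide (M ∈ N) with
      | false, false, false, false => chainSum x y M false false K N
      | false, false, true, true => chainSum x y M false false K N
      | false, false, false, true =>
        2 * x * chainSum x y M true false K N + 2 * y * chainSum x y M false true K N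
      | false, false, true, false => 0
      | true, true, false, false => x * y * chainSum x y M true true K N
      | true, true, true, true => x * y * chainSum x y M true true K N
      | true, true, false, true => 0
      | true, true, true, false =>
        x * chainSum x y M true false K N + y * chainSum x y M false true K N
      | true, false, false, false => x * chainSum x y M true false K N
      | true, false, true, true =>
        x * chainSum x y M true false K N + 2 * y * chainSum x y M false true K N
      | true, false, true, false => chainSum x y M false false K N
      | true, false, false, true => 2 * (x * y) * chainSum x y M true true K N
      | false, true, false, false =>
        2 * x * chainSum x y M true false K N + y * chainSum x y M false true K N
      | false, true, true, true => y * chainSum x y M false true K N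
      | false, true, true, false => chainSum x y M false false K N
      | false, true, false, true => 2 * (x * y) * chainSum x y M true true K N := by
  simp only [chainSum, sum_powerset_range_succ, Finset.mul_sum, ← Finset.sum_add_distrib]
  cases s <;> cases t <;> by_cases hK : M ∈ K <;> by_cases hN : M ∈ N <;>
    simp only [hK, hN, decide_true, decide_false] <;>
    (try refine Finset.sum_congr rfl fun S hS => ?_) <;>
    (try refine Finset.sum_eq_zero fun S hS => ?_) <;>
    (have hM : M ∉ S := fun h => by simpa using Finset.mem_powerset.1 hS h) <;>
    simp only [siteWeight, hM, hK, hN, decide_true, decide_false, Finset.mem_insert_self,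
      siteWeight_insert_left, siteWeight_insert_right] <;> ring

/-- One fixed matrix intertwines the two families of transfer matrices: it is the identity on the
mixed states and a 2×2 block on the states with `s = t`. Keeping all four components makes the
induction close. The cancellation of `1 + x * y` is needed at the sites that lie in exactly one of
`K` and `N`. -/
theorem upSum_downSum [IsDomain R] {x y : R} (hxy : 1 + x * y ≠ 0) (M : ℕ) (K N : Finset ℕ) :
    (1 - x * y) * upSum x y M false false K N + 2 * (x * y) * upSum x y M true true K N =
        (1 + x * y) * downSum x y M false false K N ∧
      2 * upSum x y M false false K N + (x * y - 1) * upSum x y M true true K N =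
        (1 + x * y) * downSum x y M true true K N ∧
      upSum x y M true false K N = downSum x y M true false K N ∧
      upSum x y M false true K N = downSum x y M false true K N := by
  induction M with
  | zero =>
    simp only [upSum, downSum, siteWeight, Finset.range_zero, Finset.powerset_empty,
      Finset.sum_singleton]
    refine ⟨by ring, by ring, trivial, trivial⟩
  | succ M ih =>
    obtain ⟨h1, h2, h3, h4⟩ := ih
    have h5 : upSum x y M false false K N + x * y * upSum x y M true true K N =
        downSum x y M false false K N + x * y * downSum x y M true true K N :=
      mul_left_cancel₀ hxy (by linear_combination h1 + x * y * h2)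
    by_cases hK : M ∈ K <;> by_cases hN : M ∈ N <;>
      simp only [upSum_succ, downSum_succ, hK, hN, decide_true, decide_false] <;>
      refine ⟨?_, ?_, ?_, ?_⟩
    · linear_combination h1 + 2 * (x * y) * h2
    · linear_combination (x * y) * h2
    · linear_combination x * h3
    · linear_combination y * h4
    · linear_combination (1 + x * y) * y * h4
    · linear_combination (1 + x * y) * y * h4
    · linear_combination h5
    · trivial
    · linear_combination (1 + x * y) * 2 * x * h3
    · linear_combination (1 + x * y) * 2 * x * h3
    · trivial
    · linear_combination 2 * h5
    · linear_combination h1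
    · linear_combination 2 * h1 + (x * y) * h2
    · linear_combination x * h3
    · linear_combination y * h4

/-- Enlarging the range of sites beyond the largest elements of `K` and `N`. -/
theorem upSum_add (x y : R) {M : ℕ} {K N : Finset ℕ} (hK : K ⊆ Finset.range M)
    (hN : N ⊆ Finset.range M) (k : ℕ) :
    (1 - x * y) * upSum x y (M + k) false false K N =
        (1 - x * y) * upSum x y M false false K N +
          (2 * (x * y) - 2 * (x * y) ^ (k + 1)) * upSum x y M true true K N ∧
      upSum x y (M + k) true true K N = (x * y) ^ k * upSum x y M true true K N := by
  induction k with
  | zero => constructor <;> simp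
  | succ k ih =>
    have hK' : M + k ∉ K := fun h => by simpa using hK h
    have hN' : M + k ∉ N := fun h => by simpa using hN h
    rw [← add_assoc]
    simp only [upSum_succ, hK', hN', decide_false]
    constructor
    · linear_combination ih.1 + (1 - x * y) * 2 * (x * y) * ih.2
    · linear_combination x * y * ih.2

/-- A smaller partition has no element above those of `K` and `N`, so there is no geometric tail as
in `upSum_add`. -/
theorem downSum_add (x y : R) {M : ℕ} {K N : Finset ℕ} (hK : K ⊆ Finset.range M)
    (hN : N ⊆ Finset.range M) (k : ℕ) :
    downSum x y (M + k) false false K N = downSum x y M false false K N := by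
  induction k with
  | zero => simp
  | succ k ih =>
    have hK' : M + k ∉ K := fun h => by simpa using hK h
    have hN' : M + k ∉ N := fun h => by simpa using hN h
    rw [← add_assoc]
    simp only [downSum_succ, hK', hN', decide_false, ih]

/-- The skew Cauchy identity in one variable on either side, up to an error of high degree. -/
theorem upSum_eq_downSum [IsDomain R] {x y : R} (hxy : 1 + x * y ≠ 0) {M : ℕ} {K N : Finset ℕ}
    (hK : K ⊆ Finset.range M) (hN : N ⊆ Finset.range M) (k : ℕ) :
    (1 - x * y) * upSum x y (M + k) false false K N =
      (1 + x * y) * downSum x y (M + k) false false K N -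
        2 * (x * y) ^ (k + 1) * upSum x y M true true K N := by
  rw [downSum_add x y hK hN, (upSum_add x y hK hN k).1]
  linear_combination (upSum_downSum hxy M K N).1

/-- Another intertwining relation. Here `s + t` is the lead of `N` over `K`, so only the two states
with `s ≠ t` can mix; the mixing matrix has denominator `x + y`. The first component is what is
used: two one-variable skew `Q`-functions may be composed in either order. -/
theorem chainSum_swap [IsDomain R] {x y : R} (hxy : x + y ≠ 0) (M : ℕ) (K N : Finset ℕ) :
    chainSum x y M false false K N = chainSum y x M false false K N ∧
      chainSum x y M true true K N = chainSum y x M true true K N ∧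
      (x + y) * chainSum x y M true false K N =
        2 * y * chainSum y x M true false K N + (x - y) * chainSum y x M false true K N ∧
      (x + y) * chainSum x y M false true K N =
        (y - x) * chainSum y x M true false K N + 2 * x * chainSum y x M false true K N := by
  induction M with
  | zero =>
    simp only [chainSum, siteWeight, Finset.range_zero, Finset.powerset_empty,
      Finset.sum_singleton]
    refine ⟨trivial, trivial, by ring, by ring⟩
  | succ M ih =>
    obtain ⟨h1, h2, h3, h4⟩ := ih
    have h5 : x * chainSum x y M true false K N + y * chainSum x y M false true K N =
        y * chainSum y x M true false K N + x * chainSum y x M false true K N :=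
      mul_left_cancel₀ hxy (by linear_combination x * h3 + y * h4)
    by_cases hK : M ∈ K <;> by_cases hN : M ∈ N <;>
      simp only [chainSum_succ, hK, hN, decide_true, decide_false] <;>
      refine ⟨?_, ?_, ?_, ?_⟩
    · exact h1
    · linear_combination x * y * h2
    · linear_combination x * h3 + 2 * y * h4
    · linear_combination y * h4
    · trivial
    · linear_combination h5
    · linear_combination (x + y) * h1
    · linear_combination (x + y) * h1
    · linear_combination 2 * h5
    · trivial
    · linear_combination (x + y) * 2 * (x * y) * h2
    · linear_combination (x + y) * 2 * (x * y) * h2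
    · exact h1
    · linear_combination x * y * h2
    · linear_combination x * h3
    · linear_combination 2 * x * h3 + y * h4

open StrictPartition in
theorem countGE_insert {M : ℕ} {S : Finset ℕ} (hS : M ∉ S) (m : ℕ) :
    countGE (insert M S) m = countGE S m + if m ≤ M then 1 else 0 := by
  unfold countGE
  rw [Finset.filter_insert]
  split_ifs with h
  · rw [Finset.card_insert_of_notMem (by simp [hS])]
  · rfl

open StrictPartition in
theorem countGE_eq_zero {M : ℕ} {S : Finset ℕ} (hS : S ⊆ Finset.range M) {m : ℕ} (hm : M ≤ m) :
    countGE S m = 0 := by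
  unfold countGE
  rw [Finset.card_eq_zero, Finset.filter_eq_empty_iff]
  intro j hj
  have := Finset.mem_range.1 (hS hj)
  omega

-- The sites traversed in state `true` contribute one factor `x` each, and their number is the
-- difference of the sums of the two sets, each element `m` counting as `m + 1`. An initial state
-- `true` acts like one more element of `S`, of contribution `M`. The power of `x` on the left
-- avoids a subtraction of exponents.
open StrictPartition Classical in
theorem siteWeight_eq (α β x : R) (M : ℕ) (s : Bool) {S K : Finset ℕ}
    (hS : S ⊆ Finset.range M) (hK : K ⊆ Finset.range M) :
    siteWeight α β x M s S K * x ^ (∑ m ∈ K, (m + 1)) =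
      if ∀ m, countGE K m ≤ countGE S m + s.toNat ∧ countGE S m + s.toNat ≤ countGE K m + 1 then
        α ^ (S \ K).card * β ^ (K \ S).card * x ^ (s.toNat * M + ∑ m ∈ S, (m + 1))
      else 0 := by
  induction M generalizing s S K with
  | zero =>
    obtain rfl : S = ∅ := by simpa using hS
    obtain rfl : K = ∅ := by simpa using hK
    have : ∀ m, countGE ∅ m = 0 := fun m => rfl
    rw [if_pos fun m => by cases s <;> simp [this]]
    simp [siteWeight]
  | succ M ih =>
    have key : ∀ (T : Finset ℕ), T ⊆ Finset.range (M + 1) →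
        ∃ T', T' ⊆ Finset.range M ∧ M ∉ T' ∧ (T = T' ∨ T = insert M T') := by
      intro T hT
      refine ⟨T.erase M, ?_, by simp, ?_⟩
      · rwa [← Finset.subset_insert_iff, ← Finset.range_add_one]
      · by_cases h : M ∈ T
        · exact Or.inr (Finset.insert_erase h).symm
        · exact Or.inl (Finset.erase_eq_of_notMem h).symm
    obtain ⟨S', hS', hMS, hS⟩ := key S hS
    obtain ⟨K', hK', hMK, hK⟩ := key K hK
    have hcS : ∀ m, M ≤ m → countGE S' m = 0 := fun m hm => countGE_eq_zero hS' hm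
    have hcK : ∀ m, M ≤ m → countGE K' m = 0 := fun m hm => countGE_eq_zero hK' hm
    have hnS := hcS M le_rfl
    have hnK := hcK M le_rfl
    -- Transports the induction hypothesis through the factor `f` of the top site, once the
    -- conditions on the counts are matched.
    have cong : ∀ (p q : Prop) (a f b c d : R), a = f * c → (p ↔ q) →
        (c = if p then b else 0) → f * b = d → a = if q then d else 0 := by
      rintro p q a f b c d rfl hpq h rfl
      rw [h]
      simp only [hpq, mul_ite, mul_zero]
    rcases hS with rfl | rfl <;> rcases hK with rfl | rfl <;> cases s
    · simp only [siteWeight, hMS, hMK, decide_false]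
      refine cong _ _ _ 1 _ _ _ (by rw [one_mul]) Iff.rfl (ih false hS' hK') (by simp)
    · simp only [siteWeight, hMS, hMK, decide_false]
      rw [mul_assoc, ih true hS' hK', mul_ite, mul_zero]
      refine if_congr Iff.rfl ?_ rfl
      simp only [Bool.toNat_true]
      ring
    · simp only [siteWeight, hMS, decide_false, Finset.mem_insert_self, decide_true, zero_mul]
      rw [if_neg]
      intro h
      have := h M
      simp only [countGE_insert hMK, hnS, hnK, Bool.toNat_false] at this
      simp at this
    · simp only [siteWeight, hMS, decide_false, Finset.mem_insert_self, decide_true,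
        siteWeight_insert_right]
      rw [Finset.sum_insert hMK, Finset.insert_sdiff_of_notMem _ hMS,
        Finset.card_insert_of_notMem (by simp [hMK]), Finset.sdiff_insert_of_notMem hMS]
      refine cong _ _ _ (β * x ^ (M + 1)) _ _ _ ?_ ?_ (ih false hS' hK') ?_
      · ring
      · refine forall_congr' fun m => ?_
        rw [countGE_insert hMK]
        by_cases hm : m ≤ M
        · simp only [hm, if_true, Bool.toNat_true, Bool.toNat_false]
          omega
        · simp [hm, hcS m (by omega), hcK m (by omega)]
      · simp only [Bool.toNat_true, Bool.toNat_false]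
        ring
    · simp only [siteWeight, hMK, decide_false, Finset.mem_insert_self, decide_true,
        siteWeight_insert_left]
      rw [Finset.sum_insert hMS, Finset.insert_sdiff_of_notMem _ hMK,
        Finset.card_insert_of_notMem (by simp [hMS]), Finset.sdiff_insert_of_notMem hMK]
      refine cong _ _ _ (α * x) _ _ _ ?_ ?_ (ih true hS' hK') ?_
      · ring
      · refine forall_congr' fun m => ?_
        rw [countGE_insert hMS]
        by_cases hm : m ≤ M
        · simp only [hm, if_true, Bool.toNat_true, Bool.toNat_false, add_zero]
        · simp [hm, hcS m (by omega), hcK m (by omega)]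
      · simp only [Bool.toNat_true, Bool.toNat_false]
        ring
    · simp only [siteWeight, hMK, decide_false, Finset.mem_insert_self, decide_true, zero_mul]
      rw [if_neg]
      intro h
      have := h M
      simp only [countGE_insert hMS, hnS, hnK, Bool.toNat_true] at this
      simp at this
    · simp only [siteWeight, Finset.mem_insert_self, decide_true,
        siteWeight_insert_left, siteWeight_insert_right]
      rw [Finset.sum_insert hMS, Finset.sum_insert hMK, Finset.insert_sdiff_insert,
        Finset.insert_sdiff_insert, Finset.sdiff_insert_of_notMem hMS,
        Finset.sdiff_insert_of_notMem hMK]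
      refine cong _ _ _ (x ^ (M + 1)) _ _ _ ?_ ?_ (ih false hS' hK') ?_
      · ring
      · refine forall_congr' fun m => ?_
        rw [countGE_insert hMS, countGE_insert hMK]
        omega
      · simp only [Bool.toNat_false]
        ring
    · simp only [siteWeight, Finset.mem_insert_self, decide_true,
        siteWeight_insert_left, siteWeight_insert_right]
      rw [Finset.sum_insert hMS, Finset.sum_insert hMK, Finset.insert_sdiff_insert,
        Finset.insert_sdiff_insert, Finset.sdiff_insert_of_notMem hMS,
        Finset.sdiff_insert_of_notMem hMK]
      refine cong _ _ _ (x ^ (M + 2)) _ _ _ ?_ ?_ (ih true hS' hK') ?_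
      · ring
      · refine forall_congr' fun m => ?_
        rw [countGE_insert hMS, countGE_insert hMK]
        omega
      · simp only [Bool.toNat_true]
        ring

end SiteModel

end ShiftedSchur

end

/-! ### The skew Cauchy and commutation identities for one-variable functions. -/

noncomputable section

namespace ShiftedSchur

open StrictPartition Polynomial

open Classical in
/-- The coefficient of the one-variable skew `Q`-function. -/
def stripQ (lam mu : StrictPartition) : ℚ :=
  if mu.Interlaces lam then 2 ^ (lam.support \ mu.support).card else 0

open Classical in
/-- The coefficient of the one-variable skew `P`-function. -/
def stripP (lam mu : StrictPartition) : ℚ :=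
  if mu.Interlaces lam then 2 ^ (mu.support \ lam.support).card else 0

theorem contained_of_stripQ_ne_zero {lam mu : StrictPartition} (h : stripQ lam mu ≠ 0) :
    mu.Contained lam := by
  by_contra hc
  exact h (if_neg fun hi => hc hi.contained)

theorem contained_of_stripP_ne_zero {lam mu : StrictPartition} (h : stripP lam mu ≠ 0) :
    mu.Contained lam := by
  by_contra hc
  exact h (if_neg fun hi => hc hi.contained)

/-- The parts occurring in only one of the two partitions satisfy `#(lam \ mu) - #(mu \ lam) =
l(lam) - l(mu)`. -/
theorem stripP_eq (lam mu : StrictPartition) :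
    stripP lam mu = 2 ^ ((mu.length : ℤ) - (lam.length : ℤ)) * stripQ lam mu := by
  unfold stripP stripQ
  split_ifs
  · have h := Finset.card_sdiff_add_card lam.support mu.support
    rw [Finset.union_comm, ← Finset.card_sdiff_add_card, card_support, card_support] at h
    rw [← zpow_natCast, ← zpow_natCast, ← zpow_add₀ (by norm_num)]
    congr 1
    omega
  · simp

theorem interlaces_refl (lam : StrictPartition) : lam.Interlaces lam :=
  fun i => ⟨le_rfl, lam.antitone (Nat.le_succ i)⟩

@[simp]
theorem stripQ_self (lam : StrictPartition) : stripQ lam lam = 1 := by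
  simp [stripQ, interlaces_refl]

@[simp]
theorem stripP_self (lam : StrictPartition) : stripP lam lam = 1 := by
  simp [stripP, interlaces_refl]

open Classical in
theorem siteWeight_support {R : Type*} [CommRing R] (α β x : R) {M : ℕ} {lam mu : StrictPartition}
    (hl : lam.support ⊆ Finset.range M) (hm : mu.support ⊆ Finset.range M) :
    siteWeight α β x M false lam.support mu.support * x ^ mu.size =
      if mu.Interlaces lam then
        α ^ (lam.support \ mu.support).card * β ^ (mu.support \ lam.support).card * x ^ lam.size
      else 0 := by
  rw [← sum_support, ← sum_support, siteWeight_eq _ _ _ _ _ hl hm]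
  refine if_congr ?_ (by simp) rfl
  rw [interlaces_iff]
  simp

theorem siteWeight_X_one {M : ℕ} {lam mu : StrictPartition}
    (hl : lam.support ⊆ Finset.range M) (hm : mu.support ⊆ Finset.range M) :
    siteWeight 2 1 (X : ℚ[X]) M false lam.support mu.support =
      C (stripQ lam mu) * X ^ (lam.size - mu.size) := by
  classical
  refine mul_right_cancel₀ (pow_ne_zero mu.size X_ne_zero) ?_
  rw [siteWeight_support _ _ _ hl hm, stripQ]
  split_ifs with h
  · rw [mul_assoc (C _), ← pow_add, Nat.sub_add_cancel h.contained.size_le]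
    simp [map_ofNat C]
  · simp

theorem siteWeight_one_Q {M : ℕ} {lam mu : StrictPartition}
    (hl : lam.support ⊆ Finset.range M) (hm : mu.support ⊆ Finset.range M) :
    siteWeight 2 1 (1 : ℚ[X]) M false lam.support mu.support = C (stripQ lam mu) := by
  classical
  have := siteWeight_support 2 1 (1 : ℚ[X]) hl hm
  rw [one_pow, mul_one] at this
  rw [this, stripQ]
  split_ifs <;> simp [map_ofNat C]

theorem siteWeight_one_P {M : ℕ} {lam mu : StrictPartition}
    (hl : lam.support ⊆ Finset.range M) (hm : mu.support ⊆ Finset.range M) :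
    siteWeight 1 2 (1 : ℚ[X]) M false lam.support mu.support = C (stripP lam mu) := by
  classical
  have := siteWeight_support 1 2 (1 : ℚ[X]) hl hm
  rw [one_pow, mul_one] at this
  rw [this, stripP]
  split_ifs <;> simp [map_ofNat C]

/-- The strict partitions with parts at most `M`. -/
def partsLE (M : ℕ) : Finset StrictPartition :=
  (Finset.range M).powerset.map equivFinset.symm.toEmbedding

theorem mem_partsLE {M : ℕ} {lam : StrictPartition} :
    lam ∈ partsLE M ↔ lam.support ⊆ Finset.range M := by
  rw [partsLE, Finset.mem_map_equiv, Finset.mem_powerset]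
  rfl

theorem sum_powerset_eq {A : Type*} [AddCommMonoid A] (M : ℕ) (f : Finset ℕ → A) :
    ∑ S ∈ (Finset.range M).powerset, f S = ∑ lam ∈ partsLE M, f lam.support := by
  rw [partsLE, Finset.sum_map]
  refine Finset.sum_congr rfl fun S _ => ?_
  rw [Equiv.coe_toEmbedding]
  exact congrArg f (equivFinset.apply_symm_apply S).symm

/-- The coefficients of the skew Cauchy sum over larger partitions. -/
def upCoeff (mu nu : StrictPartition) (a : ℕ) : ℚ :=
  ∑ lam ∈ ofSize (mu.size + a), stripQ lam mu * stripP lam nu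

/-- The coefficients of the skew Cauchy sum over smaller partitions. -/
def downCoeff (mu nu : StrictPartition) (a : ℕ) : ℚ :=
  ∑ tau ∈ (sizeLE nu.size).filter fun tau => nu.size = tau.size + a, stripQ nu tau * stripP mu tau

/-- With the second variable set to `1`, the power of `X` is `|lam| - |mu|`, so a coefficient
selects the size of the intermediate partition. The bound on `M` ensures that all partitions of this
size are seen by the sum. -/
theorem coeff_upSum {M a : ℕ} {mu nu : StrictPartition} (hmu : mu.support ⊆ Finset.range M)
    (hnu : nu.support ⊆ Finset.range M) (ha : mu.size + a ≤ M) :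
    (upSum (X : ℚ[X]) 1 M false false mu.support nu.support).coeff a = upCoeff mu nu a := by
  rw [upSum, sum_powerset_eq, finsetSum_coeff, upCoeff]
  symm
  have hsub : ofSize (mu.size + a) ⊆ partsLE M := fun lam hl =>
    mem_partsLE.2 (lam.support_subset_range ((mem_ofSize.1 hl).trans_le ha))
  rw [← Finset.sum_subset hsub]
  · refine Finset.sum_congr rfl fun lam hl => ?_
    have hl' := mem_partsLE.1 (hsub hl)
    rw [siteWeight_X_one hl' hmu, siteWeight_one_P hl' hnu, mem_ofSize.1 hl, mul_right_comm,
      ← C_mul, coeff_C_mul_X_pow, if_pos (by omega)]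
  · intro lam hl hl2
    have hl' := mem_partsLE.1 hl
    rw [siteWeight_X_one hl' hmu, siteWeight_one_P hl' hnu, mul_right_comm,
      ← C_mul, coeff_C_mul_X_pow, ite_eq_right_iff]
    intro h
    by_contra hc
    have := (contained_of_stripQ_ne_zero (left_ne_zero_of_mul hc)).size_le
    rw [mem_ofSize] at hl2
    omega

theorem coeff_downSum {M : ℕ} {mu nu : StrictPartition} (hmu : mu.support ⊆ Finset.range M)
    (hnu : nu.support ⊆ Finset.range M) (hM : nu.size ≤ M) (a : ℕ) :
    (downSum (X : ℚ[X]) 1 M false false mu.support nu.support).coeff a = downCoeff mu nu a := by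
  rw [downSum, sum_powerset_eq, finsetSum_coeff, downCoeff]
  symm
  have hsub : ((sizeLE nu.size).filter fun tau => nu.size = tau.size + a) ⊆ partsLE M :=
    fun lam hl => mem_partsLE.2 (lam.support_subset_range
      ((mem_sizeLE.1 (Finset.mem_filter.1 hl).1).trans hM))
  rw [← Finset.sum_subset hsub]
  · refine Finset.sum_congr rfl fun lam hl => ?_
    have hl' := mem_partsLE.1 (hsub hl)
    have := (Finset.mem_filter.1 hl).2
    rw [siteWeight_X_one hnu hl', siteWeight_one_P hmu hl', mul_right_comm,
      ← C_mul, coeff_C_mul_X_pow, if_pos (by omega)]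
  · intro lam hl hl2
    have hl' := mem_partsLE.1 hl
    rw [siteWeight_X_one hnu hl', siteWeight_one_P hmu hl', mul_right_comm,
      ← C_mul, coeff_C_mul_X_pow, ite_eq_right_iff]
    intro h
    by_contra hc
    have := (contained_of_stripQ_ne_zero (left_ne_zero_of_mul hc)).size_le
    rw [Finset.mem_filter, mem_sizeLE] at hl2
    omega

/-- This is the coefficient of `X ^ (a + 1)` in the skew Cauchy identity with its factor `(1 + X) /
(1 - X)` cleared of the denominator. -/
theorem upCoeff_succ (mu nu : StrictPartition) (a : ℕ) :
    upCoeff mu nu (a + 1) = upCoeff mu nu a + downCoeff mu nu (a + 1) + downCoeff mu nu a := by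
  have hmu : mu.support ⊆ Finset.range (mu.size + nu.size) :=
    mu.support_subset_range (Nat.le_add_right _ _)
  have hnu : nu.support ⊆ Finset.range (mu.size + nu.size) :=
    nu.support_subset_range (Nat.le_add_left _ _)
  have hmono : Finset.range (mu.size + nu.size) ⊆ Finset.range (mu.size + nu.size + (a + 1)) :=
    Finset.range_subset_range.2 (by omega)
  have hX : (1 : ℚ[X]) + X * 1 ≠ 0 := by
    intro h
    have := congrArg (eval 0) h
    simp at this
  -- With `a + 1` extra sites the error term is divisible by `X ^ (a + 2)` and does not reach this
  -- coefficient.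
  have key := congrArg (fun p => coeff p (a + 1)) (upSum_eq_downSum hX hmu hnu (a + 1))
  simp only [mul_one, sub_mul, add_mul, one_mul, coeff_sub, coeff_add, coeff_X_mul] at key
  rw [coeff_upSum (hmu.trans hmono) (hnu.trans hmono) (by omega),
    coeff_upSum (hmu.trans hmono) (hnu.trans hmono) (by omega),
    coeff_downSum (hmu.trans hmono) (hnu.trans hmono) (by omega),
    coeff_downSum (hmu.trans hmono) (hnu.trans hmono) (by omega), mul_assoc, coeff_ofNat_mul,
    coeff_X_pow_mul', if_neg (by omega)] at key
  linarith

/-- The coefficient of `X ^ a` in `chainSum_swap` at `(X, 1)`: on one side `X` records the lower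
strip, on the other side the upper one. -/
theorem sum_stripQ_swap (mu nu : StrictPartition) {a b : ℕ} (h : nu.size = mu.size + a + b) :
    ∑ lam ∈ ofSize (mu.size + a), stripQ nu lam * stripQ lam mu =
      ∑ lam ∈ ofSize (mu.size + b), stripQ nu lam * stripQ lam mu := by
  have hmu : mu.support ⊆ Finset.range nu.size := mu.support_subset_range (by omega)
  have hnu : nu.support ⊆ Finset.range nu.size := nu.support_subset_range le_rfl
  have hX : (X : ℚ[X]) + 1 ≠ 0 := X_add_C_ne_zero 1
  have key := congrArg (fun p => coeff p a) (chainSum_swap hX nu.size mu.support nu.support).1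
  simp only [chainSum, sum_powerset_eq, finsetSum_coeff] at key
  have hsub : ∀ c, c = a ∨ c = b → ofSize (mu.size + c) ⊆ partsLE nu.size := fun c hc lam hl =>
    mem_partsLE.2 (lam.support_subset_range (by rw [mem_ofSize.1 hl]; omega))
  rw [← Finset.sum_subset (hsub a (Or.inl rfl)), ← Finset.sum_subset (hsub b (Or.inr rfl))] at key
  · convert key using 1
    · refine Finset.sum_congr rfl fun lam hl => ?_
      have hl' := mem_partsLE.1 (hsub a (Or.inl rfl) hl)
      rw [siteWeight_X_one hl' hmu, siteWeight_one_Q hnu hl', mul_right_comm,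
        ← C_mul, coeff_C_mul_X_pow, mem_ofSize.1 hl, if_pos (by omega), mul_comm]
    · refine Finset.sum_congr rfl fun lam hl => ?_
      have hl' := mem_partsLE.1 (hsub b (Or.inr rfl) hl)
      rw [siteWeight_X_one hnu hl', siteWeight_one_Q hl' hmu, ← mul_assoc,
        ← C_mul, coeff_C_mul_X_pow, mem_ofSize.1 hl, if_pos (by omega), mul_comm]
  · intro lam hl hl2
    have hl' := mem_partsLE.1 hl
    rw [siteWeight_X_one hnu hl', siteWeight_one_Q hl' hmu, ← mul_assoc,
      ← C_mul, coeff_C_mul_X_pow, ite_eq_right_iff]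
    intro h
    by_contra hc
    have := (contained_of_stripQ_ne_zero (right_ne_zero_of_mul hc)).size_le
    rw [mem_ofSize] at hl2
    omega
  · intro lam hl hl2
    have hl' := mem_partsLE.1 hl
    rw [siteWeight_X_one hl' hmu, siteWeight_one_Q hnu hl', mul_right_comm,
      ← C_mul, coeff_C_mul_X_pow, ite_eq_right_iff]
    intro h
    by_contra hc
    have := (contained_of_stripQ_ne_zero (left_ne_zero_of_mul hc)).size_le
    rw [mem_ofSize] at hl2
    omega

end ShiftedSchur

end

/-! ### Products of commuting families indexed by multi-indices, and their commutation relations. -/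

noncomputable section

namespace ShiftedSchur

open Finset.HasAntidiagonal (antidiagonal mem_antidiagonal)

section MultiProd

variable {E : Type*}

theorem pairwise_commute_comp [Monoid E] {F : ℕ → E} (hF : ∀ a b, Commute (F a) (F b))
    (d : ℕ → ℕ) (S : Set ℕ) : S.Pairwise (Function.onFun Commute fun k => F (d k)) :=
  fun _ _ _ _ _ => hF _ _

/-- The product `∏ F (d k)` for a commuting family `F` and a multi-index `d`. -/
def multiProd [Monoid E] (F : ℕ → E) (hF : ∀ a b, Commute (F a) (F b)) (d : ℕ →₀ ℕ) : E :=
  d.support.noncommProd (fun k => F (d k)) (pairwise_commute_comp hF d _)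

@[simp]
theorem multiProd_zero [Monoid E] (F : ℕ → E) (hF : ∀ a b, Commute (F a) (F b)) :
    multiProd F hF 0 = 1 :=
  (Finset.noncommProd_congr Finsupp.support_zero (fun _ _ => rfl) _).trans
    (Finset.noncommProd_empty _ _)

/-- Since `F 0 = 1`, the case `a = 0`, in which the support does not grow, needs no exception.
Together with `finsupp_induction_add_single` this lets one coordinate be added at a time. -/
theorem multiProd_add_single [Monoid E] (F : ℕ → E) (hF : ∀ a b, Commute (F a) (F b))
    (h0 : F 0 = 1) {d : ℕ →₀ ℕ} {k : ℕ} (hk : d k = 0) (a : ℕ) :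
    multiProd F hF (d + Finsupp.single k a) = F a * multiProd F hF d := by
  by_cases ha : a = 0
  · simp [ha, h0]
  have hs : (d + Finsupp.single k a).support = insert k d.support := by
    ext i
    by_cases hi : i = k
    · simp [hi, ha]
    · simp [hi]
  have hval : ∀ i ∈ d.support, F ((d + Finsupp.single k a) i) = F (d i) := by
    intro i hi
    have : k ≠ i := by
      rintro rfl
      simp [hk] at hi
    simp [this]
  refine (Finset.noncommProd_congr hs (fun _ _ => rfl) _).trans
    ((Finset.noncommProd_insert_of_notMem _ _ _ (pairwise_commute_comp hF _ _)
      (by simp [hk])).trans ?_)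
  congr 1
  · simp [hk]
  · exact Finset.noncommProd_congr rfl hval _

theorem multiProd_equivMapDomain [Monoid E] (F : ℕ → E) (hF : ∀ a b, Commute (F a) (F b))
    (s : Equiv.Perm ℕ) (d : ℕ →₀ ℕ) :
    multiProd F hF (d.equivMapDomain s) = multiProd F hF d := by
  have h : (d.equivMapDomain s).support = d.support.map s.toEmbedding := by
    ext i
    simp [Finset.mem_map_equiv]
  unfold multiProd
  rw [Finset.noncommProd_congr h (fun _ _ => rfl)]
  unfold Finset.noncommProd
  congr 1
  rw [Finset.map_val, Multiset.map_map]
  refine Multiset.map_congr rfl fun i _ => ?_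
  simp

theorem multiProd_map [Monoid E] {E' G : Type*} [Monoid E'] [FunLike G E E'] [MonoidHomClass G E E']
    (g : G) (F : ℕ → E) (hF : ∀ a b, Commute (F a) (F b)) (d : ℕ →₀ ℕ) :
    multiProd (fun a => g (F a)) (fun a b => (hF a b).map g) d = g (multiProd F hF d) :=
  (Finset.map_noncommProd _ _ _ g).symm

theorem multiProd_commute [Monoid E] (F : ℕ → E) (hF : ∀ a b, Commute (F a) (F b)) {z : E}
    (hz : ∀ a, Commute z (F a)) (d : ℕ →₀ ℕ) : Commute z (multiProd F hF d) :=
  Finset.noncommProd_commute _ _ _ _ fun _ _ => hz _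

theorem sum_antidiagonal_add_single {A : Type*} [AddCommMonoid A] {d : ℕ →₀ ℕ} {k : ℕ}
    (hk : d k = 0) (a : ℕ) (f : (ℕ →₀ ℕ) × (ℕ →₀ ℕ) → A) :
    ∑ p ∈ antidiagonal (d + Finsupp.single k a), f p =
      ∑ q ∈ antidiagonal a, ∑ p ∈ antidiagonal d,
        f (p.1 + Finsupp.single k q.1, p.2 + Finsupp.single k q.2) := by
  rw [← Finset.sum_product']
  have key : ∀ (u : ℕ →₀ ℕ), u.erase k + Finsupp.single k (u k) = u := fun u =>
    Finsupp.erase_add_single k u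
  refine Finset.sum_bij' (fun p _ => ((p.1 k, p.2 k), (p.1.erase k, p.2.erase k)))
    (fun x _ => (x.2.1 + Finsupp.single k x.1.1, x.2.2 + Finsupp.single k x.1.2)) ?_ ?_ ?_ ?_ ?_
  · rintro ⟨p, q⟩ h
    rw [mem_antidiagonal] at h
    simp only [Finset.mem_product, mem_antidiagonal]
    constructor
    · have := DFunLike.congr_fun h k
      simpa [hk] using this
    · ext i
      by_cases hi : i = k
      · simp [hi, hk]
      · have := DFunLike.congr_fun h i
        simpa [hi, Finsupp.single_apply, Ne.symm hi] using this
  · rintro ⟨⟨i, j⟩, p, q⟩ h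
    simp only [Finset.mem_product, mem_antidiagonal] at h ⊢
    rw [← h.1, ← h.2, Finsupp.single_add]
    abel
  · rintro ⟨p, q⟩ _
    simp [key]
  · rintro ⟨⟨i, j⟩, p, q⟩ h
    simp only [Finset.mem_product, mem_antidiagonal] at h
    have h2 := DFunLike.congr_fun h.2 k
    simp only [Finsupp.add_apply, hk, Nat.add_eq_zero_iff] at h2
    have he : ∀ (u : ℕ →₀ ℕ) (c : ℕ), u k = 0 → (u + Finsupp.single k c).erase k = u := by
      intro u c hu
      ext i
      by_cases hi : i = k
      · simp [hi, hu]
      · simp [hi]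
    simp [he, h2.1, h2.2]
  · rintro ⟨p, q⟩ _
    simp [key]

theorem apply_eq_zero_of_mem_antidiagonal {d : ℕ →₀ ℕ} {k : ℕ} (hk : d k = 0)
    {p : (ℕ →₀ ℕ) × (ℕ →₀ ℕ)} (hp : p ∈ antidiagonal d) : p.1 k = 0 ∧ p.2 k = 0 := by
  rw [mem_antidiagonal] at hp
  have := DFunLike.congr_fun hp k
  simpa [hk] using this

theorem finsupp_induction_add_single {p : (ℕ →₀ ℕ) → Prop} (h0 : p 0)
    (h : ∀ (d : ℕ →₀ ℕ) (k a : ℕ), d k = 0 → p d → p (d + Finsupp.single k a)) (d : ℕ →₀ ℕ) :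
    p d := by
  refine Finsupp.induction d h0 fun k a f hk _ hf => ?_
  rw [add_comm]
  exact h f k a (Finsupp.notMem_support_iff.1 hk) hf

/-- Moving an element past a product of a commuting family, given how it moves past the
factors. -/
theorem mul_multiProd [Semiring E] {z : E} {F h : ℕ → E} (hF : ∀ a b, Commute (F a) (F b))
    (hh : ∀ a x, Commute (h a) x) (hF0 : F 0 = 1) (hh0 : h 0 = 1)
    (hz : ∀ a, z * F a = ∑ q ∈ antidiagonal a, h q.1 * (F q.2 * z)) (d : ℕ →₀ ℕ) :
    z * multiProd F hF d = ∑ p ∈ antidiagonal d,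
      multiProd h (fun a b => hh a (h b)) p.1 * (multiProd F hF p.2 * z) := by
  induction d using finsupp_induction_add_single with
  | h0 => simp
  | h d k a hk ih =>
    rw [multiProd_add_single _ _ hF0 hk, ← mul_assoc, hz, Finset.sum_mul,
      sum_antidiagonal_add_single hk]
    refine Finset.sum_congr rfl fun q _ => ?_
    rw [mul_assoc, mul_assoc, ih, Finset.mul_sum, Finset.mul_sum]
    refine Finset.sum_congr rfl fun p hp => ?_
    obtain ⟨h1, h2⟩ := apply_eq_zero_of_mem_antidiagonal hk hp
    rw [multiProd_add_single _ _ hh0 h1, multiProd_add_single _ _ hF0 h2]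
    have hc := (multiProd_commute h (fun a b => hh a (h b)) (z := F q.2)
      (fun b => (hh b _).symm) p.1).eq
    simp only [mul_assoc]
    rw [← mul_assoc (F q.2), hc, mul_assoc]

/-- The mirror image of `mul_multiProd`; the two together move a product of one family past a
product of another. -/
theorem multiProd_mul [Semiring E] {z : E} {F h : ℕ → E} (hF : ∀ a b, Commute (F a) (F b))
    (hh : ∀ a x, Commute (h a) x) (hF0 : F 0 = 1) (hh0 : h 0 = 1)
    (hz : ∀ a, F a * z = ∑ q ∈ antidiagonal a, h q.1 * (z * F q.2)) (d : ℕ →₀ ℕ) :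
    multiProd F hF d * z = ∑ p ∈ antidiagonal d,
      multiProd h (fun a b => hh a (h b)) p.1 * (z * multiProd F hF p.2) := by
  induction d using finsupp_induction_add_single with
  | h0 => simp
  | h d k a hk ih =>
    rw [multiProd_add_single _ _ hF0 hk, (multiProd_commute F hF (hF a) d).eq, mul_assoc, hz,
      Finset.mul_sum, sum_antidiagonal_add_single hk]
    refine Finset.sum_congr rfl fun q _ => ?_
    have hc := (multiProd_commute F hF (fun b => (hh q.1 (F b))) d).eq
    rw [← mul_assoc, ← hc, mul_assoc, ← mul_assoc (multiProd F hF d), ih, Finset.sum_mul,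
      Finset.mul_sum]
    refine Finset.sum_congr rfl fun p hp => ?_
    obtain ⟨h1, h2⟩ := apply_eq_zero_of_mem_antidiagonal hk hp
    rw [multiProd_add_single _ _ hh0 h1, multiProd_add_single _ _ hF0 h2,
      (multiProd_commute F hF (hF q.2) p.2).eq]
    simp only [mul_assoc]

/-- Solving the recursion satisfied by the commutators of two families. -/
theorem mul_eq_sum_antidiagonal_of_recursion [Ring E] {z y : E} {U : ℕ → E} (hU0 : U 0 = 1)
    (hz : ∀ a, z * U (a + 1) = y * (z * U a) + U (a + 1) * z + y * (U a * z)) (a : ℕ) :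
    z * U a = ∑ q ∈ antidiagonal a,
      (if q.1 = 0 then 1 else 2 * y ^ q.1) * (U q.2 * z) := by
  induction a with
  | zero => simp [hU0]
  | succ a ih =>
    -- The coefficients `1, 2 y, 2 y ^ 2, …` are those of `(1 + y t) / (1 - y t)`. Each is `y` times
    -- the previous one, except that `2 y = y * 1 + y`, whence the extra term.
    have key : ∀ b, ∑ q ∈ antidiagonal b, (2 * y ^ (q.1 + 1)) * (U q.2 * z) =
        y * (∑ q ∈ antidiagonal b, (if q.1 = 0 then 1 else 2 * y ^ q.1) * (U q.2 * z)) +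
          y * (U b * z) := by
      intro b
      cases b with
      | zero => simp [hU0]; noncomm_ring
      | succ b =>
        rw [Finset.Nat.antidiagonal_succ]
        simp only [Finset.sum_cons, Finset.sum_map, Function.Embedding.prodMap,
          Function.Embedding.coeFn_mk, Prod.map, Nat.succ_eq_add_one, Function.Embedding.refl_apply,
          Nat.add_eq_zero_iff, one_ne_zero, and_false, if_false, if_true, zero_add, pow_one, one_mul,
          mul_add, Finset.mul_sum]
        have : ∀ q : ℕ × ℕ, y * (2 * y ^ (q.1 + 1) * (U q.2 * z)) =
            2 * y ^ (q.1 + 1 + 1) * (U q.2 * z) := fun q => by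
          rw [pow_succ' y (q.1 + 1)]
          noncomm_ring
        simp only [this]
        noncomm_ring
    rw [hz, ih, Finset.Nat.antidiagonal_succ]
    simp only [Finset.sum_cons, Finset.sum_map, Function.Embedding.prodMap,
          Function.Embedding.coeFn_mk, Prod.map, Nat.succ_eq_add_one, Function.Embedding.refl_apply,
          Nat.add_eq_zero_iff, one_ne_zero, and_false, if_false, if_true, one_mul]
    rw [key]
    abel

end MultiProd

section Relation

variable {E R : Type*} [Ring E] [CommRing R] [Algebra R E]

theorem mvPowerSeries_map_commute {σ : Type*} (f : MvPowerSeries σ R) (g : MvPowerSeries σ E) :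
    Commute (MvPowerSeries.map (algebraMap R E) f) g := by
  classical
  ext d
  rw [MvPowerSeries.coeff_mul, MvPowerSeries.coeff_mul, Finsupp.sum_antidiagonal_swap d
    fun p q => MvPowerSeries.coeff p g *
      MvPowerSeries.coeff q (MvPowerSeries.map (algebraMap R E) f)]
  refine Finset.sum_congr rfl fun p _ => ?_
  simp only [MvPowerSeries.coeff_map]
  exact Algebra.commutes _ _

open PowerSeries in
/-- The commutation relation between the products of two families follows from the recursion
satisfied by the commutators of their members. -/
theorem exists_multiProd_mul_multiProd {E : Type*} [Ring E] [Algebra ℚ E] {U D : ℕ → E} (hU : ∀ a b, Commute (U a) (U b))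
    (hD : ∀ a b, Commute (D a) (D b)) (hU0 : U 0 = 1) (hD0 : D 0 = 1)
    (hDU : ∀ a b, D (b + 1) * U (a + 1) =
      D b * U a + U (a + 1) * D (b + 1) + U a * D b) :
    ∃ c : (ℕ →₀ ℕ) → (ℕ →₀ ℕ) → ℚ, ∀ d e,
      multiProd D hD e * multiProd U hU d =
        ∑ q ∈ antidiagonal e, ∑ p ∈ antidiagonal d,
          c p.1 q.1 • (multiProd U hU p.2 * multiProd D hD q.2) := by
  classical
  -- The generating series of the `D b` turns the recursion in two indices into one in `a` alone,
  -- with `X` in the role of `y`.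
  let z : PowerSeries E := PowerSeries.mk D
  let h : ℕ → PowerSeries ℚ := fun a => if a = 0 then 1 else 2 * X ^ a
  let ι : PowerSeries ℚ →+* PowerSeries E := PowerSeries.map (algebraMap ℚ E)
  have hι : ∀ f x, Commute (ι f) x := fun f x => mvPowerSeries_map_commute f x
  have hC : ∀ a b, Commute (C (R := E) (U a)) (C (U b)) := fun a b => (hU a b).map C
  have hh : ∀ a b, Commute (h a) (h b) := fun a b => Commute.all _ _
  have step1 : ∀ a, z * C (U a) = ∑ q ∈ antidiagonal a, ι (h q.1) * (C (U q.2) * z) := by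
    intro a
    have := mul_eq_sum_antidiagonal_of_recursion (z := z) (y := X) (U := fun a => C (U a))
      (by simp [hU0]) (fun a => by
        ext b
        cases b with
        | zero => simp [z, hD0]
        | succ b => simp [z, hDU, coeff_succ_X_mul]) a
    rw [this]
    refine Finset.sum_congr rfl fun q _ => ?_
    congr 1
    simp only [h, ι]
    split_ifs <;> simp [map_ofNat]
  -- The roles are exchanged: the products of the `U` are collected in one series `w`, and reading
  -- off the coefficient of `X ^ b` shows how a single `D b` passes `w`. The scalars `H` are
  -- central, so `multiProd_mul` handles a product of the `D`.
  let H : ℕ → MvPowerSeries ℕ ℚ := fun b d => PowerSeries.coeff b (multiProd h hh d)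
  let w : MvPowerSeries ℕ E := fun d => multiProd U hU d
  let κ : MvPowerSeries ℕ ℚ →+* MvPowerSeries ℕ E := MvPowerSeries.map (algebraMap ℚ E)
  have hκ : ∀ f x, Commute (κ f) x := fun f x => mvPowerSeries_map_commute f x
  have hCD : ∀ a b, Commute (MvPowerSeries.C (σ := ℕ) (R := E) (D a)) (MvPowerSeries.C (D b)) :=
    fun a b => (hD a b).map MvPowerSeries.C
  have hHH : ∀ a b, Commute (H a) (H b) := fun a b => Commute.all _ _
  have step2 : ∀ b, MvPowerSeries.C (D b) * w =
      ∑ q ∈ antidiagonal b, κ (H q.1) * (w * MvPowerSeries.C (D q.2)) := by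
    intro b
    ext d
    have h1 := congrArg (PowerSeries.coeff b) (mul_multiProd hC (fun a x => hι (h a) x)
      (by simp [hU0]) (by simp [h]) step1 d)
    have h2 : ∀ p, multiProd (fun a => C (R := E) (U a)) hC p = C (multiProd U hU p) :=
      fun p => multiProd_map _ U hU p
    have h3 : ∀ p, multiProd (fun a => ι (h a)) (fun a b => hι _ _) p = ι (multiProd h hh p) :=
      fun p => multiProd_map _ h hh p
    simp only [h2, h3, map_sum, PowerSeries.coeff_mul_C] at h1
    simp only [PowerSeries.coeff_mul _ (ι _)] at h1
    simp only [PowerSeries.coeff_C_mul] at h1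
    rw [MvPowerSeries.coeff_C_mul, map_sum]
    refine Eq.trans (b := D b * multiProd U hU d) rfl ?_
    refine Eq.trans (by simpa [z] using h1) ?_
    rw [Finset.sum_comm]
    refine Finset.sum_congr rfl fun q _ => ?_
    rw [MvPowerSeries.coeff_mul]
    refine Finset.sum_congr rfl fun p _ => ?_
    rw [MvPowerSeries.coeff_mul_C]
    rfl
  refine ⟨fun d e => MvPowerSeries.coeff d (multiProd H hHH e), fun d e => ?_⟩
  have h1 := congrArg (MvPowerSeries.coeff d) (multiProd_mul hCD (fun a x => hκ (H a) x)
      (by simp [hD0]) (by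
        have : H 0 = 1 := by
          ext d
          change PowerSeries.coeff 0 (multiProd h hh d) = _
          rw [PowerSeries.coeff_zero_eq_constantCoeff, ← multiProd_map, MvPowerSeries.coeff_one]
          induction d using finsupp_induction_add_single with
          | h0 => simp
          | h d k a hk ih =>
            rw [multiProd_add_single _ _ (by simp [h]) hk, ih]
            by_cases ha : a = 0
            · simp [ha, h]
            · have : d + Finsupp.single k a ≠ 0 := fun hz => ha (by
                simpa [hk] using DFunLike.congr_fun hz k)
              simp [this, h, ha]
        rw [this, map_one]) step2 e)
  have h2 : ∀ p, multiProd (fun a => MvPowerSeries.C (σ := ℕ) (R := E) (D a)) hCD p =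
      MvPowerSeries.C (multiProd D hD p) := fun p => multiProd_map _ D hD p
  have h3 : ∀ p, multiProd (fun a => κ (H a)) (fun a b => hκ _ _) p = κ (multiProd H hHH p) :=
      fun p => multiProd_map _ H hHH p
  simp only [h2, h3, map_sum, MvPowerSeries.coeff_C_mul] at h1
  refine Eq.trans (b := multiProd D hD e * MvPowerSeries.coeff d w) rfl (h1.trans ?_)
  refine Finset.sum_congr rfl fun q _ => ?_
  rw [MvPowerSeries.coeff_mul]
  refine Finset.sum_congr rfl fun p _ => ?_
  rw [MvPowerSeries.coeff_mul_C, MvPowerSeries.coeff_map, Algebra.smul_def]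
  rfl

end Relation

end ShiftedSchur

end

/-! ### Fock space, strip operators and the skew Cauchy relation in several variables. -/

noncomputable section

namespace ShiftedSchur

open StrictPartition
open Finset.HasAntidiagonal (antidiagonal mem_antidiagonal)

theorem exists_ne_zero_of_finsum {α M : Type*} [AddCommMonoid M] {f : α → M}
    (h : ∑ᶠ a, f a ≠ 0) : ∃ a, f a ≠ 0 := by
  by_contra hc
  push Not at hc
  exact h (by simp [hc])

section Fock

variable {F : Type*} [CommRing F]

/-- The free module on the strict partitions. -/
abbrev Fock (F : Type*) [CommRing F] : Type _ := StrictPartition →₀ F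

/-- The endomorphism of the Fock space with matrix `k`, where the column `κ` is restricted to the
finite set `T κ`. -/
def kernelOp (T : StrictPartition → Finset StrictPartition)
    (k : StrictPartition → StrictPartition → F) : Module.End F (Fock F) :=
  Finsupp.linearCombination F fun kap => ∑ lam ∈ T kap, Finsupp.single lam (k lam kap)

/-- The matrix entries of an endomorphism of the Fock space. -/
def matEntry (A : Module.End F (Fock F)) (lam kap : StrictPartition) : F :=
  A (Finsupp.single kap 1) lam

theorem kernelOp_single (T : StrictPartition → Finset StrictPartition)
    (k : StrictPartition → StrictPartition → F) (kap : StrictPartition) :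
    kernelOp T k (Finsupp.single kap 1) = ∑ lam ∈ T kap, Finsupp.single lam (k lam kap) := by
  simp [kernelOp]

open Classical in
theorem entry_kernelOp (T : StrictPartition → Finset StrictPartition)
    (k : StrictPartition → StrictPartition → F) (lam kap : StrictPartition) :
    matEntry (kernelOp T k) lam kap = if lam ∈ T kap then k lam kap else 0 := by
  rw [matEntry, kernelOp_single, Finsupp.finsetSum_apply]
  simp [Finsupp.single_apply]

theorem entry_mul_kernelOp (A : Module.End F (Fock F))
    (T : StrictPartition → Finset StrictPartition) (k : StrictPartition → StrictPartition → F)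
    (lam kap : StrictPartition) :
    matEntry (A * kernelOp T k) lam kap = ∑ iot ∈ T kap, matEntry A lam iot * k iot kap := by
  rw [matEntry, Module.End.mul_apply, kernelOp_single, map_sum, Finsupp.finsetSum_apply]
  refine Finset.sum_congr rfl fun iot _ => ?_
  have : Finsupp.single iot (k iot kap) = k iot kap • Finsupp.single iot (1 : F) := by simp
  rw [this, map_smul, Finsupp.smul_apply, smul_eq_mul, mul_comm]
  rfl

theorem entry_mul (A B : Module.End F (Fock F)) (lam kap : StrictPartition) :
    matEntry (A * B) lam kap = ∑ᶠ iot, matEntry A lam iot * matEntry B iot kap := by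
  have h : B (Finsupp.single kap 1) = ∑ iot ∈ (B (Finsupp.single kap 1)).support,
      matEntry B iot kap • Finsupp.single iot (1 : F) := by
    conv_lhs => rw [← Finsupp.sum_single (B (Finsupp.single kap 1))]
    refine Finset.sum_congr rfl fun iot _ => ?_
    simp [matEntry]
  rw [finsum_eq_sum_of_support_subset (s := (B (Finsupp.single kap 1)).support)]
  · rw [matEntry, Module.End.mul_apply, h, map_sum, Finsupp.finsetSum_apply, ← h]
    refine Finset.sum_congr rfl fun iot _ => ?_
    rw [map_smul, Finsupp.smul_apply, smul_eq_mul, mul_comm]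
    rfl
  · intro iot hi
    rw [Function.mem_support] at hi
    simpa [matEntry] using right_ne_zero_of_mul hi

open Classical in
theorem entry_one (lam kap : StrictPartition) :
    matEntry (1 : Module.End F (Fock F)) lam kap = if lam = kap then 1 else 0 := by
  simp [matEntry, Finsupp.single_apply, eq_comm]

theorem end_ext {A B : Module.End F (Fock F)} (h : ∀ lam kap, matEntry A lam kap = matEntry B lam kap) :
    A = B := by
  refine Finsupp.lhom_ext' fun kap => LinearMap.ext_ring ?_
  ext lam
  exact h lam kap

@[simp]
theorem entry_add (A B : Module.End F (Fock F)) (lam kap : StrictPartition) :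
    matEntry (A + B) lam kap = matEntry A lam kap + matEntry B lam kap := rfl

@[simp]
theorem entry_smul {S : Type*} [Monoid S] [DistribMulAction S F] [SMulCommClass F S F] (c : S) 
    (A : Module.End F (Fock F)) (lam kap : StrictPartition) :
    matEntry (c • A) lam kap = c • matEntry A lam kap := rfl

theorem entry_sum {ι : Type*} (s : Finset ι) (A : ι → Module.End F (Fock F))
    (lam kap : StrictPartition) :
    matEntry (∑ i ∈ s, A i) lam kap = ∑ i ∈ s, matEntry (A i) lam kap := by
  rw [matEntry, LinearMap.sum_apply, Finsupp.finsetSum_apply]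
  rfl

end Fock

/-- The operator adding a strip of size `a`. -/
def raiseOp (a : ℕ) : Module.End ℚ (Fock ℚ) :=
  kernelOp (fun kap => ofSize (kap.size + a)) stripQ

/-- The operator removing a strip of size `b`. -/
def lowerOp (b : ℕ) : Module.End ℚ (Fock ℚ) :=
  kernelOp (fun lam => (sizeLE lam.size).filter fun nu => lam.size = nu.size + b)
    fun nu lam => stripP lam nu

theorem entry_raiseOp (a : ℕ) (lam kap : StrictPartition) :
    matEntry (raiseOp a) lam kap = if lam.size = kap.size + a then stripQ lam kap else 0 := by
  classical
  rw [raiseOp, entry_kernelOp]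
  simp [mem_ofSize]

theorem entry_lowerOp (b : ℕ) (nu lam : StrictPartition) :
    matEntry (lowerOp b) nu lam = if lam.size = nu.size + b then stripP lam nu else 0 := by
  classical
  rw [lowerOp, entry_kernelOp]
  simp only [Finset.mem_filter, mem_sizeLE]
  refine if_congr ?_ rfl rfl
  omega

theorem raiseOp_zero : raiseOp 0 = 1 := by
  classical
  refine end_ext fun lam kap => ?_
  rw [entry_raiseOp, entry_one]
  by_cases h : lam = kap
  · simp [h]
  · rw [if_neg h, ite_eq_right_iff]
    intro hs
    by_contra hc
    exact h ((contained_of_stripQ_ne_zero hc).eq_of_size_eq (by omega)).symm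

theorem lowerOp_zero : lowerOp 0 = 1 := by
  classical
  refine end_ext fun lam kap => ?_
  rw [entry_lowerOp, entry_one]
  by_cases h : lam = kap
  · simp [h]
  · rw [if_neg h, ite_eq_right_iff]
    intro hs
    by_contra hc
    exact h ((contained_of_stripP_ne_zero hc).eq_of_size_eq (by omega))

/-- The entries are those of `sum_stripQ_swap` if the sizes differ by `a + b`, and vanish otherwise.
This commutation is the source of the symmetry of the skew `Q`-functions. -/
theorem raiseOp_commute (a b : ℕ) : Commute (raiseOp a) (raiseOp b) := by
  refine end_ext fun nu mu => ?_
  conv_lhs => rw [raiseOp.eq_1 b]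
  conv_rhs => rw [raiseOp.eq_1 a]
  rw [entry_mul_kernelOp, entry_mul_kernelOp]
  simp only [entry_raiseOp]
  by_cases h : nu.size = mu.size + a + b
  · have := sum_stripQ_swap mu nu h
    symm
    convert this using 1
    · refine Finset.sum_congr rfl fun lam hl => ?_
      rw [if_pos (by rw [mem_ofSize.1 hl]; omega)]
    · refine Finset.sum_congr rfl fun lam hl => ?_
      rw [if_pos (by rw [mem_ofSize.1 hl]; omega)]
  · rw [Finset.sum_eq_zero, Finset.sum_eq_zero]
    · intro lam hl
      rw [if_neg (by rw [mem_ofSize.1 hl]; omega), zero_mul]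
    · intro lam hl
      rw [if_neg (by rw [mem_ofSize.1 hl]; omega), zero_mul]

/-- `B` is the adjoint of `A` for the bilinear form in which the strict partitions are orthogonal
and `lam` has norm `2 ^ (-l(lam))`. -/
def IsAdjoint (A B : Module.End ℚ (Fock ℚ)) : Prop :=
  ∀ lam nu, matEntry B nu lam = 2 ^ ((nu.length : ℤ) - (lam.length : ℤ)) * matEntry A lam nu

theorem isAdjoint_raiseOp_lowerOp (a : ℕ) : IsAdjoint (raiseOp a) (lowerOp a) := by
  intro lam nu
  rw [entry_raiseOp, entry_lowerOp, mul_ite, mul_zero, stripP_eq]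

theorem IsAdjoint.mul {A B A' B' : Module.End ℚ (Fock ℚ)} (h : IsAdjoint A B)
    (h' : IsAdjoint A' B') : IsAdjoint (A * A') (B' * B) := by
  intro lam nu
  rw [entry_mul, entry_mul, mul_finsum _ _]
  refine finsum_congr fun iot => ?_
  rw [h lam iot, h' iot nu]
  have : (2 : ℚ) ^ ((nu.length : ℤ) - (lam.length : ℤ)) =
      2 ^ ((nu.length : ℤ) - (iot.length : ℤ)) * 2 ^ ((iot.length : ℤ) - (lam.length : ℤ)) := by
    rw [← zpow_add₀ (by norm_num)]
    congr 1
    ring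
  rw [this]
  ring

theorem IsAdjoint.one : IsAdjoint 1 1 := by
  classical
  intro lam nu
  rw [entry_one, entry_one]
  by_cases h : lam = nu
  · simp [h]
  · simp [h, Ne.symm h]

theorem IsAdjoint.unique {A B B' : Module.End ℚ (Fock ℚ)} (h : IsAdjoint A B)
    (h' : IsAdjoint A B') : B = B' :=
  end_ext fun nu lam => by rw [h lam nu, h' lam nu]

/-- Adjoints are unique and reverse products, so the commutation is inherited from the raising
operators. -/
theorem lowerOp_commute (a b : ℕ) : Commute (lowerOp a) (lowerOp b) := by
  have h1 := (isAdjoint_raiseOp_lowerOp a).mul (isAdjoint_raiseOp_lowerOp b)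
  have h2 := (isAdjoint_raiseOp_lowerOp b).mul (isAdjoint_raiseOp_lowerOp a)
  rw [(raiseOp_commute a b).eq] at h1
  exact h2.unique h1

theorem entry_lowerOp_mul_raiseOp (a b : ℕ) (nu mu : StrictPartition) :
    matEntry (lowerOp b * raiseOp a) nu mu =
      if mu.size + a = nu.size + b then upCoeff mu nu a else 0 := by
  rw [raiseOp, entry_mul_kernelOp]
  simp only [entry_lowerOp]
  split_ifs with h
  · refine Finset.sum_congr rfl fun lam hl => ?_
    rw [if_pos (by rw [mem_ofSize.1 hl]; omega), mul_comm]
  · refine Finset.sum_eq_zero fun lam hl => ?_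
    rw [if_neg (by rw [mem_ofSize.1 hl]; omega), zero_mul]

theorem entry_raiseOp_mul_lowerOp (a b : ℕ) (nu mu : StrictPartition) :
    matEntry (raiseOp a * lowerOp b) nu mu =
      if mu.size + a = nu.size + b then downCoeff mu nu a else 0 := by
  rw [lowerOp, entry_mul_kernelOp]
  simp only [entry_raiseOp]
  split_ifs with h
  · rw [downCoeff]
    refine Finset.sum_congr ?_ fun tau ht => ?_
    · ext tau
      simp only [Finset.mem_filter, mem_sizeLE]
      omega
    · rw [if_pos (by have := (Finset.mem_filter.1 ht).2; omega)]
  · refine Finset.sum_eq_zero fun tau ht => ?_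
    rw [if_neg (by have := (Finset.mem_filter.1 ht).2; omega), zero_mul]

/-- In terms of generating series, `(1 - x y) D(y) U(x) = (1 + x y) U(x) D(y)`. It is `upCoeff_succ`
read as an identity of matrix entries. -/
theorem lowerOp_mul_raiseOp_succ (a b : ℕ) :
    lowerOp (b + 1) * raiseOp (a + 1) =
      lowerOp b * raiseOp a + raiseOp (a + 1) * lowerOp (b + 1) + raiseOp a * lowerOp b := by
  refine end_ext fun nu mu => ?_
  simp only [entry_add, entry_lowerOp_mul_raiseOp, entry_raiseOp_mul_lowerOp]
  by_cases h : mu.size + a = nu.size + b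
  · rw [if_pos (by omega), if_pos h, if_pos (by omega), if_pos h, upCoeff_succ]
  · rw [if_neg (by omega), if_neg h, if_neg (by omega), if_neg h]
    simp

/-- The operator `∏ U_{d k}`. -/
def raiseMulti (d : ℕ →₀ ℕ) : Module.End ℚ (Fock ℚ) := multiProd raiseOp raiseOp_commute d

/-- The operator `∏ D_{e k}`. -/
def lowerMulti (e : ℕ →₀ ℕ) : Module.End ℚ (Fock ℚ) := multiProd lowerOp lowerOp_commute e

/-- The factor `2 ^ (l(mu) - l(lam))` relating `P` to `Q` is the one in the definition of the
adjoint, so the coefficients of `P` are entries of `lowerMulti` as soon as those of `Q` are entries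
of `raiseMulti`. -/
theorem isAdjoint_multi (d : ℕ →₀ ℕ) : IsAdjoint (raiseMulti d) (lowerMulti d) := by
  unfold raiseMulti lowerMulti
  induction d using finsupp_induction_add_single with
  | h0 => simpa using IsAdjoint.one
  | h d k a hk ih =>
    rw [multiProd_add_single _ _ raiseOp_zero hk, multiProd_add_single _ _ lowerOp_zero hk,
      (multiProd_commute lowerOp lowerOp_commute (lowerOp_commute a) d).eq]
    exact (isAdjoint_raiseOp_lowerOp a).mul ih

theorem raiseMulti_entry_ne_zero {d : ℕ →₀ ℕ} {lam mu : StrictPartition}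
    (h : matEntry (raiseMulti d) lam mu ≠ 0) :
    mu.Contained lam ∧ lam.size = mu.size + d.degree := by
  unfold raiseMulti at h
  induction d using finsupp_induction_add_single generalizing lam with
  | h0 =>
    classical
    rw [multiProd_zero, entry_one] at h
    obtain rfl : lam = mu := by
      by_contra hc
      simp [hc] at h
    simp [contained_refl]
  | h d k a hk ih =>
    rw [multiProd_add_single _ _ raiseOp_zero hk, entry_mul] at h
    obtain ⟨iot, hi⟩ := exists_ne_zero_of_finsum h
    obtain ⟨h1, h2⟩ := ih (right_ne_zero_of_mul hi)
    have h3 := left_ne_zero_of_mul hi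
    rw [entry_raiseOp] at h3
    have h4 : lam.size = iot.size + a := by
      by_contra hc
      simp [hc] at h3
    rw [if_pos h4] at h3
    refine ⟨h1.trans (contained_of_stripQ_ne_zero h3), ?_⟩
    rw [map_add, Finsupp.degree_single]
    omega

theorem lowerMulti_entry_ne_zero {d : ℕ →₀ ℕ} {lam nu : StrictPartition}
    (h : matEntry (lowerMulti d) nu lam ≠ 0) :
    nu.Contained lam ∧ lam.size = nu.size + d.degree := by
  rw [isAdjoint_multi d lam nu] at h
  exact raiseMulti_entry_ne_zero (right_ne_zero_of_mul h)

/-- The skew Cauchy relation between the operators in several variables. -/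
theorem lowerMulti_mul_raiseMulti (d e : ℕ →₀ ℕ) :
    lowerMulti e * raiseMulti d = ∑ q ∈ antidiagonal e, ∑ p ∈ antidiagonal d,
      matEntry (lowerMulti q.1 * raiseMulti p.1) empty empty •
        (raiseMulti p.2 * lowerMulti q.2) := by
  classical
  obtain ⟨c, hc⟩ := exists_multiProd_mul_multiProd raiseOp_commute lowerOp_commute raiseOp_zero
    lowerOp_zero fun a b => lowerOp_mul_raiseOp_succ a b
  have key : ∀ d e, matEntry (lowerMulti e * raiseMulti d) empty empty = c d e := by
    intro d e
    -- Lowering kills the vacuum unless it is the identity, so in the vacuum entry of the relation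
    -- only the term with scalar `c d e` survives.
    have h0 : ∀ (p q : ℕ →₀ ℕ), matEntry (raiseMulti p * lowerMulti q) empty empty =
        if p = 0 ∧ q = 0 then 1 else 0 := by
      intro p q
      split_ifs with h
      · rw [h.1, h.2, raiseMulti, lowerMulti, multiProd_zero, multiProd_zero, mul_one, entry_one,
          if_pos rfl]
      · by_contra hne
        rw [entry_mul] at hne
        obtain ⟨iot, hi⟩ := exists_ne_zero_of_finsum hne
        have h1 := (raiseMulti_entry_ne_zero (left_ne_zero_of_mul hi)).2
        have h2 := (lowerMulti_entry_ne_zero (right_ne_zero_of_mul hi)).2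
        rw [size_empty] at h1 h2
        exact h ⟨(Finsupp.degree_eq_zero_iff p).1 (by omega),
          (Finsupp.degree_eq_zero_iff q).1 (by omega)⟩
    have := congrArg (fun A => matEntry A empty empty) (hc d e)
    refine Eq.trans this ?_
    simp only [entry_sum, entry_smul]
    rw [Finset.sum_eq_single (e, 0), Finset.sum_eq_single (d, 0)]
    · have := h0 0 0
      rw [raiseMulti, lowerMulti] at this
      rw [this]
      simp
    · rintro ⟨p1, p2⟩ hp hne
      have := h0 p2 0
      rw [raiseMulti, lowerMulti] at this
      rw [this, if_neg, smul_zero]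
      rintro ⟨rfl, -⟩
      rw [mem_antidiagonal] at hp
      simp at hp
      exact hne (by rw [hp])
    · intro h
      exact absurd (mem_antidiagonal.2 (add_zero d)) h
    · rintro ⟨q1, q2⟩ hq hne
      refine Finset.sum_eq_zero fun p _ => ?_
      have := h0 p.2 q2
      rw [raiseMulti, lowerMulti] at this
      rw [this, if_neg, smul_zero]
      rintro ⟨-, rfl⟩
      rw [mem_antidiagonal] at hq
      simp at hq
      exact hne (by rw [hq])
    · intro h
      exact absurd (mem_antidiagonal.2 (add_zero e)) h
  rw [lowerMulti, raiseMulti, hc]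
  simp only [key]
  rfl

end ShiftedSchur

end

/-! ### Shifted diagrams and marked tableaux of given content. -/

noncomputable section

namespace ShiftedSchur

open StrictPartition

theorem letter_eq_iff (p q : Letter) :
    p = q ↔ p.index = q.index ∧ (p.Marked ↔ q.Marked) := by
  obtain ⟨k, a⟩ := p
  obtain ⟨l, b⟩ := q
  change (k, a) = (l, b) ↔ k = l ∧ (a = true ↔ b = true)
  rw [Prod.mk.injEq, ← Bool.eq_iff_iff]

theorem letter_le_iff (p q : Letter) :
    p ≤ q ↔ p.index < q.index ∨ (p.index = q.index ∧ (p.Marked → q.Marked)) := by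
  rw [Prod.Lex.le_iff]
  rfl

/-- The letter with a given index and mark. -/
def mkLetter (k : ℕ) (b : Bool) : Letter := toLex (k, b)

@[simp]
theorem marked_mkLetter (k : ℕ) (b : Bool) : (mkLetter k b).Marked ↔ b = true := Iff.rfl

namespace StrictPartition

theorem mem_shiftedDiagram {lam : StrictPartition} {i j : ℕ} :
    (i, j) ∈ lam.shiftedDiagram ↔ i ≤ j ∧ j < lam.part i + i := Iff.rfl

theorem Contained.shiftedDiagram_subset {mu lam : StrictPartition} (h : mu.Contained lam) :
    mu.shiftedDiagram ⊆ lam.shiftedDiagram := fun c hc =>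
  ⟨hc.1, hc.2.trans_le (Nat.add_le_add_right (h c.1) _)⟩

theorem contained_of_shiftedDiagram_subset {mu lam : StrictPartition}
    (h : mu.shiftedDiagram ⊆ lam.shiftedDiagram) : mu.Contained lam := by
  intro i
  by_contra hc
  have h1 : (i, lam.part i + i) ∈ mu.shiftedDiagram := ⟨by simp, by simpa using hc⟩
  have := (h h1).2
  simp at this

theorem Contained.antisymm {mu lam : StrictPartition} (h : mu.Contained lam)
    (h' : lam.Contained mu) : mu = lam := by
  ext i
  exact le_antisymm (h i) (h' i)

theorem shiftedDiagram_injective : Function.Injective shiftedDiagram := fun _ _ h =>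
  (contained_of_shiftedDiagram_subset h.subset).antisymm
    (contained_of_shiftedDiagram_subset h.symm.subset)

theorem shiftedDiagram_eq (lam : StrictPartition) {n : ℕ} (hn : lam.part n = 0) :
    lam.shiftedDiagram = ((Finset.range n).sigma fun i => Finset.range (lam.part i)).map
      ⟨fun x => (x.1, x.1 + x.2), fun x y h => by
        obtain ⟨a, b⟩ := x
        obtain ⟨c, d⟩ := y
        simp only [Prod.mk.injEq] at h
        obtain ⟨rfl, h⟩ := h
        simp only [Nat.add_left_cancel_iff] at h
        rw [h]⟩ := by
  ext ⟨i, j⟩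
  simp only [mem_shiftedDiagram, Finset.coe_map, Set.mem_image, Finset.mem_coe, Finset.mem_sigma,
    Finset.mem_range, Sigma.exists]
  constructor
  · rintro ⟨h1, h2⟩
    refine ⟨i, j - i, ⟨?_, by omega⟩, Prod.ext rfl (by change i + (j - i) = j; omega)⟩
    by_contra hc
    have := lam.antitone (not_lt.mp hc)
    omega
  · rintro ⟨a, b, ⟨h1, h2⟩, h⟩
    obtain ⟨rfl, rfl⟩ := Prod.mk.inj h
    exact ⟨Nat.le_add_right a b, by change a + b < lam.part a + a; omega⟩

theorem finite_shiftedDiagram (lam : StrictPartition) : lam.shiftedDiagram.Finite := by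
  obtain ⟨n, hn⟩ := lam.exists_part_eq_zero
  rw [lam.shiftedDiagram_eq hn]
  exact Finset.finite_toSet _

theorem ncard_shiftedDiagram (lam : StrictPartition) : lam.shiftedDiagram.ncard = lam.size := by
  obtain ⟨n, hn⟩ := lam.exists_part_eq_zero
  rw [lam.shiftedDiagram_eq hn, Set.ncard_coe_finset, Finset.card_map, Finset.card_sigma,
    lam.size_eq_sum hn]
  simp

instance (lam mu : StrictPartition) : Finite (lam.shiftedSkewDiagram mu) :=
  (lam.finite_shiftedDiagram.subset Set.sdiff_subset).to_subtype

theorem ncard_shiftedSkewDiagram {lam mu : StrictPartition} (h : mu.Contained lam) :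
    (lam.shiftedSkewDiagram mu).ncard + mu.size = lam.size := by
  rw [← ncard_shiftedDiagram, ← ncard_shiftedDiagram, shiftedSkewDiagram]
  exact Set.ncard_sdiff_add_ncard_of_subset h.shiftedDiagram_subset lam.finite_shiftedDiagram

end StrictPartition

namespace MarkedTableau

variable {lam mu : StrictPartition}

@[ext]
theorem ext {t u : MarkedTableau lam mu} (h : ∀ c, t.entry c = u.entry c) : t = u := by
  obtain ⟨e, _, _, _, _⟩ := t
  obtain ⟨f, _, _, _, _⟩ := u
  obtain rfl : e = f := funext h
  rfl

/-- Tableaux of given content. -/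
abbrev OfContent (lam mu : StrictPartition) (d : ℕ →₀ ℕ) : Type :=
  {t : MarkedTableau lam mu // ∀ k, t.exponent k = d k}

theorem exponent_eq (t : MarkedTableau lam mu) (k : ℕ) :
    t.exponent k = {c | ∃ h : c ∈ lam.shiftedSkewDiagram mu, (t.entry ⟨c, h⟩).index = k}.ncard := by
  rw [exponent, ← Set.ncard_image_of_injective _ Subtype.val_injective]
  congr 1
  ext c
  simp

theorem index_mem_support {d : ℕ →₀ ℕ} {t : MarkedTableau lam mu} (ht : ∀ k, t.exponent k = d k)
    (c) : (t.entry c).index ∈ d.support := by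
  rw [Finsupp.mem_support_iff, ← ht, exponent]
  have hc : c ∈ {c' | (t.entry c').index = (t.entry c).index} := rfl
  exact ((Set.ncard_pos (Set.toFinite _)).2 ⟨c, hc⟩).ne'

theorem exponent_eq_zero {t : MarkedTableau lam mu} {k : ℕ} (h : ∀ c, (t.entry c).index ≠ k) :
    t.exponent k = 0 := by
  rw [exponent, Set.ncard_eq_zero (Set.toFinite _)]
  ext c
  simpa using h c

instance (d : ℕ →₀ ℕ) : Finite (OfContent lam mu d) := by
  classical
  refine Finite.of_injective (β := lam.shiftedSkewDiagram mu → d.support × Bool)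
    (fun t c => (⟨_, index_mem_support t.2 c⟩, decide (t.1.entry c).Marked)) ?_
  intro t u h
  refine Subtype.ext (MarkedTableau.ext fun c => ?_)
  have := congrFun h c
  simp only [Prod.mk.injEq, Subtype.mk.injEq, decide_eq_decide] at this
  exact (letter_eq_iff _ _).2 this

theorem card_ofContent_zero (lam mu : StrictPartition) (h : mu.Contained lam) [Decidable (lam = mu)] :
    Nat.card (OfContent lam mu 0) = if lam = mu then 1 else 0 := by
  split_ifs with he
  · subst he
    have hemp : ∀ c : lam.shiftedSkewDiagram lam, False := fun c => c.2.2 c.2.1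
    rw [Nat.card_eq_one_iff_unique]
    refine ⟨⟨fun t u => Subtype.ext (MarkedTableau.ext fun c => (hemp c).elim)⟩, ⟨⟨⟨fun c =>
      (hemp c).elim, fun c => (hemp c).elim, fun c => (hemp c).elim, fun c => (hemp c).elim,
      fun c => (hemp c).elim⟩, fun k => exponent_eq_zero fun c => (hemp c).elim⟩⟩⟩
  · have : IsEmpty (OfContent lam mu 0) := by
      refine ⟨fun t => he (Contained.antisymm ?_ h)⟩
      refine contained_of_shiftedDiagram_subset fun c hc => ?_
      by_contra hn
      have := index_mem_support t.2 ⟨c, hc, hn⟩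
      simp at this
    exact Nat.card_of_isEmpty

/-- A set of boxes which is closed under moves to the left and up inside a shifted diagram is a
shifted diagram. -/
theorem _root_.ShiftedSchur.exists_shiftedDiagram_eq {lam : StrictPartition} {K : Set (ℕ × ℕ)}
    (hK : K ⊆ lam.shiftedDiagram)
    (hrow : ∀ i j j', (i, j) ∈ K → j' ≤ j → (i, j') ∈ lam.shiftedDiagram → (i, j') ∈ K)
    (hcol : ∀ i j, (i + 1, j) ∈ K → (i, j) ∈ lam.shiftedDiagram → (i, j) ∈ K) :
    ∃ kap : StrictPartition, kap.shiftedDiagram = K := by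
  classical
  have hex : ∀ i, ∃ f, ∀ j, (i, j) ∈ K ↔ i ≤ j ∧ j < f + i := by
    intro i
    have hx : ∃ x, (i, x + i) ∉ K := ⟨lam.part i, fun h => by have := (hK h).2; simp at this⟩
    refine ⟨Nat.find hx, fun j => ⟨fun h => ⟨(hK h).1, ?_⟩, fun h => ?_⟩⟩
    · by_contra hc
      refine Nat.find_spec hx (hrow i j _ h (not_lt.mp hc) ⟨Nat.le_add_left _ _, ?_⟩)
      exact (not_lt.mp hc).trans_lt (hK h).2
    · have := Nat.find_min hx (m := j - i) (by omega)
      rwa [not_not, Nat.sub_add_cancel h.1] at this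
  choose f hf using hex
  refine ⟨ofStep f ?_ ?_, ?_⟩
  · intro i
    by_cases h0 : f (i + 1) = 0
    · exact Or.inr h0
    · left
      have h1 : (i + 1, f (i + 1) + i) ∈ K := (hf _ _).2 ⟨by omega, by omega⟩
      have h2 := (hK h1).2
      simp only at h2
      have h3 := lam.part_succ_lt i
      have h4 := hcol i _ h1 ⟨by simp, by simp only; omega⟩
      have := ((hf _ _).1 h4).2
      omega
  · obtain ⟨n, hn⟩ := lam.exists_part_eq_zero
    refine ⟨n, ?_⟩
    by_contra hc
    have h1 : (n, n) ∈ K := (hf n n).2 ⟨le_rfl, by omega⟩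
    have := (hK h1).2
    simp only at this
    omega
  · ext ⟨i, j⟩
    rw [hf]
    rfl

end MarkedTableau

end ShiftedSchur

end

/-! ### Splitting off the letters of largest index: the branching rule. -/

noncomputable section

namespace ShiftedSchur

open StrictPartition

namespace MarkedTableau

variable {lam mu : StrictPartition}

/-- The boxes of a tableau whose letter has index `n` fill the skew diagram `kap - mu`. -/
def Splits (t : MarkedTableau lam mu) (n : ℕ) (kap : StrictPartition) : Prop :=
  mu.Contained kap ∧ kap.Contained lam ∧
    ∀ c, (t.entry c).index = n ↔ c.1 ∈ kap.shiftedDiagram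

theorem Splits.unique {t : MarkedTableau lam mu} {n : ℕ} {kap kap' : StrictPartition}
    (h : t.Splits n kap) (h' : t.Splits n kap') : kap = kap' := by
  have key : ∀ {a b : StrictPartition}, t.Splits n a → t.Splits n b →
      a.shiftedDiagram ⊆ b.shiftedDiagram := by
    intro a b ha hb c hc
    by_cases hm : c ∈ mu.shiftedDiagram
    · exact hb.1.shiftedDiagram_subset hm
    · have hl := ha.2.1.shiftedDiagram_subset hc
      exact (hb.2.2 ⟨c, hl, hm⟩).1 ((ha.2.2 ⟨c, hl, hm⟩).2 hc)
  exact shiftedDiagram_injective ((key h h').antisymm (key h' h))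

theorem index_le_of_row (t : MarkedTableau lam mu) {c d} (h1 : c.1.1 = d.1.1)
    (h2 : c.1.2 ≤ d.1.2) : (t.entry d).index ≤ (t.entry c).index := by
  have := (letter_le_iff _ _).1 (t.row_noninc c d h1 h2)
  omega

theorem index_le_of_col (t : MarkedTableau lam mu) {c d} (h1 : c.1.2 = d.1.2)
    (h2 : c.1.1 ≤ d.1.1) : (t.entry d).index ≤ (t.entry c).index := by
  have := (letter_le_iff _ _).1 (t.col_noninc c d h1 h2)
  omega

/-- Rows and columns are nonincreasing, so the letters of largest index lie next to `mu`, and their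
boxes together with those of `mu` are closed under moves to the left and up. -/
theorem exists_splits (hc : mu.Contained lam) (t : MarkedTableau lam mu) {n : ℕ}
    (hn : ∀ c, (t.entry c).index ≤ n) : ∃ kap, t.Splits n kap := by
  have hK : mu.shiftedDiagram ∪ {c | ∃ h : c ∈ lam.shiftedSkewDiagram mu,
      (t.entry ⟨c, h⟩).index = n} ⊆ lam.shiftedDiagram :=
    Set.union_subset hc.shiftedDiagram_subset fun c hc => hc.1.1
  have hrow : ∀ i j j', (i, j) ∈ mu.shiftedDiagram ∪ {c | ∃ h : c ∈ lam.shiftedSkewDiagram mu,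
      (t.entry ⟨c, h⟩).index = n} → j' ≤ j → (i, j') ∈ lam.shiftedDiagram →
      (i, j') ∈ mu.shiftedDiagram ∪ {c | ∃ h : c ∈ lam.shiftedSkewDiagram mu,
        (t.entry ⟨c, h⟩).index = n} := by
    intro i j j' h hj hl
    by_cases hm : (i, j') ∈ mu.shiftedDiagram
    · exact Or.inl hm
    · right
      rcases h with h | ⟨h1, h2⟩
      · exact absurd ⟨hl.1, lt_of_le_of_lt hj h.2⟩ hm
      · refine ⟨⟨hl, hm⟩, le_antisymm (hn _) ?_⟩
        rw [← h2]
        exact t.index_le_of_row rfl hj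
  have hcol : ∀ i j, (i + 1, j) ∈ mu.shiftedDiagram ∪ {c | ∃ h : c ∈ lam.shiftedSkewDiagram mu,
      (t.entry ⟨c, h⟩).index = n} → (i, j) ∈ lam.shiftedDiagram →
      (i, j) ∈ mu.shiftedDiagram ∪ {c | ∃ h : c ∈ lam.shiftedSkewDiagram mu,
        (t.entry ⟨c, h⟩).index = n} := by
    intro i j h hl
    by_cases hm : (i, j) ∈ mu.shiftedDiagram
    · exact Or.inl hm
    · right
      rcases h with h | ⟨h1, h2⟩
      -- Strictness of `mu` is used: in shifted coordinates row `i + 1` does not extend beyond row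
      -- `i`.
      · refine absurd ⟨hl.1, ?_⟩ hm
        have h3 := h.2
        have h4 := h.1
        have h5 := mu.part_succ_lt i
        simp only at h3 h4 ⊢
        omega
      · refine ⟨⟨hl, hm⟩, le_antisymm (hn _) ?_⟩
        rw [← h2]
        exact t.index_le_of_col rfl (Nat.le_succ i)
  obtain ⟨kap, hk⟩ := exists_shiftedDiagram_eq hK hrow hcol
  refine ⟨kap, contained_of_shiftedDiagram_subset (hk ▸ Set.subset_union_left),
    contained_of_shiftedDiagram_subset (hk ▸ hK), fun c => ?_⟩
  rw [hk]
  constructor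
  · exact fun h => Or.inr ⟨c.2, h⟩
  · rintro (h | ⟨_, h⟩)
    · exact absurd h c.2.2
    · exact h

/-- The part of a tableau inside a smaller skew diagram. -/
def restrict {lam' mu' : StrictPartition} (h1 : lam'.Contained lam) (h2 : mu.Contained mu')
    (t : MarkedTableau lam mu) : MarkedTableau lam' mu' :=
  have hm : ∀ {c}, c ∈ lam'.shiftedSkewDiagram mu' → c ∈ lam.shiftedSkewDiagram mu :=
    fun hc => ⟨h1.shiftedDiagram_subset hc.1, fun h => hc.2 (h2.shiftedDiagram_subset h)⟩
  { entry := fun c => t.entry ⟨c.1, hm c.2⟩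
    row_noninc := fun c d => t.row_noninc ⟨c.1, hm c.2⟩ ⟨d.1, hm d.2⟩
    col_noninc := fun c d => t.col_noninc ⟨c.1, hm c.2⟩ ⟨d.1, hm d.2⟩
    unmarked_once := fun c d h h' h'' => Subtype.ext (Subtype.mk.inj
      (t.unmarked_once ⟨c.1, hm c.2⟩ ⟨d.1, hm d.2⟩ h h' h''))
    marked_once := fun c d h h' h'' => Subtype.ext (Subtype.mk.inj
      (t.marked_once ⟨c.1, hm c.2⟩ ⟨d.1, hm d.2⟩ h h' h'')) }

open Classical in
/-- Joining a tableau of shape `lam - kap` and one of shape `kap - mu` with larger letters. -/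
def glue {kap : StrictPartition} (t : MarkedTableau lam kap) (u : MarkedTableau kap mu)
    (htu : ∀ c d, (t.entry c).index < (u.entry d).index) : MarkedTableau lam mu where
  entry := fun c => if h : c.1 ∈ kap.shiftedDiagram then u.entry ⟨c.1, h, c.2.2⟩
    else t.entry ⟨c.1, c.2.1, h⟩
  row_noninc := by
    intro c d h1 h2
    by_cases hc : c.1 ∈ kap.shiftedDiagram <;> by_cases hd : d.1 ∈ kap.shiftedDiagram <;>
      simp only [hc, hd, dif_pos, dif_neg, not_false_eq_true]
    · exact u.row_noninc _ _ h1 h2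
    · exact (letter_le_iff _ _).2 (Or.inl (htu _ _))
    · refine absurd ⟨c.2.1.1, ?_⟩ hc
      have := hd.2
      rw [h1]
      omega
    · exact t.row_noninc _ _ h1 h2
  col_noninc := by
    intro c d h1 h2
    by_cases hc : c.1 ∈ kap.shiftedDiagram <;> by_cases hd : d.1 ∈ kap.shiftedDiagram <;>
      simp only [hc, hd, dif_pos, dif_neg, not_false_eq_true]
    · exact u.col_noninc _ _ h1 h2
    · exact (letter_le_iff _ _).2 (Or.inl (htu _ _))
    · refine absurd ⟨c.2.1.1, ?_⟩ hc
      have h3 := hd.2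
      have h4 := hd.1
      rcases h2.lt_or_eq with h5 | h5
      · have := kap.part_lt_of_lt h5 (by omega)
        -- The right ends of the nonempty shifted rows move weakly to the left on going down, so a
        -- box of `kap` has no box of `lam - kap` above it.
        have key : ∀ m n, m ≤ n → kap.part n ≠ 0 → kap.part n + n ≤ kap.part m + m := by
          intro m n hmn
          induction n, hmn using Nat.le_induction with
          | base => exact fun _ => le_rfl
          | succ n _ ih =>
            intro hn
            have h6 := kap.part_succ_lt n
            have := ih (by omega)
            omega
        have := key _ _ h2 (by omega)
        omega
      · rw [h5]
        omega
    · exact t.col_noninc _ _ h1 h2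
  unmarked_once := by
    intro c d h1
    by_cases hc : c.1 ∈ kap.shiftedDiagram <;> by_cases hd : d.1 ∈ kap.shiftedDiagram <;>
      simp only [hc, hd, dif_pos, dif_neg, not_false_eq_true] <;> intro h2 h3
    · exact Subtype.ext (Subtype.mk.inj (u.unmarked_once _ _ h1 h2 h3))
    · have := htu ⟨d.1, d.2.1, hd⟩ ⟨c.1, hc, c.2.2⟩
      rw [h2] at this
      exact absurd this (lt_irrefl _)
    · have := htu ⟨c.1, c.2.1, hc⟩ ⟨d.1, hd, d.2.2⟩
      rw [h2] at this
      exact absurd this (lt_irrefl _)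
    · exact Subtype.ext (Subtype.mk.inj (t.unmarked_once _ _ h1 h2 h3))
  marked_once := by
    intro c d h1
    by_cases hc : c.1 ∈ kap.shiftedDiagram <;> by_cases hd : d.1 ∈ kap.shiftedDiagram <;>
      simp only [hc, hd, dif_pos, dif_neg, not_false_eq_true] <;> intro h2 h3
    · exact Subtype.ext (Subtype.mk.inj (u.marked_once _ _ h1 h2 h3))
    · have := htu ⟨d.1, d.2.1, hd⟩ ⟨c.1, hc, c.2.2⟩
      rw [h2] at this
      exact absurd this (lt_irrefl _)
    · have := htu ⟨c.1, c.2.1, hc⟩ ⟨d.1, hd, d.2.2⟩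
      rw [h2] at this
      exact absurd this (lt_irrefl _)
    · exact Subtype.ext (Subtype.mk.inj (t.marked_once _ _ h1 h2 h3))

theorem index_lt_of_content {d : ℕ →₀ ℕ} {n : ℕ} (hd : ∀ k, n ≤ k → d k = 0)
    {t : MarkedTableau lam mu} (ht : ∀ k, t.exponent k = d k) (c) : (t.entry c).index < n := by
  by_contra hc
  exact Finsupp.mem_support_iff.1 (index_mem_support ht c) (hd _ (not_lt.mp hc))

theorem index_eq_of_content_single {n a : ℕ} {t : MarkedTableau lam mu}
    (ht : ∀ k, t.exponent k = Finsupp.single n a k) (c) : (t.entry c).index = n := by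
  have := Finsupp.support_single_subset (index_mem_support ht c)
  simpa using this

/-- A tableau is a pair of the tableau of its letters of index less than `n` and the tableau of its
letters of index `n`. -/
def splitEquiv {kap : StrictPartition} (h1 : mu.Contained kap) (h2 : kap.Contained lam)
    {d : ℕ →₀ ℕ} {n : ℕ} (hd : ∀ k, n ≤ k → d k = 0) (a : ℕ) :
    {t : OfContent lam mu (d + Finsupp.single n a) // t.1.Splits n kap} ≃
      OfContent lam kap d × OfContent kap mu (Finsupp.single n a) where
  toFun t := by
    have hn : d n = 0 := hd n le_rfl
    refine (⟨t.1.1.restrict (contained_refl lam) h1, fun k => ?_⟩,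
      ⟨t.1.1.restrict h2 (contained_refl mu), fun k => ?_⟩)
    · by_cases hk : k = n
      · rw [hk, hn]
        refine exponent_eq_zero fun c hc => ?_
        exact c.2.2 ((t.2.2.2 ⟨c.1, _⟩).1 hc)
      · have := t.1.2 k
        rw [Finsupp.add_apply, Finsupp.single_eq_of_ne hk, add_zero] at this
        rw [← this, exponent_eq, exponent_eq]
        congr 1
        ext c
        constructor
        · rintro ⟨h, h'⟩
          exact ⟨⟨h.1, fun hc => h.2 (h1.shiftedDiagram_subset hc)⟩, h'⟩
        · rintro ⟨h, h'⟩
          refine ⟨⟨h.1, fun hc => ?_⟩, h'⟩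
          exact hk (h'.symm.trans ((t.2.2.2 ⟨c, h⟩).2 hc))
    · rcases eq_or_ne k n with rfl | hk
      · have := t.1.2 k
        rw [Finsupp.add_apply, hn, zero_add] at this
        rw [← this, exponent_eq, exponent_eq]
        congr 1
        ext c
        constructor
        · rintro ⟨h, h'⟩
          exact ⟨⟨h2.shiftedDiagram_subset h.1, h.2⟩, h'⟩
        · rintro ⟨h, h'⟩
          exact ⟨⟨(t.2.2.2 ⟨c, h⟩).1 h', h.2⟩, h'⟩
      · rw [Finsupp.single_eq_of_ne hk]
        refine exponent_eq_zero fun c hc => hk ?_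
        rw [← hc]
        exact (t.2.2.2 ⟨c.1, h2.shiftedDiagram_subset c.2.1, c.2.2⟩).2 c.2.1
  invFun x := by
    have hn : d n = 0 := hd n le_rfl
    have hlt : ∀ c d, (x.1.1.entry c).index < (x.2.1.entry d).index := fun c d => by
      rw [index_eq_of_content_single x.2.2]
      exact index_lt_of_content hd x.1.2 c
    have hiff : ∀ c, ((glue x.1.1 x.2.1 hlt).entry c).index = n ↔ c.1 ∈ kap.shiftedDiagram := by
      intro c
      by_cases hc : c.1 ∈ kap.shiftedDiagram
      · simp only [glue, hc, dif_pos, iff_true]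
        exact index_eq_of_content_single x.2.2 _
      · simp only [glue, hc, dif_neg, not_false_eq_true, iff_false]
        exact (index_lt_of_content hd x.1.2 _).ne
    refine ⟨⟨glue x.1.1 x.2.1 hlt, fun k => ?_⟩, h1, h2, hiff⟩
    rw [Finsupp.add_apply]
    by_cases hk : k = n
    · rw [hk, hn, zero_add, ← x.2.2 n, exponent_eq, exponent_eq]
      congr 1
      ext c
      constructor
      · rintro ⟨h, h'⟩
        exact ⟨⟨(hiff ⟨c, h⟩).1 h', h.2⟩, index_eq_of_content_single x.2.2 _⟩
      · rintro ⟨h, h'⟩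
        exact ⟨⟨h2.shiftedDiagram_subset h.1, h.2⟩, (hiff ⟨c, _⟩).2 h.1⟩
    · rw [Finsupp.single_eq_of_ne hk, add_zero, ← x.1.2 k, exponent_eq, exponent_eq]
      congr 1
      ext c
      constructor
      · rintro ⟨h, h'⟩
        have hc : c ∉ kap.shiftedDiagram := fun hc => hk (h'.symm.trans ((hiff ⟨c, h⟩).2 hc))
        refine ⟨⟨h.1, hc⟩, ?_⟩
        simpa only [glue, hc, dif_neg, not_false_eq_true] using h'
      · rintro ⟨h, h'⟩
        refine ⟨⟨h.1, fun hc => h.2 (h1.shiftedDiagram_subset hc)⟩, ?_⟩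
        simpa only [glue, h.2, dif_neg, not_false_eq_true] using h'
  left_inv t := by
    refine Subtype.ext (Subtype.ext (MarkedTableau.ext fun c => ?_))
    by_cases hc : c.1 ∈ kap.shiftedDiagram <;>
      simp only [glue, restrict, hc, dif_neg, dif_pos, not_false_eq_true]
  right_inv x := by
    refine Prod.ext (Subtype.ext (MarkedTableau.ext fun c => ?_))
      (Subtype.ext (MarkedTableau.ext fun c => ?_))
    · simp only [glue, restrict, c.2.2, dif_neg, not_false_eq_true]
    · simp only [glue, restrict, c.2.1, dif_pos]

open Classical in
/-- The strict partitions between `mu` and `lam`. -/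
def _root_.ShiftedSchur.between (mu lam : StrictPartition) : Finset StrictPartition :=
  (sizeLE lam.size).filter fun kap => mu.Contained kap ∧ kap.Contained lam

theorem _root_.ShiftedSchur.mem_between {mu lam kap : StrictPartition} :
    kap ∈ between mu lam ↔ mu.Contained kap ∧ kap.Contained lam := by
  simp only [between, Finset.mem_filter, mem_sizeLE, and_iff_right_iff_imp]
  exact fun h => h.2.size_le

/-- Every tableau determines a unique `kap`, the shape filled by `mu` and the letters of index `n`;
`splitEquiv` counts the tableaux with this `kap`. -/
theorem card_ofContent_add_single (hc : mu.Contained lam) {d : ℕ →₀ ℕ} {n : ℕ}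
    (hd : ∀ k, n ≤ k → d k = 0) (a : ℕ) :
    Nat.card (OfContent lam mu (d + Finsupp.single n a)) =
      ∑ kap ∈ between mu lam,
        Nat.card (OfContent lam kap d) * Nat.card (OfContent kap mu (Finsupp.single n a)) := by
  have e : (Σ kap : between mu lam,
      {t : OfContent lam mu (d + Finsupp.single n a) // t.1.Splits n kap}) ≃
      OfContent lam mu (d + Finsupp.single n a) := by
    refine Equiv.ofBijective (fun x => x.2.1) ⟨?_, fun t => ?_⟩
    · rintro ⟨kap, t, ht⟩ ⟨kap', t', ht'⟩ (rfl : t = t')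
      obtain rfl : kap = kap' := Subtype.ext (ht.unique ht')
      rfl
    · obtain ⟨kap, hk⟩ := exists_splits hc t.1 (n := n) fun c => by
        refine Nat.lt_succ_iff.1 (index_lt_of_content (n := n + 1) (fun k hk => ?_) t.2 c)
        rw [Finsupp.add_apply, hd k (by omega), Finsupp.single_eq_of_ne (by omega), add_zero]
      exact ⟨⟨⟨kap, mem_between.2 ⟨hk.1, hk.2.1⟩⟩, t, hk⟩, rfl⟩
  rw [← Nat.card_congr e, Nat.card_sigma, ← Finset.sum_coe_sort (between mu lam)]
  refine Finset.sum_congr rfl fun kap _ => ?_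
  have := mem_between.1 kap.2
  rw [Nat.card_congr (splitEquiv this.1 this.2 hd a), Nat.card_prod]

end MarkedTableau

end ShiftedSchur

end

/-! ### Tableaux with letters of one index, and the symmetry of the skew functions. -/

noncomputable section

namespace ShiftedSchur

open StrictPartition

/-- The rows of `lam - mu` whose first box has no box of `lam - mu` below it. -/
def freeRows (lam mu : StrictPartition) : Finset ℕ :=
  lam.finite_support.toFinset.filter fun i =>
    mu.part i < lam.part i ∧ ¬ (mu.part i ≠ 0 ∧ lam.part (i + 1) = mu.part i)

theorem mem_freeRows {lam mu : StrictPartition} {i : ℕ} : i ∈ freeRows lam mu ↔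
    mu.part i < lam.part i ∧ ¬ (mu.part i ≠ 0 ∧ lam.part (i + 1) = mu.part i) := by
  simp only [freeRows, Finset.mem_filter, Set.Finite.mem_toFinset, Function.mem_support,
    and_iff_right_iff_imp]
  omega

/-- Let `B` be the set of nonempty rows and `J` the set of nonempty rows that are not free. By
interlacing, `lam_i` for a row of `B` is a part of `mu` only if it equals `mu_{i-1}`, that is, if `i
- 1` lies in `J`. So the parts of `lam` missing from `mu` are those in the rows of `B` outside the
shift of `J`, and both sides equal `#B - #J`. -/
theorem card_freeRows {lam mu : StrictPartition} (h : mu.Interlaces lam) :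
    (freeRows lam mu).card = (lam.support \ mu.support).card := by
  classical
  let B := lam.finite_support.toFinset.filter fun i => mu.part i < lam.part i
  have hB : ∀ i, i ∈ B ↔ mu.part i < lam.part i := fun i => by
    simp only [B, Finset.mem_filter, Set.Finite.mem_toFinset, Function.mem_support,
      and_iff_right_iff_imp]
    omega
  let J := B.filter fun i => mu.part i ≠ 0 ∧ lam.part (i + 1) = mu.part i
  have hJ : ∀ i, i ∈ J ↔ mu.part i ≠ 0 ∧ lam.part (i + 1) = mu.part i := fun i => by
    simp only [J, Finset.mem_filter, hB, and_iff_right_iff_imp]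
    have := lam.part_succ_lt i
    omega
  have hJB : J.map ⟨Nat.succ, Nat.succ_injective⟩ ⊆ B := by
    intro i hi
    obtain ⟨k, hk, rfl⟩ := Finset.mem_map.1 hi
    rw [hJ] at hk
    rw [hB]
    have := mu.part_succ_lt k
    change mu.part (k + 1) < lam.part (k + 1)
    omega
  have h1 : (freeRows lam mu).card + J.card = B.card := by
    rw [← Finset.card_filter_add_card_filter_not (s := B)
      (fun i => mu.part i ≠ 0 ∧ lam.part (i + 1) = mu.part i), add_comm]
    congr 2
    ext i
    rw [mem_freeRows, Finset.mem_filter, hB]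
  have h2 : (lam.support \ mu.support).card = (B \ J.map ⟨Nat.succ, Nat.succ_injective⟩).card := by
    symm
    have hmem : ∀ i, i ∈ B \ J.map ⟨Nat.succ, Nat.succ_injective⟩ ↔
        lam.part i ≠ 0 ∧ ∀ j, mu.part j ≠ lam.part i := by
      intro i
      rw [Finset.mem_sdiff, hB, Finset.mem_map]
      constructor
      · rintro ⟨hi, hn⟩
        refine ⟨by omega, fun j hj => ?_⟩
        rcases lt_or_ge j i with hji | hji
        · obtain ⟨k, rfl⟩ : ∃ k, i = k + 1 := ⟨i - 1, by omega⟩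
          have h3 := (h k).2
          have h4 := mu.antitone (Nat.lt_succ_iff.1 hji)
          rcases (Nat.lt_succ_iff.1 hji).lt_or_eq with h5 | rfl
          · have := mu.distinct j k (by omega) (by omega)
            omega
          · exact hn ⟨j, (hJ j).2 ⟨by omega, hj.symm⟩, rfl⟩
        · have := mu.antitone hji
          omega
      · rintro ⟨h0, hn⟩
        refine ⟨lt_of_le_of_ne (h i).1 (hn i), ?_⟩
        rintro ⟨k, hk, rfl⟩
        exact hn k ((hJ k).1 hk).2.symm
    refine Finset.card_bij (fun i _ => lam.part i - 1) ?_ ?_ ?_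
    · intro i hi
      rw [hmem] at hi
      rw [Finset.mem_sdiff, mem_support, mem_support]
      refine ⟨⟨i, by omega⟩, ?_⟩
      rintro ⟨j, hj⟩
      exact hi.2 j (by omega)
    · intro i hi j hj hij
      exact lam.part_sub_one_injOn ((hmem i).1 hi).1 ((hmem j).1 hj).1 hij
    · intro m hm
      rw [Finset.mem_sdiff, mem_support, mem_support] at hm
      obtain ⟨⟨i, hi⟩, hn⟩ := hm
      refine ⟨i, (hmem i).2 ⟨by omega, fun j hj => hn ⟨j, by omega⟩⟩, by omega⟩
  rw [h2, Finset.card_sdiff_of_subset hJB, Finset.card_map]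
  omega

namespace MarkedTableau

variable {lam mu : StrictPartition}

/-- For one index the marked letter is the larger one and occurs once in a row, so it can only be
the leftmost letter of this index. -/
theorem not_marked_of_row {t : MarkedTableau lam mu} {c d} (h1 : c.1.1 = d.1.1)
    (h2 : c.1.2 < d.1.2) (h : (t.entry c).index = (t.entry d).index) : ¬ (t.entry d).Marked := by
  intro hd
  have h3 := (letter_le_iff _ _).1 (t.row_noninc c d h1 h2.le)
  have h4 : (t.entry c).Marked := by
    rcases h3 with h3 | h3
    · omega
    · exact h3.2 hd
  have h5 := t.marked_once c d h1 ((letter_eq_iff _ _).2 ⟨h, iff_of_true h4 hd⟩) h4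
  rw [h5] at h2
  exact lt_irrefl _ h2

/-- Dually, the unmarked letter occurs once in a column and can only be the lowest letter of its
index. -/
theorem marked_of_col {t : MarkedTableau lam mu} {c d} (h1 : c.1.2 = d.1.2)
    (h2 : c.1.1 < d.1.1) (h : (t.entry c).index = (t.entry d).index) : (t.entry c).Marked := by
  by_contra hc
  have h3 := (letter_le_iff _ _).1 (t.col_noninc c d h1 h2.le)
  have h4 : ¬ (t.entry d).Marked := by
    rcases h3 with h3 | h3
    · omega
    · exact fun h4 => hc (h3.2 h4)
  have h5 := t.unmarked_once c d h1 ((letter_eq_iff _ _).2 ⟨h, iff_of_false hc h4⟩) hc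
  rw [h5] at h2
  exact lt_irrefl _ h2

theorem size_of_content_single (hc : mu.Contained lam) {n a : ℕ} {t : MarkedTableau lam mu}
    (ht : ∀ k, t.exponent k = Finsupp.single n a k) : lam.size = mu.size + a := by
  have h := ht n
  rw [Finsupp.single_eq_same, exponent_eq] at h
  rw [← ncard_shiftedSkewDiagram hc, ← h, add_comm]
  congr 2
  ext c
  exact ⟨fun hc => ⟨hc, index_eq_of_content_single ht _⟩, fun hc => hc.1⟩

/-- If `lam_{i+1} > mu_i`, the second box of row `i` of `lam - mu` has a box to its left and one
below it. The first forces it to be unmarked, the second to be marked. -/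
theorem interlaces_of_content_single (hc : mu.Contained lam) {n a : ℕ} {t : MarkedTableau lam mu}
    (ht : ∀ k, t.exponent k = Finsupp.single n a k) : mu.Interlaces lam := by
  refine fun i => ⟨hc i, ?_⟩
  by_contra hlt
  have h1 := lam.part_succ_lt i
  have h2 := mu.part_succ_lt i
  have hb1 : (i, mu.part i + i) ∈ lam.shiftedSkewDiagram mu :=
    ⟨⟨by simp, by simp only; omega⟩, fun h => by simpa using h.2⟩
  have hb2 : (i, mu.part i + i + 1) ∈ lam.shiftedSkewDiagram mu :=
    ⟨⟨by simp only; omega, by simp only; omega⟩, fun h => by have := h.2; simp only at this; omega⟩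
  have hb3 : (i + 1, mu.part i + i + 1) ∈ lam.shiftedSkewDiagram mu :=
    ⟨⟨by simp only; omega, by simp only; omega⟩, fun h => by have := h.2; simp only at this; omega⟩
  have hidx := index_eq_of_content_single ht
  exact not_marked_of_row (t := t) (c := ⟨_, hb1⟩) (d := ⟨_, hb2⟩) rfl (Nat.lt_succ_self _)
    (by rw [hidx, hidx]) (marked_of_col (t := t) (c := ⟨_, hb2⟩) (d := ⟨_, hb3⟩) rfl
      (Nat.lt_succ_self _) (by rw [hidx, hidx]))

/-- If a box of `lam - mu` lies above another one, then it is the first box of its row, and the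
row is not free. -/
theorem first_of_above (h : mu.Interlaces lam) {i i' j : ℕ} (hii : i < i')
    (hc : (i, j) ∈ lam.shiftedSkewDiagram mu) (hd : (i', j) ∈ lam.shiftedSkewDiagram mu) :
    j = mu.part i + i ∧ i ∉ freeRows lam mu := by
  have h1 : mu.part i + i ≤ j := by
    by_contra hlt
    exact hc.2 ⟨hc.1.1, not_le.mp hlt⟩
  have h2 := hd.1.2
  have h3 := hd.1.1
  simp only at h2 h3
  have key : ∀ n, i + 1 ≤ n → lam.part n ≠ 0 →
      lam.part n + n ≤ lam.part (i + 1) + (i + 1) ∧ lam.part (i + 1) ≠ 0 := by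
    intro n hn
    induction n, hn using Nat.le_induction with
    | base => exact fun h => ⟨le_rfl, h⟩
    | succ n _ ih =>
      intro h0
      have h4 := lam.part_succ_lt n
      have := ih (by omega)
      omega
  have h4 := key i' hii (by omega)
  have h5 := (h i).2
  rw [mem_freeRows]
  omega

theorem isFirst_of_not_left {i j : ℕ} (hc : (i, j) ∈ lam.shiftedSkewDiagram mu) :
    mu.part i + i ≤ j ∧ j < lam.part i + i := by
  refine ⟨?_, hc.1.2⟩
  by_contra hlt
  exact hc.2 ⟨hc.1.1, not_le.mp hlt⟩

/-- The first box of a free row. -/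
def freeBox (i : freeRows lam mu) : lam.shiftedSkewDiagram mu :=
  ⟨(i.1, mu.part i + i), ⟨Nat.le_add_left _ _, Nat.add_lt_add_right (mem_freeRows.1 i.2).1 _⟩,
    fun h => lt_irrefl _ h.2⟩

open Classical in
/-- The fillings of `lam - mu` by the letters of one index correspond to the choices of marks for
the free boxes. -/
def singleEquiv (h : mu.Interlaces lam) {n a : ℕ} (ha : lam.size = mu.size + a) :
    OfContent lam mu (Finsupp.single n a) ≃ (freeRows lam mu → Bool) where
  toFun t i := decide (t.1.entry (freeBox i)).Marked
  invFun g := by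
    -- A box with a neighbour to its left must be unmarked, and the first box of a row that is not
    -- free must be marked because of the box below it; the first boxes of free rows are
    -- unconstrained.
    let e : lam.shiftedSkewDiagram mu → Letter := fun c => mkLetter n
      (if c.1.2 = mu.part c.1.1 + c.1.1 then
        (if hi : c.1.1 ∈ freeRows lam mu then g ⟨c.1.1, hi⟩ else true) else false)
    have hrow : ∀ c d : lam.shiftedSkewDiagram mu, c.1.1 = d.1.1 → c.1.2 < d.1.2 →
        ¬ (e d).Marked := by
      intro c d h1 h2
      have h3 : mu.part c.1.1 + c.1.1 ≤ c.1.2 := (isFirst_of_not_left c.2).1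
      have : d.1.2 ≠ mu.part d.1.1 + d.1.1 := by
        rw [← h1]
        omega
      simp [e, this]
    have hcol : ∀ c d : lam.shiftedSkewDiagram mu, c.1.2 = d.1.2 → c.1.1 < d.1.1 →
        (e c).Marked := by
      intro c d h1 h2
      obtain ⟨h3, h4⟩ := first_of_above h h2 c.2 (by rw [h1]; exact d.2)
      simp only [e, marked_mkLetter, h3, if_true, h4, dif_neg, not_false_eq_true]
    refine ⟨⟨e, ?_, ?_, ?_, ?_⟩, ?_⟩
    · intro c d h1 h2
      rcases h2.lt_or_eq with h2 | h2
      · exact (letter_le_iff _ _).2 (Or.inr ⟨rfl, fun h' => absurd h' (hrow c d h1 h2)⟩)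
      · rw [Subtype.ext (Prod.ext h1 h2) (a1 := c) (a2 := d)]
    · intro c d h1 h2
      rcases h2.lt_or_eq with h2 | h2
      · exact (letter_le_iff _ _).2 (Or.inr ⟨rfl, fun _ => hcol c d h1 h2⟩)
      · rw [Subtype.ext (Prod.ext h2 h1) (a1 := c) (a2 := d)]
    · intro c d h1 h2 h3
      rcases lt_trichotomy c.1.1 d.1.1 with h4 | h4 | h4
      · exact absurd (hcol c d h1 h4) h3
      · exact Subtype.ext (Prod.ext h4 h1)
      · exact absurd (hcol d c h1.symm h4) (h2 ▸ h3)
    · intro c d h1 h2 h3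
      rcases lt_trichotomy c.1.2 d.1.2 with h4 | h4 | h4
      · exact absurd (h2 ▸ h3) (hrow c d h1 h4)
      · exact Subtype.ext (Prod.ext h1 h4)
      · exact absurd h3 (hrow d c h1.symm h4)
    · intro k
      by_cases hk : k = n
      · subst hk
        rw [exponent_eq, Finsupp.single_eq_same]
        have := ncard_shiftedSkewDiagram h.contained
        have hset : {c | ∃ hc : c ∈ lam.shiftedSkewDiagram mu, (e ⟨c, hc⟩).index = k} =
            lam.shiftedSkewDiagram mu := by
          ext c
          exact ⟨fun hc => hc.1, fun hc => ⟨hc, rfl⟩⟩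
        rw [hset]
        omega
      · rw [Finsupp.single_eq_of_ne hk]
        exact exponent_eq_zero fun c hc => hk hc.symm
  left_inv t := by
    refine Subtype.ext (MarkedTableau.ext fun c => (letter_eq_iff _ _).2 ⟨?_, ?_⟩)
    · rw [index_eq_of_content_single t.2]
      rfl
    · obtain ⟨⟨i, j⟩, hc⟩ := c
      have hidx := index_eq_of_content_single t.2
      have hb := isFirst_of_not_left hc
      by_cases hj : j = mu.part i + i
      · by_cases hi : i ∈ freeRows lam mu
        · simp only [hj, hi, marked_mkLetter, if_true, dif_pos, decide_eq_true_eq]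
          exact Iff.rfl
        · simp only [hj, hi, marked_mkLetter, if_true, dif_neg, not_false_eq_true, true_iff]
          rw [mem_freeRows] at hi
          have h1 := mu.part_succ_lt i
          have hd : (i + 1, mu.part i + i) ∈ lam.shiftedSkewDiagram mu := by
            refine ⟨⟨by simp only; omega, by simp only; omega⟩, fun h => ?_⟩
            have := h.2
            simp only at this
            omega
          exact marked_of_col (d := ⟨_, hd⟩) rfl (Nat.lt_succ_self i) (by rw [hidx, hidx])
      · simp only [hj, if_false, marked_mkLetter, Bool.false_eq_true, false_iff]
        have hd : (i, mu.part i + i) ∈ lam.shiftedSkewDiagram mu := by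
          refine ⟨⟨by simp only; omega, by simp only; omega⟩, fun h => ?_⟩
          have := h.2
          simp only at this
          omega
        exact not_marked_of_row (c := ⟨_, hd⟩) rfl (by simp only; omega) (by rw [hidx, hidx])
  right_inv g := by
    funext i
    simp [freeBox]

theorem card_ofContent_single (hc : mu.Contained lam) (n a : ℕ) :
    (Nat.card (OfContent lam mu (Finsupp.single n a)) : ℚ) = matEntry (raiseOp a) lam mu := by
  classical
  rw [entry_raiseOp, stripQ, ← ite_and]
  split_ifs with h
  · rw [Nat.card_congr (singleEquiv h.2 h.1), Nat.card_fun, ← card_freeRows h.2]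
    simp
  · have : IsEmpty (OfContent lam mu (Finsupp.single n a)) :=
      ⟨fun t => h ⟨size_of_content_single hc t.2, interlaces_of_content_single hc t.2⟩⟩
    rw [Nat.card_of_isEmpty, Nat.cast_zero]

/-- Induction on a bound for the indices, removing the largest one by the branching rule. Its
letters are adjacent to `mu`, so its operator has to act first; commutation brings it to the right
end of the product. -/
theorem card_ofContent (hc : mu.Contained lam) (d : ℕ →₀ ℕ) :
    (Nat.card (OfContent lam mu d) : ℚ) = matEntry (raiseMulti d) lam mu := by
  classical
  obtain ⟨n, hn⟩ : ∃ n, ∀ k, n ≤ k → d k = 0 := by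
    refine ⟨d.support.sup id + 1, fun k hk => ?_⟩
    by_contra h
    have : k ≤ d.support.sup id := Finset.le_sup (f := id) (Finsupp.mem_support_iff.2 h)
    omega
  induction n generalizing d mu with
  | zero =>
    obtain rfl : d = 0 := Finsupp.ext fun k => hn k (Nat.zero_le k)
    rw [card_ofContent_zero lam mu hc, raiseMulti, multiProd_zero, entry_one]
    split_ifs <;> simp
  | succ n ih =>
    have hd : ∀ k, n ≤ k → d.erase n k = 0 := by
      intro k hk
      rcases eq_or_ne k n with rfl | h
      · exact Finsupp.erase_same
      · rw [Finsupp.erase_ne h]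
        exact hn k (by omega)
    rw [← Finsupp.erase_add_single n d, card_ofContent_add_single hc hd, raiseMulti,
      multiProd_add_single _ _ raiseOp_zero (Finsupp.erase_same),
      (multiProd_commute _ _ (raiseOp_commute _) _).eq, entry_mul,
      finsum_eq_sum_of_support_subset (s := between mu lam)]
    · rw [Nat.cast_sum]
      refine Finset.sum_congr rfl fun kap hk => ?_
      rw [mem_between] at hk
      rw [Nat.cast_mul, card_ofContent_single hk.1, ih hk.2 _ hd]
      rfl
    · intro kap hk
      rw [Function.mem_support] at hk
      rw [Finset.mem_coe, mem_between]
      refine ⟨?_, (raiseMulti_entry_ne_zero (left_ne_zero_of_mul hk)).1⟩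
      have h2 := right_ne_zero_of_mul hk
      rw [entry_raiseOp] at h2
      exact contained_of_stripQ_ne_zero (ite_ne_right_iff.1 h2).2

end MarkedTableau

theorem coeff_skewQSeries_eq (lam mu : StrictPartition) (d : ℕ →₀ ℕ) :
    MvPowerSeries.coeff d (skewQSeries lam mu) = matEntry (raiseMulti d) lam mu := by
  rw [coeff_skewQSeries]
  split_ifs with h
  · exact MarkedTableau.card_ofContent h d
  · by_contra hc
    exact h (raiseMulti_entry_ne_zero (Ne.symm hc)).1

/-- The skew `Q`-functions are symmetric functions. -/
theorem skewQSeries_mem_Lambda (lam mu : StrictPartition) : skewQSeries lam mu ∈ Lambda := by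
  refine ⟨fun s d => ?_, lam.size, fun d hd => ?_⟩
  -- Permuting the variables permutes the factors of a product of commuting operators.
  · rw [coeff_skewQSeries_eq, coeff_skewQSeries_eq, raiseMulti, raiseMulti,
      multiProd_equivMapDomain]
  · rw [coeff_skewQSeries_eq] at hd
    have := (raiseMulti_entry_ne_zero hd).2
    omega

theorem coeff_skewQ (lam mu : StrictPartition) (d : ℕ →₀ ℕ) :
    MvPowerSeries.coeff d (skewQ lam mu : MvPowerSeries ℕ ℚ) = matEntry (raiseMulti d) lam mu := by
  rw [skewQ, dif_pos (skewQSeries_mem_Lambda lam mu), coeff_skewQSeries_eq]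

theorem coeff_skewP (lam mu : StrictPartition) (d : ℕ →₀ ℕ) :
    MvPowerSeries.coeff d (skewP lam mu : MvPowerSeries ℕ ℚ) = matEntry (lowerMulti d) mu lam := by
  rw [skewP, Subalgebra.coe_smul, MvPowerSeries.coeff_smul, coeff_skewQ, isAdjoint_multi d lam mu]

end ShiftedSchur

end

/-! ### From identities in two alphabets to arbitrary specializations. -/

noncomputable section

namespace ShiftedSchur

open StrictPartition
open Finset.HasAntidiagonal (antidiagonal mem_antidiagonal)

theorem Lambda_ext {f g : Lambda} (h : ∀ d, MvPowerSeries.coeff d (f : MvPowerSeries ℕ ℚ) =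
    MvPowerSeries.coeff d (g : MvPowerSeries ℕ ℚ)) : f = g :=
  Subtype.ext (MvPowerSeries.ext h)

theorem coeff_sum_smul {ι : Type*} (s : Finset ι) (c : ι → ℚ) (f : ι → Lambda) (d : ℕ →₀ ℕ) :
    MvPowerSeries.coeff d ((∑ i ∈ s, c i • f i : Lambda) : MvPowerSeries ℕ ℚ) =
      ∑ i ∈ s, c i * MvPowerSeries.coeff d (f i : MvPowerSeries ℕ ℚ) := by
  rw [AddSubmonoidClass.coe_finsetSum, map_sum]
  refine Finset.sum_congr rfl fun i _ => ?_
  rw [Subalgebra.coe_smul]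
  rfl

/-- An identity between sums of products of symmetric functions in two sets of variables implies
the identity between the sums of products of their specializations. -/
theorem sum_specialization_eq {ι κ : Type*} {s : Finset ι} {t : Finset κ} {f g : ι → Lambda}
    {f' g' : κ → Lambda}
    (h : ∀ d e, ∑ i ∈ s, MvPowerSeries.coeff d (f i : MvPowerSeries ℕ ℚ) *
        MvPowerSeries.coeff e (g i : MvPowerSeries ℕ ℚ) =
      ∑ j ∈ t, MvPowerSeries.coeff d (f' j : MvPowerSeries ℕ ℚ) *
        MvPowerSeries.coeff e (g' j : MvPowerSeries ℕ ℚ)) (a b : Specialization) :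
    ∑ i ∈ s, a (f i) * b (g i) = ∑ j ∈ t, a (f' j) * b (g' j) := by
  classical
  -- Comparing coefficients in the second alphabet allows `a` to be applied. Its values are complex
  -- while `b` is only `ℚ`-linear, so these values are split into rational coordinates before `b` is
  -- applied.
  let B := Module.Basis.ofVectorSpace ℚ ℂ
  have h1 : ∀ e, ∑ i ∈ s, MvPowerSeries.coeff e (g i : MvPowerSeries ℕ ℚ) • a (f i) =
      ∑ j ∈ t, MvPowerSeries.coeff e (g' j : MvPowerSeries ℕ ℚ) • a (f' j) := by
    intro e
    have : ∑ i ∈ s, MvPowerSeries.coeff e (g i : MvPowerSeries ℕ ℚ) • f i =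
        ∑ j ∈ t, MvPowerSeries.coeff e (g' j : MvPowerSeries ℕ ℚ) • f' j := by
      refine Lambda_ext fun d => ?_
      simp only [coeff_sum_smul]
      simpa only [mul_comm] using h d e
    simpa only [map_sum, map_smul] using congrArg a this
  have h2 : ∀ β, ∑ i ∈ s, B.repr (a (f i)) β • b (g i) =
      ∑ j ∈ t, B.repr (a (f' j)) β • b (g' j) := by
    intro β
    have : ∑ i ∈ s, B.repr (a (f i)) β • g i = ∑ j ∈ t, B.repr (a (f' j)) β • g' j := by
      refine Lambda_ext fun e => ?_
      simp only [coeff_sum_smul]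
      simpa [mul_comm] using congrArg (fun x => B.repr x β) (h1 e)
    simpa only [map_sum, map_smul] using congrArg b this
  let T := (s.biUnion fun i => (B.repr (a (f i))).support) ∪
    t.biUnion fun j => (B.repr (a (f' j))).support
  have h3 : ∀ x y, (B.repr x).support ⊆ T → x * y = ∑ β ∈ T, B β * (B.repr x β • y) := by
    intro x y hx
    conv_lhs => rw [← B.linearCombination_repr x, Finsupp.linearCombination_apply,
      Finsupp.sum_of_support_subset _ hx _ (by simp), Finset.sum_mul]
    refine Finset.sum_congr rfl fun β _ => ?_
    rw [smul_mul_assoc, mul_smul_comm]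
  rw [Finset.sum_congr rfl fun i hi => h3 _ _ ((Finset.subset_biUnion_of_mem
      (fun i => (B.repr (a (f i))).support) hi).trans Finset.subset_union_left),
    Finset.sum_congr rfl fun j hj => h3 _ _ ((Finset.subset_biUnion_of_mem
      (fun j => (B.repr (a (f' j))).support) hj).trans Finset.subset_union_right),
    Finset.sum_comm, Finset.sum_comm (s := t)]
  refine Finset.sum_congr rfl fun β _ => ?_
  rw [← Finset.mul_sum, ← Finset.mul_sum, h2]

theorem skewQ_eq_zero {lam mu : StrictPartition} (h : ¬ mu.Contained lam) : skewQ lam mu = 0 := by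
  refine Lambda_ext fun d => ?_
  rw [coeff_skewQ]
  by_contra hc
  exact h (raiseMulti_entry_ne_zero hc).1

theorem skewP_eq_zero {lam mu : StrictPartition} (h : ¬ mu.Contained lam) : skewP lam mu = 0 := by
  rw [skewP, skewQ_eq_zero h, smul_zero]

theorem contained_of_skewQ_ne_zero {lam mu : StrictPartition} {a : Specialization}
    (h : a (skewQ lam mu) ≠ 0) : mu.Contained lam := by
  by_contra hc
  exact h (by rw [skewQ_eq_zero hc, map_zero])

theorem contained_of_skewP_ne_zero {lam mu : StrictPartition} {a : Specialization}
    (h : a (skewP lam mu) ≠ 0) : mu.Contained lam := by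
  by_contra hc
  exact h (by rw [skewP_eq_zero hc, map_zero])

@[simp]
theorem skewQ_self (lam : StrictPartition) : skewQ lam lam = 1 := by
  classical
  refine Lambda_ext fun d => ?_
  rw [coeff_skewQ, OneMemClass.coe_one, MvPowerSeries.coeff_one]
  split_ifs with h
  · rw [h, raiseMulti, multiProd_zero, entry_one, if_pos rfl]
  · by_contra hc
    have := (raiseMulti_entry_ne_zero hc).2
    exact h ((Finsupp.degree_eq_zero_iff d).1 (by omega))

@[simp]
theorem skewP_self (lam : StrictPartition) : skewP lam lam = 1 := by
  simp [skewP]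

/-- If `d` has degree `k`, this is an entry of `lowerMulti_mul_raiseMulti`: the vacuum entry there
expands into a sum over `x.1`, the product of operators into one over `x.2`. Otherwise both sides
vanish for degree reasons. Fixing `k` makes the sums finite, as `sum_specialization_eq` requires. -/
theorem coeff_skew_cauchy (mu nu : StrictPartition) (k : ℕ) (d e : ℕ →₀ ℕ) :
    ∑ lam ∈ ofSize (mu.size + k), MvPowerSeries.coeff d (skewQ lam mu : MvPowerSeries ℕ ℚ) *
        MvPowerSeries.coeff e (skewP lam nu : MvPowerSeries ℕ ℚ) =
      ∑ x ∈ (sizeLE k ×ˢ sizeLE mu.size).filter fun x => x.1.size + nu.size = x.2.size + k,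
        MvPowerSeries.coeff d ((schurQ x.1 * skewQ nu x.2 : Lambda) : MvPowerSeries ℕ ℚ) *
          MvPowerSeries.coeff e ((schurP x.1 * skewP mu x.2 : Lambda) : MvPowerSeries ℕ ℚ) := by
  classical
  simp only [MulMemClass.coe_mul, MvPowerSeries.coeff_mul, schurQ, schurP, coeff_skewQ, coeff_skewP]
  by_cases hd : d.degree = k
  · have hl : ∑ lam ∈ ofSize (mu.size + k), matEntry (raiseMulti d) lam mu *
        matEntry (lowerMulti e) nu lam = matEntry (lowerMulti e * raiseMulti d) nu mu := by
      rw [entry_mul, finsum_eq_sum_of_support_subset (s := ofSize (mu.size + k))]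
      · exact Finset.sum_congr rfl fun lam _ => mul_comm _ _
      · intro lam h
        rw [Finset.mem_coe, mem_ofSize, (raiseMulti_entry_ne_zero (right_ne_zero_of_mul h)).2, hd]
    rw [hl, lowerMulti_mul_raiseMulti, entry_sum]
    simp only [entry_sum, entry_smul, smul_eq_mul, Finset.sum_filter]
    rw [Finset.sum_comm]
    simp only [Finset.sum_mul_sum]
    have h1 : ∀ x ∈ sizeLE k ×ˢ sizeLE mu.size,
        (if x.1.size + nu.size = x.2.size + k then ∑ p ∈ antidiagonal d, ∑ q ∈ antidiagonal e,
          matEntry (raiseMulti p.1) x.1 empty * matEntry (raiseMulti p.2) nu x.2 *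
            (matEntry (lowerMulti q.1) empty x.1 * matEntry (lowerMulti q.2) x.2 mu) else 0) =
        ∑ p ∈ antidiagonal d, ∑ q ∈ antidiagonal e,
          matEntry (raiseMulti p.1) x.1 empty * matEntry (raiseMulti p.2) nu x.2 *
            (matEntry (lowerMulti q.1) empty x.1 * matEntry (lowerMulti q.2) x.2 mu) := by
      intro x _
      split_ifs with h
      · rfl
      · symm
        refine Finset.sum_eq_zero fun p hp => Finset.sum_eq_zero fun q _ => ?_
        by_contra hne
        have h2 := left_ne_zero_of_mul hne
        have h3 := (raiseMulti_entry_ne_zero (left_ne_zero_of_mul h2)).2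
        have h4 := (raiseMulti_entry_ne_zero (right_ne_zero_of_mul h2)).2
        have h5 := congrArg Finsupp.degree (mem_antidiagonal.1 hp)
        rw [map_add] at h5
        rw [size_empty] at h3
        omega
    rw [Finset.sum_congr rfl h1, Finset.sum_comm (s := sizeLE k ×ˢ sizeLE mu.size)]
    refine Finset.sum_congr rfl fun p hp => ?_
    rw [Finset.sum_comm (s := sizeLE k ×ˢ sizeLE mu.size)]
    refine Finset.sum_congr rfl fun q _ => ?_
    have hk : p.1.degree ≤ k := by
      have h5 := congrArg Finsupp.degree (mem_antidiagonal.1 hp)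
      rw [map_add] at h5
      omega
    rw [entry_mul, entry_mul, finsum_eq_sum_of_support_subset (s := sizeLE k),
      finsum_eq_sum_of_support_subset (s := sizeLE mu.size), Finset.sum_mul_sum,
      ← Finset.sum_product']
    · refine Finset.sum_congr rfl fun x _ => ?_
      ring
    · intro tau h
      rw [Finset.mem_coe, mem_sizeLE]
      have := (lowerMulti_entry_ne_zero (right_ne_zero_of_mul h)).2
      omega
    · intro kap h
      have := (raiseMulti_entry_ne_zero (right_ne_zero_of_mul h)).2
      rw [Finset.mem_coe, mem_sizeLE]
      rw [size_empty] at this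
      omega
  · rw [Finset.sum_eq_zero, Finset.sum_eq_zero]
    · intro x hx
      rw [Finset.mem_filter] at hx
      refine mul_eq_zero_of_left (Finset.sum_eq_zero fun p hp => ?_) _
      by_contra hne
      have h3 := (raiseMulti_entry_ne_zero (left_ne_zero_of_mul hne)).2
      have h4 := (raiseMulti_entry_ne_zero (right_ne_zero_of_mul hne)).2
      have h5 := congrArg Finsupp.degree (mem_antidiagonal.1 hp)
      rw [map_add] at h5
      rw [size_empty] at h3
      omega
    · intro lam hl
      rw [mem_ofSize] at hl
      by_contra hne
      have := (raiseMulti_entry_ne_zero (left_ne_zero_of_mul hne)).2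
      omega

/-- The skew Cauchy identity for arbitrary specializations. -/
theorem skew_cauchy (a b : Specialization) (mu nu : StrictPartition) (k : ℕ) :
    ∑ lam ∈ ofSize (mu.size + k), a (skewQ lam mu) * b (skewP lam nu) =
      ∑ x ∈ (sizeLE k ×ˢ sizeLE mu.size).filter fun x => x.1.size + nu.size = x.2.size + k,
        HTerm a b x.1 * (a (skewQ nu x.2) * b (skewP mu x.2)) := by
  rw [sum_specialization_eq (coeff_skew_cauchy mu nu k)]
  refine Finset.sum_congr rfl fun x _ => ?_
  rw [map_mul, map_mul, HTerm]
  ring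

theorem coeff_gradedH (a b : Specialization) (N : ℕ) :
    PowerSeries.coeff N (gradedH a b) = ∑ lam ∈ ofSize N, HTerm a b lam := by
  rw [gradedH, PowerSeries.coeff_mk]
  refine (finsum_mem_congr (Set.ext fun lam => ?_) fun _ _ => rfl).trans
    (finsum_mem_coe_finset _ (ofSize N))
  exact (mem_ofSize (lam := lam)).symm

end ShiftedSchur

end

/-! ### Operators of specializations, normal ordering and vacuum expectation. -/

noncomputable section

namespace ShiftedSchur

open StrictPartition PowerSeries
open Finset.HasAntidiagonal (antidiagonal mem_antidiagonal)

/-- The operator with matrix entries `Q_{lam/mu}(a)`, restricted to the degree `k`. -/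
def specQ (a : Specialization) (k : ℕ) : Module.End ℂ (Fock ℂ) :=
  kernelOp (fun mu => ofSize (mu.size + k)) fun lam mu => a (skewQ lam mu)

/-- The operator with matrix entries `P_{lam/mu}(b)`. -/
def specP (b : Specialization) : Module.End ℂ (Fock ℂ) :=
  kernelOp (fun lam => sizeLE lam.size) fun mu lam => b (skewP lam mu)

theorem entry_specQ (a : Specialization) (k : ℕ) (lam mu : StrictPartition) :
    matEntry (specQ a k) lam mu = if lam.size = mu.size + k then a (skewQ lam mu) else 0 := by
  classical
  rw [specQ, entry_kernelOp]
  simp only [mem_ofSize]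

theorem entry_specP (b : Specialization) (mu lam : StrictPartition) :
    matEntry (specP b) mu lam = b (skewP lam mu) := by
  classical
  rw [specP, entry_kernelOp, ite_eq_left_iff, mem_sizeLE]
  intro h
  symm
  by_contra hc
  exact h (contained_of_skewP_ne_zero hc).size_le

/-- The generating series of the operators `specQ a k`. -/
def seriesQ (a : Specialization) : PowerSeries (Module.End ℂ (Fock ℂ)) := mk (specQ a)

/-- The operator `specP b` as a constant series. -/
def seriesP (b : Specialization) : PowerSeries (Module.End ℂ (Fock ℂ)) := C (specP b)

/-- Scalar series as series of operators. -/
def scalarSeries : PowerSeries ℂ →+* PowerSeries (Module.End ℂ (Fock ℂ)) :=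
  PowerSeries.map (algebraMap ℂ _)

theorem scalarSeries_commute (f : PowerSeries ℂ) (x : PowerSeries (Module.End ℂ (Fock ℂ))) :
    Commute (scalarSeries f) x := mvPowerSeries_map_commute f x

theorem sum_sizeLE {A : Type*} [AddCommMonoid A] (k : ℕ) (G : ℕ → StrictPartition → A) :
    ∑ q ∈ antidiagonal k, ∑ kap ∈ ofSize q.1, G q.2 kap =
      ∑ kap ∈ sizeLE k, G (k - kap.size) kap := by
  rw [Finset.sum_sigma']
  refine Finset.sum_bij' (fun x _ => x.2) (fun kap _ => ⟨(kap.size, k - kap.size), kap⟩)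
    ?_ ?_ ?_ ?_ ?_
  · rintro ⟨q, kap⟩ h
    simp only [Finset.mem_sigma, mem_antidiagonal, mem_ofSize] at h
    refine mem_sizeLE.2 ?_
    change kap.size ≤ k
    omega
  · intro kap h
    rw [mem_sizeLE] at h
    simp only [Finset.mem_sigma, mem_antidiagonal, mem_ofSize, and_true]
    omega
  · rintro ⟨⟨q1, q2⟩, kap⟩ h
    simp only [Finset.mem_sigma, mem_antidiagonal, mem_ofSize] at h
    obtain ⟨h, rfl⟩ := h
    simp [← h]
  · intro kap _
    rfl
  · rintro ⟨⟨q1, q2⟩, kap⟩ h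
    simp only [Finset.mem_sigma, mem_antidiagonal, mem_ofSize] at h
    obtain ⟨h, rfl⟩ := h
    simp [← h]

theorem entry_specP_mul_specQ (a b : Specialization) (k : ℕ) (nu mu : StrictPartition) :
    matEntry (specP b * specQ a k) nu mu =
      ∑ lam ∈ ofSize (mu.size + k), b (skewP lam nu) * a (skewQ lam mu) := by
  rw [specQ, entry_mul_kernelOp]
  simp only [entry_specP]

/-- The entries are those of `skew_cauchy`. Only the degree of the `Q`-operators is recorded; `k`
splits into `|kap|`, coming from the scalar, and `|nu| - |tau|`. -/
theorem seriesP_mul_seriesQ (a b : Specialization) :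
    seriesP b * seriesQ a = scalarSeries (gradedH a b) * (seriesQ a * seriesP b) := by
  classical
  ext1 k
  refine end_ext fun nu mu => ?_
  have h1 : coeff k (seriesP b * seriesQ a) = specP b * specQ a k := by
    rw [seriesP, seriesQ, coeff_C_mul, coeff_mk]
  have h2 : ∀ m, coeff m (seriesQ a * seriesP b) = specQ a m * specP b := fun m => by
    rw [seriesP, seriesQ, coeff_mul_C, coeff_mk]
  have h3 : ∀ m, matEntry (specQ a m * specP b) nu mu = ∑ tau ∈ sizeLE mu.size,
      (if nu.size = tau.size + m then a (skewQ nu tau) else 0) * b (skewP mu tau) := fun m => by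
    rw [specP, entry_mul_kernelOp]
    simp only [entry_specQ]
  rw [h1, coeff_mul, entry_sum, entry_specP_mul_specQ]
  simp only [h2, scalarSeries, coeff_map, ← Algebra.smul_def, entry_smul, coeff_gradedH, h3,
    smul_eq_mul, Finset.sum_mul]
  rw [sum_sizeLE k fun m kap => HTerm a b kap * ∑ tau ∈ sizeLE mu.size,
      (if nu.size = tau.size + m then a (skewQ nu tau) else 0) * b (skewP mu tau)]
  rw [Finset.sum_congr rfl fun lam _ => mul_comm (b (skewP lam nu)) (a (skewQ lam mu)),
    skew_cauchy a b mu nu k, Finset.sum_filter, Finset.sum_product]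
  refine Finset.sum_congr rfl fun kap hk => ?_
  rw [mem_sizeLE] at hk
  rw [Finset.mul_sum]
  refine Finset.sum_congr rfl fun tau _ => ?_
  by_cases h : nu.size = tau.size + (k - kap.size)
  · rw [if_pos h, if_pos (by simp only; omega)]
  · rw [if_neg h, if_neg (by simp only; omega), zero_mul, mul_zero]

/-- The vacuum expectation value of a series of operators. -/
def vacuum (x : PowerSeries (Module.End ℂ (Fock ℂ))) : PowerSeries ℂ :=
  mk fun N => matEntry (coeff N x) empty empty

theorem vacuum_scalarSeries_mul (f : PowerSeries ℂ) (x : PowerSeries (Module.End ℂ (Fock ℂ))) :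
    vacuum (scalarSeries f * x) = f * vacuum x := by
  ext N
  rw [vacuum, coeff_mk, coeff_mul, coeff_mul, entry_sum]
  refine Finset.sum_congr rfl fun q _ => ?_
  rw [scalarSeries, coeff_map, ← Algebra.smul_def, entry_smul, vacuum, coeff_mk, smul_eq_mul]

/-- A raising operator reaches `empty` only from `empty`, and only in degree `0`, where its entry is
`1`. -/
theorem matEntry_specQ_mul (a : Specialization) (k : ℕ) (x : Module.End ℂ (Fock ℂ)) :
    matEntry (specQ a k * x) empty empty = if k = 0 then matEntry x empty empty else 0 := by
  have h : ∀ iot, matEntry (specQ a k) empty iot * matEntry x iot empty ≠ 0 →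
      k = 0 ∧ iot = empty := by
    intro iot hi
    have h1 := left_ne_zero_of_mul hi
    rw [entry_specQ] at h1
    have h2 := (ite_ne_right_iff.1 h1).1
    rw [size_empty] at h2
    exact ⟨by omega, size_eq_zero.1 (by omega)⟩
  rw [entry_mul]
  split_ifs with hk
  · rw [finsum_eq_single _ empty fun iot hi => ?_]
    · rw [entry_specQ, if_pos (by omega), skewQ_self, map_one, one_mul]
    · by_contra hc
      exact hi (h iot hc).2
  · refine finsum_eq_zero_of_forall_eq_zero fun iot => ?_
    by_contra hc
    exact hk (h iot hc).1

theorem vacuum_seriesQ_mul (a : Specialization) (x : PowerSeries (Module.End ℂ (Fock ℂ))) :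
    vacuum (seriesQ a * x) = vacuum x := by
  ext N
  rw [vacuum, vacuum, coeff_mk, coeff_mk, coeff_mul, entry_sum]
  simp only [seriesQ, coeff_mk, matEntry_specQ_mul]
  rw [Finset.sum_eq_single (0, N)]
  · simp
  · rintro ⟨q1, q2⟩ hq hne
    rw [mem_antidiagonal] at hq
    refine if_neg ?_
    rintro rfl
    simp at hq
    exact hne (by rw [hq])
  · intro h
    exact absurd (mem_antidiagonal.2 (zero_add N)) h

theorem vacuum_mul_seriesP (b : Specialization) (x : PowerSeries (Module.End ℂ (Fock ℂ))) :
    vacuum (x * seriesP b) = vacuum x := by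
  ext N
  rw [vacuum, vacuum, coeff_mk, coeff_mk, seriesP, coeff_mul_C, specP, entry_mul_kernelOp,
    Finset.sum_eq_single empty]
  · rw [skewP_self, map_one, mul_one]
  · intro iot hi hne
    rw [mem_sizeLE, size_empty, Nat.le_zero, size_eq_zero] at hi
    exact absurd hi hne
  · intro h
    exact absurd (mem_sizeLE.2 le_rfl) h

/-- The product of the first operators of the process. -/
def chainOp (rp rm : ℕ → Specialization) : ℕ → PowerSeries (Module.End ℂ (Fock ℂ))
  | 0 => seriesP (rm 0) * seriesQ (rp 0)
  | n + 1 => seriesP (rm (n + 1)) * seriesQ (rp (n + 1)) * chainOp rp rm n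

/-- The product of the first operators `seriesQ`. -/
def prodQ (rp : ℕ → Specialization) : ℕ → PowerSeries (Module.End ℂ (Fock ℂ))
  | 0 => 1
  | n + 1 => seriesQ (rp n) * prodQ rp n

/-- The product of the first operators `seriesP`. -/
def prodP (rm : ℕ → Specialization) : ℕ → PowerSeries (Module.End ℂ (Fock ℂ))
  | 0 => 1
  | n + 1 => seriesP (rm n) * prodP rm n

theorem seriesP_mul_prodQ (rp : ℕ → Specialization) (b : Specialization) (n : ℕ) :
    seriesP b * prodQ rp n =
      scalarSeries (∏ i ∈ Finset.range n, gradedH (rp i) b) * (prodQ rp n * seriesP b) := by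
  induction n with
  | zero => simp [prodQ]
  | succ n ih =>
    rw [prodQ, ← mul_assoc, seriesP_mul_seriesQ, mul_assoc, mul_assoc, ih, Finset.prod_range_succ,
      mul_comm (∏ i ∈ _, _), map_mul, ← mul_assoc (seriesQ _),
      ← (scalarSeries_commute _ (seriesQ _)).eq]
    simp only [mul_assoc]

/-- Normal ordering: the factor `seriesP (rm j)` passes all `seriesQ (rp i)` with `i ≤ j`. As `rm j`
stands for `ρ_{j+1}⁻`, these are the pairs `i < j + 1` of the statement. -/
theorem chainOp_eq (rp rm : ℕ → Specialization) (n : ℕ) :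
    chainOp rp rm n =
      scalarSeries (∏ j ∈ Finset.range (n + 1), ∏ i ∈ Finset.range (j + 1),
        gradedH (rp i) (rm j)) * (prodQ rp (n + 1) * prodP rm (n + 1)) := by
  induction n with
  | zero => simp [chainOp, prodQ, prodP, seriesP_mul_seriesQ]
  | succ n ih =>
    rw [chainOp, ih, Finset.prod_range_succ _ (n + 1), map_mul, ← mul_assoc,
      ← (scalarSeries_commute _ _).eq, mul_assoc, mul_assoc, mul_assoc]
    congr 1
    rw [← mul_assoc (seriesQ _)]
    change seriesP (rm (n + 1)) * (prodQ rp (n + 1 + 1) * prodP rm (n + 1)) = _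
    rw [← mul_assoc, seriesP_mul_prodQ, mul_assoc, mul_assoc]
    rfl

theorem vacuum_chainOp (rp rm : ℕ → Specialization) (n : ℕ) :
    vacuum (chainOp rp rm n) = ∏ j ∈ Finset.range (n + 1), ∏ i ∈ Finset.range (j + 1),
        gradedH (rp i) (rm j) := by
  classical
  have h1 : ∀ n x, vacuum (prodQ rp n * x) = vacuum x := by
    intro n x
    induction n with
    | zero => simp [prodQ]
    | succ n ih => rw [prodQ, mul_assoc, vacuum_seriesQ_mul, ih]
  have h2 : ∀ n x, vacuum (x * prodP rm n) = vacuum x := by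
    intro n
    induction n with
    | zero => simp [prodP]
    | succ n ih =>
      intro x
      rw [prodP, ← mul_assoc, ih, vacuum_mul_seriesP]
  have h3 : vacuum 1 = 1 := by
    ext N
    rw [vacuum, coeff_mk, coeff_one, coeff_one]
    split_ifs with h
    · rw [entry_one, if_pos rfl]
    · rfl
  rw [chainOp_eq, vacuum_scalarSeries_mul, h1, ← one_mul (prodP rm (n + 1)), h2, h3, mul_one]

end ShiftedSchur

end

/-! ### The sum of the weights of given degree as a matrix entry. -/

noncomputable section

namespace ShiftedSchur

open StrictPartition PowerSeries
open Finset.HasAntidiagonal (antidiagonal mem_antidiagonal)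

/-- The weight of a pair of sequences, with a final partition `bet` in place of `∅`. -/
def chainWeight (rp rm : ℕ → Specialization) (n : ℕ) (bet : StrictPartition)
    (p : PartitionSequences n) : ℂ :=
  ∏ k : Fin (n + 1),
    rp k (skewQ (p.1 k) (Fin.cons (α := fun _ => StrictPartition) empty p.2 k)) *
      rm k (skewP (p.1 k) (Fin.snoc (α := fun _ => StrictPartition) p.2 bet k))

open Classical in
/-- The weight in a given degree. -/
def degreeWeight (rp rm : ℕ → Specialization) (n N : ℕ) (bet : StrictPartition)
    (p : PartitionSequences n) : ℂ :=
  if p ∈ ofDegree n N then chainWeight rp rm n bet p else 0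

/-- Appending one more partition to either sequence. -/
def appendEquiv (n : ℕ) :
    (StrictPartition × PartitionSequences n) × StrictPartition ≃ PartitionSequences (n + 1) where
  toFun x := (Fin.snoc (α := fun _ => StrictPartition) x.1.2.1 x.2,
    Fin.snoc (α := fun _ => StrictPartition) x.1.2.2 x.1.1)
  invFun p := ((p.2 (Fin.last n), (Fin.init p.1, Fin.init p.2)), p.1 (Fin.last (n + 1)))
  left_inv x := by simp
  right_inv p := by simp

theorem chainWeight_append (rp rm : ℕ → Specialization) (n : ℕ) (bet : StrictPartition)
    (x : (StrictPartition × PartitionSequences n) × StrictPartition) :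
    chainWeight rp rm (n + 1) bet (appendEquiv n x) =
      rm (n + 1) (skewP x.2 bet) * rp (n + 1) (skewQ x.2 x.1.1) *
        chainWeight rp rm n x.1.1 x.1.2 := by
  rw [chainWeight, Fin.prod_univ_castSucc]
  simp only [appendEquiv, Equiv.coe_fn_mk, Fin.cons_snoc_eq_snoc_cons, Fin.snoc_castSucc,
    Fin.snoc_last, Fin.val_last, Fin.val_castSucc]
  rw [chainWeight]
  ring

theorem append_mem_ofDegree (n N : ℕ)
    (x : (StrictPartition × PartitionSequences n) × StrictPartition) :
    appendEquiv n x ∈ ofDegree (n + 1) N ↔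
      ∑ k, (x.1.2.1 k).size + x.2.size = N + (∑ k, (x.1.2.2 k).size + x.1.1.size) := by
  change ∑ k, ((appendEquiv n x).1 k).size = N + ∑ k, ((appendEquiv n x).2 k).size ↔ _
  have h1 : ∑ k, ((appendEquiv n x).1 k).size = ∑ k, (x.1.2.1 k).size + x.2.size := by
    rw [Fin.sum_univ_castSucc]
    simp only [appendEquiv, Equiv.coe_fn_mk, Fin.snoc_castSucc, Fin.snoc_last]
  have h2 : ∑ k, ((appendEquiv n x).2 k).size = ∑ k, (x.1.2.2 k).size + x.1.1.size := by
    rw [Fin.sum_univ_castSucc]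
    simp only [appendEquiv, Equiv.coe_fn_mk, Fin.snoc_castSucc, Fin.snoc_last]
  rw [h1, h2]

/-- The partitions in a sequence of nonzero weight are small. -/
theorem size_le_of_chainWeight_ne_zero {rp rm : ℕ → Specialization} {n : ℕ}
    {bet : StrictPartition} {p : PartitionSequences n} (h : chainWeight rp rm n bet p ≠ 0) :
    bet.size + ∑ k, (p.2 k).size ≤ ∑ k, (p.1 k).size := by
  induction n generalizing bet with
  | zero =>
    simp only [chainWeight, Fin.prod_univ_succ, Finset.univ_eq_empty, Finset.prod_empty,
      mul_one] at h
    have := (contained_of_skewP_ne_zero (right_ne_zero_of_mul h)).size_le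
    simpa [Fin.snoc] using this
  | succ n ih =>
    obtain ⟨x, rfl⟩ := (appendEquiv n).surjective p
    rw [chainWeight_append] at h
    have h1 := ih (right_ne_zero_of_mul h)
    have h2 := (contained_of_skewP_ne_zero (left_ne_zero_of_mul (left_ne_zero_of_mul h))).size_le
    rw [Fin.sum_univ_castSucc, Fin.sum_univ_castSucc]
    simp only [appendEquiv, Equiv.coe_fn_mk, Fin.snoc_castSucc, Fin.snoc_last]
    omega

/-- The degree of the longer pair is that of the shorter one plus the difference of the sizes of the
two appended partitions. Written as a sum over an antidiagonal, with at most one nonzero term, this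
matches the product of series in `chainOp`. -/
theorem degreeWeight_append (rp rm : ℕ → Specialization) (n N : ℕ) (bet : StrictPartition)
    (x : (StrictPartition × PartitionSequences n) × StrictPartition) :
    degreeWeight rp rm (n + 1) N bet (appendEquiv n x) =
      ∑ q ∈ antidiagonal N,
        (if x.2.size = x.1.1.size + q.1 then
          rm (n + 1) (skewP x.2 bet) * rp (n + 1) (skewQ x.2 x.1.1) else 0) *
        degreeWeight rp rm n q.2 x.1.1 x.1.2 := by
  classical
  have key : ∀ q ∈ antidiagonal N, (if x.2.size = x.1.1.size + q.1 then
          rm (n + 1) (skewP x.2 bet) * rp (n + 1) (skewQ x.2 x.1.1) else 0) *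
        degreeWeight rp rm n q.2 x.1.1 x.1.2 =
      if x.2.size = x.1.1.size + q.1 ∧ x.1.2 ∈ ofDegree n q.2 then
        chainWeight rp rm (n + 1) bet (appendEquiv n x) else 0 := by
    intro q _
    rw [chainWeight_append, degreeWeight, ite_and, ite_mul, mul_ite, zero_mul, mul_zero]
  rw [Finset.sum_congr rfl key, degreeWeight]
  -- If the weight is nonzero, the containments force the size differences to be nonnegative, so the
  -- natural subtractions below are genuine.
  by_cases hw : chainWeight rp rm (n + 1) bet (appendEquiv n x) = 0
  · simp [hw]
  · have hw' := hw
    rw [chainWeight_append] at hw'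
    have h1 := (contained_of_skewQ_ne_zero (right_ne_zero_of_mul (left_ne_zero_of_mul hw'))).size_le
    have h2 := size_le_of_chainWeight_ne_zero (right_ne_zero_of_mul hw')
    split_ifs with hN
    · rw [append_mem_ofDegree] at hN
      rw [Finset.sum_eq_single (x.2.size - x.1.1.size, N - (x.2.size - x.1.1.size))]
      · rw [if_pos]
        refine ⟨by simp only; omega, ?_⟩
        change ∑ k, (x.1.2.1 k).size = _ + ∑ k, (x.1.2.2 k).size
        simp only
        omega
      · rintro ⟨q1, q2⟩ hq hne
        rw [mem_antidiagonal] at hq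
        simp only at hq ⊢
        refine if_neg fun h => hne ?_
        rw [Prod.mk.injEq]
        omega
      · intro h
        rw [mem_antidiagonal] at h
        simp only at h
        omega
    · rw [append_mem_ofDegree] at hN
      symm
      refine Finset.sum_eq_zero fun q hq => if_neg fun h => hN ?_
      rw [mem_antidiagonal] at hq
      have h3 : ∑ k, (x.1.2.1 k).size = q.2 + ∑ k, (x.1.2.2 k).size := h.2
      omega

/-- Sequences of length one. -/
def oneEquiv : StrictPartition ≃ PartitionSequences 0 where
  toFun lam := (fun _ => lam, Fin.elim0)
  invFun p := p.1 0
  left_inv _ := rfl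
  right_inv p := by
    refine Prod.ext (funext fun k => ?_) (funext fun k => k.elim0)
    rw [Fin.fin_one_eq_zero k]

theorem degreeWeight_one (rp rm : ℕ → Specialization) (N : ℕ) (bet lam : StrictPartition) :
    degreeWeight rp rm 0 N bet (oneEquiv lam) =
      if lam.size = N then rm 0 (skewP lam bet) * rp 0 (skewQ lam empty) else 0 := by
  classical
  rw [degreeWeight]
  refine if_congr ?_ ?_ rfl
  · simp [ofDegree, oneEquiv]
  · simp [chainWeight, oneEquiv, Fin.snoc, mul_comm]

/-- A set containing the support of the weights after appending. -/
def appendSupport (rp rm : ℕ → Specialization) (n : ℕ) (q : ℕ × ℕ) :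
    Set ((StrictPartition × PartitionSequences n) × StrictPartition) :=
  {x | x.2.size = x.1.1.size + q.1 ∧ degreeWeight rp rm n q.2 x.1.1 x.1.2 ≠ 0}

theorem finite_appendSupport (rp rm : ℕ → Specialization) (n : ℕ) (q : ℕ × ℕ)
    (h : (Function.support fun x : StrictPartition × PartitionSequences n =>
      degreeWeight rp rm n q.2 x.1 x.2).Finite) : (appendSupport rp rm n q).Finite := by
  refine (h.biUnion fun y _ => (ofSize (y.1.size + q.1)).finite_toSet.image (Prod.mk y)).subset ?_
  rintro ⟨y, l⟩ ⟨h1, h2⟩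
  simp only [Set.mem_iUnion]
  exact ⟨y, h2, l, mem_ofSize.2 h1, rfl⟩

/-- Finiteness holds jointly in the final partition and the sequences, because the former is
contained in the last `lam`. The joint form is what the induction and the exchange of finite sums
need. -/
theorem finite_degreeWeight (rp rm : ℕ → Specialization) (n N : ℕ) :
    (Function.support fun x : StrictPartition × PartitionSequences n =>
      degreeWeight rp rm n N x.1 x.2).Finite := by
  induction n generalizing N with
  | zero =>
    refine ((sizeLE N ×ˢ (ofSize N).map oneEquiv.toEmbedding).finite_toSet).subset ?_
    rintro ⟨bet, p⟩ h
    obtain ⟨lam, rfl⟩ := oneEquiv.surjective p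
    rw [Function.mem_support, degreeWeight_one] at h
    obtain ⟨h1, h2⟩ := ite_ne_right_iff.1 h
    have h3 := (contained_of_skewP_ne_zero (left_ne_zero_of_mul h2)).size_le
    rw [Finset.mem_coe, Finset.mem_product]
    exact ⟨mem_sizeLE.2 (h3.trans h1.le), Finset.mem_map.2 ⟨lam, mem_ofSize.2 h1, rfl⟩⟩
  | succ n ih =>
    have hf : (⋃ q ∈ antidiagonal N, ⋃ x ∈ appendSupport rp rm n q, ⋃ bet ∈ sizeLE x.2.size,
        {(bet, appendEquiv n x)}).Finite := by
      refine Set.Finite.biUnion (antidiagonal N).finite_toSet fun q _ => ?_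
      refine (finite_appendSupport rp rm n q (ih q.2)).biUnion fun x _ => ?_
      exact (sizeLE x.2.size).finite_toSet.biUnion fun bet _ => Set.finite_singleton _
    refine hf.subset ?_
    rintro ⟨bet, p⟩ h
    obtain ⟨x, rfl⟩ := (appendEquiv n).surjective p
    rw [Function.mem_support, degreeWeight_append] at h
    obtain ⟨q, hq, h1⟩ := Finset.exists_ne_zero_of_sum_ne_zero h
    obtain ⟨h2, h3⟩ := ite_ne_right_iff.1 (left_ne_zero_of_mul h1)
    have h4 := (contained_of_skewP_ne_zero (left_ne_zero_of_mul h3)).size_le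
    simp only [Set.mem_iUnion, exists_prop]
    exact ⟨q, hq, x, ⟨h2, right_ne_zero_of_mul h1⟩, bet, mem_sizeLE.2 h4, rfl⟩

/-- The sum of the weights of given degree is a matrix entry of an operator. -/
theorem finsum_degreeWeight (rp rm : ℕ → Specialization) (n N : ℕ) (bet : StrictPartition) :
    ∑ᶠ p, degreeWeight rp rm n N bet p = matEntry (coeff N (chainOp rp rm n)) bet empty := by
  classical
  induction n generalizing N bet with
  | zero =>
    rw [← finsum_comp_equiv oneEquiv, chainOp, seriesP, seriesQ, coeff_C_mul, coeff_mk,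
      entry_specP_mul_specQ, size_empty, zero_add]
    simp only [degreeWeight_one]
    rw [finsum_eq_sum_of_support_subset (s := ofSize N)]
    · exact Finset.sum_congr rfl fun lam h => if_pos (mem_ofSize.1 h)
    · intro lam h
      exact mem_ofSize.2 (ite_ne_right_iff.1 h).1
  | succ n ih =>
    have hs : ∀ q ∈ antidiagonal N, (Function.support fun
        x : (StrictPartition × PartitionSequences n) × StrictPartition =>
        (if x.2.size = x.1.1.size + q.1 then
          rm (n + 1) (skewP x.2 bet) * rp (n + 1) (skewQ x.2 x.1.1) else 0) *
        degreeWeight rp rm n q.2 x.1.1 x.1.2).Finite := by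
      intro q _
      refine (finite_appendSupport rp rm n q (finite_degreeWeight rp rm n q.2)).subset ?_
      intro x hx
      exact ⟨(ite_ne_right_iff.1 (left_ne_zero_of_mul hx)).1, right_ne_zero_of_mul hx⟩
    rw [← finsum_comp_equiv (appendEquiv n)]
    simp only [degreeWeight_append]
    rw [finsum_sum_comm _ _ hs, chainOp, coeff_mul, entry_sum]
    refine Finset.sum_congr rfl fun q hq => ?_
    -- The sum over the last `lam` gives an entry of the new operators. The remaining sum over the
    -- new `mu` is the matrix product, this `mu` being the final partition of the shorter sequence.
    rw [finsum_curry _ (hs q hq), entry_mul, seriesP, seriesQ, coeff_C_mul, coeff_mk]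
    have h1 : ∀ y : StrictPartition × PartitionSequences n, ∑ᶠ l : StrictPartition,
        (if l.size = y.1.size + q.1 then
          rm (n + 1) (skewP l bet) * rp (n + 1) (skewQ l y.1) else 0) *
        degreeWeight rp rm n q.2 y.1 y.2 =
        matEntry (specP (rm (n + 1)) * specQ (rp (n + 1)) q.1) bet y.1 *
          degreeWeight rp rm n q.2 y.1 y.2 := by
      intro y
      rw [entry_specP_mul_specQ, finsum_eq_sum_of_support_subset (s := ofSize (y.1.size + q.1)),
        Finset.sum_mul]
      · exact Finset.sum_congr rfl fun l h => by rw [if_pos (mem_ofSize.1 h)]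
      · intro l h
        exact mem_ofSize.2 (ite_ne_right_iff.1 (left_ne_zero_of_mul h)).1
    simp only [h1]
    have hd := finite_degreeWeight rp rm n q.2
    rw [finsum_curry _ (hd.subset fun y hy => right_ne_zero_of_mul hy)]
    refine finsum_congr fun y => ?_
    rw [← ih, mul_finsum]

end ShiftedSchur

end

/-! ### Summation by degree and absolute convergence. -/

noncomputable section

namespace ShiftedSchur

open StrictPartition PowerSeries

/-- A finite sequence of specializations, extended to an infinite one. -/
def extendSpec {n : ℕ} (rho : Fin (n + 1) → Specialization) (k : ℕ) : Specialization :=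
  rho (Fin.ofNat (n + 1) k)

theorem extendSpec_val {n : ℕ} (rho : Fin (n + 1) → Specialization) (k : Fin (n + 1)) :
    extendSpec rho k = rho k := by
  rw [extendSpec, Fin.ofNat_val_eq_self]

theorem W_eq_chainWeight {n : ℕ} (rhoPlus rhoMinus : Fin (n + 1) → Specialization)
    (p : PartitionSequences n) :
    W rhoPlus rhoMinus p = chainWeight (extendSpec rhoPlus) (extendSpec rhoMinus) n empty p := by
  simp only [chainWeight, extendSpec_val, W]

theorem prod_triangle {M : Type*} [CommMonoid M] (n : ℕ) (f : ℕ → ℕ → M) :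
    ∏ i : Fin (n + 1), ∏ j : Fin (n + 1) with i.castSucc < j.succ, f i j =
      ∏ j ∈ Finset.range (n + 1), ∏ i ∈ Finset.range (j + 1), f i j := by
  simp only [Finset.prod_filter]
  rw [Finset.prod_comm, ← Fin.prod_univ_eq_prod_range
    (fun j => ∏ i ∈ Finset.range (j + 1), f i j) (n + 1)]
  refine Finset.prod_congr rfl fun j _ => ?_
  have h := Fin.prod_univ_eq_prod_range (fun i => if i < (j : ℕ) + 1 then f i j else 1) (n + 1)
  simp only [Fin.lt_def, Fin.val_castSucc, Fin.val_succ]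
  rw [h, ← Finset.prod_filter]
  refine Finset.prod_congr ?_ fun _ _ => rfl
  ext i
  simp only [Finset.mem_filter, Finset.mem_range]
  omega

theorem finsum_ofDegree {n : ℕ} (rhoPlus rhoMinus : Fin (n + 1) → Specialization) (N : ℕ) :
    ∑ᶠ p ∈ ofDegree n N, W rhoPlus rhoMinus p =
      coeff N (∏ i : Fin (n + 1), ∏ j : Fin (n + 1) with i.castSucc < j.succ,
        gradedH (rhoPlus i) (rhoMinus j)) := by
  classical
  have h := prod_triangle n fun i j => gradedH (extendSpec rhoPlus i) (extendSpec rhoMinus j)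
  simp only [extendSpec_val] at h
  rw [h, ← vacuum_chainOp, vacuum, coeff_mk, ← finsum_degreeWeight]
  refine finsum_congr fun p => ?_
  rw [finsum_eq_if, degreeWeight, W_eq_chainWeight]

theorem finite_ofDegree {n : ℕ} (rhoPlus rhoMinus : Fin (n + 1) → Specialization) (N : ℕ) :
    (ofDegree n N ∩ {p | W rhoPlus rhoMinus p ≠ 0}).Finite := by
  refine ((finite_degreeWeight (extendSpec rhoPlus) (extendSpec rhoMinus) n N).preimage
    (Prod.mk_right_injective empty).injOn).subset ?_
  rintro p ⟨h1, h2⟩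
  rw [Set.mem_ofPred_eq, W_eq_chainWeight] at h2
  rw [Set.mem_preimage, Function.mem_support]
  simp only [degreeWeight]
  rwa [if_pos h1]

/-- Summation by degree. -/
theorem hasSum_of_graded {ι : Type*} {f : ι → ℂ} (hf : Summable f) (deg : ι → ℕ) {c : ℕ → ℂ}
    (hfin : ∀ N, (Function.support f ∩ {i | deg i = N}).Finite)
    (hc : ∀ N, ∑ᶠ (i) (_ : deg i = N), f i = c N) :
    Summable (fun N => ‖c N‖) ∧ HasSum f (∑' N, c N) := by
  have hc' : ∀ N, ∑' i : {i // deg i = N}, f i = c N := by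
    intro N
    rw [← hc]
    refine (tsum_subtype {i | deg i = N} f).trans ?_
    rw [tsum_eq_finsum]
    · exact (finsum_mem_def {i | deg i = N} f).symm
    · refine (hfin N).subset fun i hi => ?_
      rw [Function.mem_support, Set.indicator_apply_ne_zero] at hi
      exact ⟨hi.2, hi.1⟩
  have hs : Summable fun x : Σ N, {i // deg i = N} => f x.2 :=
    (Equiv.sigmaFiberEquiv deg).summable_iff.2 hf
  have hn : Summable fun x : Σ N, {i // deg i = N} => ‖f x.2‖ := hs.norm
  refine ⟨Summable.of_nonneg_of_le (fun _ => norm_nonneg _) (fun N => ?_) hn.sigma, ?_⟩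
  · rw [← hc']
    exact norm_tsum_le_tsum_norm (hn.sigma_factor N)
  · have h := hs.tsum_sigma
    simp only [hc'] at h
    rw [← h]
    exact (Equiv.sigmaFiberEquiv deg).hasSum_iff.1 hs.hasSum

/-- The value at one of a finite product of absolutely convergent series. -/
theorem tsum_coeff_prod {ι : Type*} (s : Finset ι) (φ : ι → PowerSeries ℂ)
    (h : ∀ i ∈ s, Summable fun N => ‖coeff N (φ i)‖) :
    (Summable fun N => ‖coeff N (∏ i ∈ s, φ i)‖) ∧
      ∑' N, coeff N (∏ i ∈ s, φ i) = ∏ i ∈ s, ∑' N, coeff N (φ i) := by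
  classical
  induction s using Finset.induction_on with
  | empty =>
    simp only [Finset.prod_empty, coeff_one]
    refine ⟨summable_of_ne_finset_zero (s := {0}) fun N hN => ?_, ?_⟩
    · rw [if_neg (by simpa using hN), norm_zero]
    · rw [tsum_ite_eq]
  | insert i s hi ih =>
    obtain ⟨h1, h2⟩ := ih fun j hj => h j (Finset.mem_insert_of_mem hj)
    have h3 := h i (Finset.mem_insert_self i s)
    rw [Finset.prod_insert hi, Finset.prod_insert hi, ← h2]
    generalize ∏ j ∈ s, φ j = ψ at h1
    have h4 := summable_norm_sum_mul_antidiagonal_of_summable_norm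
      (f := fun N => coeff N (φ i)) (g := fun N => coeff N ψ) h3 h1
    have h5 := tsum_mul_tsum_eq_tsum_sum_antidiagonal_of_summable_norm
      (f := fun N => coeff N (φ i)) (g := fun N => coeff N ψ) h3 h1
    simp only [← coeff_mul] at h4 h5
    exact ⟨h4, h5.symm⟩

/-- Grouping by size preserves absolute convergence, so the graded series has the value `H a b` at
`u = 1`. -/
theorem hasSum_HTerm {a b : Specialization} (h : Summable (HTerm a b)) :
    (Summable fun N => ‖coeff N (gradedH a b)‖) ∧ ∑' N, coeff N (gradedH a b) = H a b := by
  obtain ⟨h1, h2⟩ := hasSum_of_graded h size (c := fun N => coeff N (gradedH a b))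
    (fun N => (ofSize N).finite_toSet.subset fun lam hl => mem_ofSize.2 hl.2)
    (fun N => by rw [gradedH, coeff_mk])
  exact ⟨h1, h2.tsum_eq.symm⟩

theorem mem_ofDegree_iff {n : ℕ} {rhoPlus rhoMinus : Fin (n + 1) → Specialization}
    {p : PartitionSequences n} (h : W rhoPlus rhoMinus p ≠ 0) (N : ℕ) :
    p ∈ ofDegree n N ↔ ∑ k, (p.1 k).size - ∑ k, (p.2 k).size = N := by
  rw [W_eq_chainWeight] at h
  have h1 := size_le_of_chainWeight_ne_zero h
  change ∑ k, (p.1 k).size = N + ∑ k, (p.2 k).size ↔ _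
  omega

theorem hasSum_W {n : ℕ} {rhoPlus rhoMinus : Fin (n + 1) → Specialization}
    (h : Summable (W rhoPlus rhoMinus)) :
    HasSum (W rhoPlus rhoMinus) (∑' N, coeff N
      (∏ i : Fin (n + 1), ∏ j : Fin (n + 1) with i.castSucc < j.succ,
        gradedH (rhoPlus i) (rhoMinus j))) := by
  refine (hasSum_of_graded h (fun p => ∑ k, (p.1 k).size - ∑ k, (p.2 k).size)
    (fun N => ?_) fun N => ?_).2
  · refine (finite_ofDegree rhoPlus rhoMinus N).subset ?_
    rintro p ⟨h1, h2⟩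
    exact ⟨(mem_ofDegree_iff h1 N).2 h2, h1⟩
  · rw [← finsum_ofDegree]
    refine finsum_congr fun p => ?_
    classical
    rw [finsum_eq_if, finsum_eq_if]
    -- Where the weight vanishes, the truncated difference of sizes may assign a wrong degree, but
    -- the term contributes nothing.
    by_cases hp : W rhoPlus rhoMinus p = 0
    · rw [hp, ite_self, ite_self]
    · exact if_congr (mem_ofDegree_iff hp N).symm rfl rfl

/-- The sequences which are constant on an interval, and empty outside of it. -/
def intervalSequences {n : ℕ} (i j : Fin (n + 1)) (lam : StrictPartition) :
    PartitionSequences n :=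
  (fun k => if (i : ℕ) ≤ k ∧ (k : ℕ) ≤ j then lam else empty,
    fun k => if (i : ℕ) ≤ k ∧ (k : ℕ) < j then lam else empty)

/-- Every factor is `Q_{kap/kap} = 1` or `P_{kap/kap} = 1`, except at the two ends of the interval,
where `lam` is created by `rhoPlus i` and destroyed by `rhoMinus j`. -/
theorem W_intervalSequences {n : ℕ} (rhoPlus rhoMinus : Fin (n + 1) → Specialization)
    {i j : Fin (n + 1)} (hij : i ≤ j) (lam : StrictPartition) :
    W rhoPlus rhoMinus (intervalSequences i j lam) = HTerm (rhoPlus i) (rhoMinus j) lam := by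
  rw [Fin.le_def] at hij
  have h1 : ∀ k : Fin (n + 1), Fin.cons (α := fun _ => StrictPartition) empty
      (intervalSequences i j lam).2 k = if (i : ℕ) < k ∧ (k : ℕ) ≤ j then lam else empty := by
    intro k
    induction k using Fin.cases with
    | zero => simp
    | succ k =>
      rw [Fin.cons_succ]
      exact if_congr (by rw [Fin.val_succ]; omega) rfl rfl
  have h2 : ∀ k : Fin (n + 1), Fin.snoc (α := fun _ => StrictPartition)
      (intervalSequences i j lam).2 empty k =
        if (i : ℕ) ≤ k ∧ (k : ℕ) < j then lam else empty := by
    intro k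
    induction k using Fin.lastCases with
    | last =>
      rw [Fin.snoc_last, if_neg]
      rw [Fin.val_last]
      omega
    | cast k =>
      rw [Fin.snoc_castSucc]
      rfl
  have h3 : ∀ k : Fin (n + 1), rhoPlus k (skewQ ((intervalSequences i j lam).1 k)
      (if (i : ℕ) < k ∧ (k : ℕ) ≤ j then lam else empty)) =
        if k = i then rhoPlus i (schurQ lam) else 1 := by
    intro k
    change rhoPlus k (skewQ (if (i : ℕ) ≤ k ∧ (k : ℕ) ≤ j then lam else empty) _) = _
    split_ifs with ha hb hc hd he <;> try omega
    all_goals first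
      | rw [skewQ_self, map_one]
      | (subst_vars; rfl)
  have h4 : ∀ k : Fin (n + 1), rhoMinus k (skewP ((intervalSequences i j lam).1 k)
      (if (i : ℕ) ≤ k ∧ (k : ℕ) < j then lam else empty)) =
        if k = j then rhoMinus j (schurP lam) else 1 := by
    intro k
    change rhoMinus k (skewP (if (i : ℕ) ≤ k ∧ (k : ℕ) ≤ j then lam else empty) _) = _
    split_ifs with ha hb hc hd he <;> try omega
    all_goals first
      | rw [skewP_self, map_one]
      | (subst_vars; rfl)
  simp only [W, h1, h2, h3, h4, Finset.prod_mul_distrib, Finset.prod_ite_eq', Finset.mem_univ,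
    if_true, HTerm]

/-- The interval sequences exhibit the terms of this series as a subfamily of the weights, and a
subfamily of a summable family of complex numbers is summable. -/
theorem summable_HTerm {n : ℕ} {rhoPlus rhoMinus : Fin (n + 1) → Specialization}
    (h : Summable (W rhoPlus rhoMinus)) {i j : Fin (n + 1)} (hij : i.castSucc < j.succ) :
    Summable (HTerm (rhoPlus i) (rhoMinus j)) := by
  have hle : i ≤ j := by
    rw [Fin.lt_def, Fin.val_castSucc, Fin.val_succ] at hij
    exact Fin.le_def.2 (by omega)
  have hi : Function.Injective (intervalSequences (n := n) i j) := by
    intro a b hab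
    have h1 := congrFun (congrArg Prod.fst hab) i
    simp only [intervalSequences] at h1
    rwa [if_pos ⟨le_rfl, Fin.le_def.1 hle⟩, if_pos ⟨le_rfl, Fin.le_def.1 hle⟩] at h1
  refine (h.comp_injective hi).congr fun lam => ?_
  exact W_intervalSequences rhoPlus rhoMinus hle lam

/-- The value at one of the product of the graded series `H`. -/
theorem tsum_coeff_prod_gradedH {n : ℕ} {rhoPlus rhoMinus : Fin (n + 1) → Specialization}
    (h : ∀ i j : Fin (n + 1), i.castSucc < j.succ →
      Summable (HTerm (rhoPlus i) (rhoMinus j))) :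
    ∑' N, coeff N (∏ i : Fin (n + 1), ∏ j : Fin (n + 1) with i.castSucc < j.succ,
        gradedH (rhoPlus i) (rhoMinus j)) =
      ∏ i : Fin (n + 1), ∏ j : Fin (n + 1) with i.castSucc < j.succ,
        H (rhoPlus i) (rhoMinus j) := by
  have h1 := fun i : Fin (n + 1) => tsum_coeff_prod
    (Finset.univ.filter fun j : Fin (n + 1) => i.castSucc < j.succ)
    (fun j => gradedH (rhoPlus i) (rhoMinus j))
    fun j hj => (hasSum_HTerm (h i j (Finset.mem_filter.1 hj).2)).1
  have h2 := tsum_coeff_prod Finset.univ _ fun i _ => (h1 i).1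
  refine h2.2.trans (Finset.prod_congr rfl fun i _ => (h1 i).2.trans ?_)
  exact Finset.prod_congr rfl fun j hj => (hasSum_HTerm (h i j (Finset.mem_filter.1 hj).2)).2

end ShiftedSchur

end

theorem proposition2p1 (n : ℕ) (rhoPlus rhoMinus : Fin (n + 1) → Specialization) :
    -- the skew functions are symmetric functions, so that specializations apply to them
    (∀ lam mu : StrictPartition, skewQSeries lam mu ∈ Lambda) ∧
    -- the identity of graded series, without any convergence assumption
    (∀ N : ℕ, (ofDegree n N ∩ {p | W rhoPlus rhoMinus p ≠ 0}).Finite ∧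
      ∑ᶠ p ∈ ofDegree n N, W rhoPlus rhoMinus p =
        PowerSeries.coeff N (∏ i : Fin (n + 1), ∏ j : Fin (n + 1) with i.castSucc < j.succ,
          gradedH (rhoPlus i) (rhoMinus j))) ∧
    -- the identity of numbers, whenever the sum of the weights converges
    (Summable (W rhoPlus rhoMinus) →
      (∀ i j : Fin (n + 1), i.castSucc < j.succ → Summable (HTerm (rhoPlus i) (rhoMinus j))) ∧
      HasSum (W rhoPlus rhoMinus)
        (∏ i : Fin (n + 1), ∏ j : Fin (n + 1) with i.castSucc < j.succ,
          H (rhoPlus i) (rhoMinus j))) := by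
  refine ⟨skewQSeries_mem_Lambda, fun N => ⟨finite_ofDegree rhoPlus rhoMinus N,
    finsum_ofDegree rhoPlus rhoMinus N⟩, fun h => ?_⟩
  have hH : ∀ i j : Fin (n + 1), i.castSucc < j.succ →
      Summable (HTerm (rhoPlus i) (rhoMinus j)) := fun _ _ hij => summable_HTerm h hij
  refine ⟨hH, ?_⟩
  rw [← tsum_coeff_prod_gradedH hH]
  exact hasSum_W h
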